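/- Theorem. Consider the following decision problem (Subset Feedback Vertex Set in split graphs, original version without marked edges). An instance consists of a split graph $G=(V,E)$, i.e. a finite simple undirected graph whose vertex set can be partitioned into a clique and an independent set (either may be empty; the partition is not part of the input), a terminal set $T\subseteq V$, and an integer $k$. The question is whether there is a set $S\subseteq V$ with $|S|\le k$ such that no cycle of $G-S$ contains a vertex of $T$. There is a deterministic algorithm that solves this problem in time $\mathcal{O}(1.350^{n})$, where $n=|V|$. Precisely: there are a single program $P$ of a random access machine (with addition, truncated subtraction, multiplication and integer division of natural numbers, indirect addressing, conditionals and loops; every instruction and every test costs one unit plus the numbers of binary digits of the addresses and values it handles) and a function $\tau:\mathbb{N}\to\mathbb{N}$ with $\tau(n)=\mathcal{O}(1.350^{n})$, such that for every $n\ge 0$ and every instance $(G,T,k)$ with $G$ a split graph on $n$ vertices, $P$, started on $(G,T,k)$ (given by $n$, the adjacency matrix of $G$, the indicator vector of $T$, and the sign and the binary digits of $k$, least significant digit first), halts at total cost at most $\tau(n)$ with the correct answer. -/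

import Mathlib

/-! ### Split graphs and subset feedback vertex sets -/

/-- A graph is a split graph if its vertex set can be partitioned into a clique `K` and an
independent set `Kᶜ` (either part may be empty). -/
def SimpleGraph.IsSplitGraph {V : Type*} (G : SimpleGraph V) : Prop :=
  ∃ K : Set V, G.IsClique K ∧ G.IsIndepSet Kᶜ

/-- `S` is a subset feedback vertex set of `G` for the terminal set `T`: no cycle of `G - S`
contains a terminal. -/
def SimpleGraph.IsSubsetFeedbackVertexSet {V : Type*} (G : SimpleGraph V) (T S : Set V) : Prop :=
  ∀ (v : (Sᶜ : Set V)) (c : (G.induce Sᶜ).Walk v v), c.IsCycle → ∀ u ∈ c.support, (u : V) ∉ T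

/-! ### Random access machines with logarithmic cost

A machine has registers `reg 0, reg 1, …` (a program names finitely many of them) and a memory
`mem 0, mem 1, …` that is addressed indirectly; all of them hold natural numbers. -/

namespace RAM

/-- A configuration: contents of the registers and of the memory. -/
structure State where
  reg : ℕ → ℕ
  mem : ℕ → ℕ

/-- Write `v` into register `x`. -/
def State.setReg (s : State) (x v : ℕ) : State :=
  ⟨Function.update s.reg x v, s.mem⟩

/-- Write `v` into the memory cell with address `a`. -/
def State.setMem (s : State) (a v : ℕ) : State :=
  ⟨s.reg, Function.update s.mem a v⟩

/-- The arithmetic operations on natural numbers; subtraction is truncated at `0`, division is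
the integer quotient (and `a / 0 = 0`). -/
inductive ArithOp where
  | add | sub | mul | div

/-- The value of an arithmetic operation. -/
def ArithOp.eval : ArithOp → ℕ → ℕ → ℕ
  | .add, a, b => a + b
  | .sub, a, b => a - b
  | .mul, a, b => a * b
  | .div, a, b => a / b

/-- Programs. The natural numbers `x`, `y`, `z` are names of registers. -/
inductive Prog where
  /-- `reg x := c` -/
  | const (x c : ℕ)
  /-- `reg x := reg y ∘ reg z` -/
  | arith (o : ArithOp) (x y z : ℕ)
  /-- `reg x := mem (reg y)` -/
  | load (x y : ℕ)
  /-- `mem (reg x) := reg y` -/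
  | store (x y : ℕ)
  /-- first `p`, then `q` -/
  | seq (p q : Prog)
  /-- if `reg x > 0` then `p` else `q` -/
  | ifPos (x : ℕ) (p q : Prog)
  /-- while `reg x > 0` do `p` -/
  | whilePos (x : ℕ) (p : Prog)

/-- `Exec p s t s'`: started in `s`, the program `p` halts in `s'`, at total cost `t`. Each
elementary instruction and each test costs one unit plus the number of binary digits
(`Nat.size`) of the addresses and values it handles. -/
inductive Exec : Prog → State → ℕ → State → Prop where
  | const (s : State) (x c : ℕ) :
      Exec (.const x c) s (1 + c.size) (s.setReg x c)
  | arith (s : State) (o : ArithOp) (x y z : ℕ) :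
      Exec (.arith o x y z) s (1 + (s.reg y).size + (s.reg z).size)
        (s.setReg x (o.eval (s.reg y) (s.reg z)))
  | load (s : State) (x y : ℕ) :
      Exec (.load x y) s (1 + (s.reg y).size + (s.mem (s.reg y)).size)
        (s.setReg x (s.mem (s.reg y)))
  | store (s : State) (x y : ℕ) :
      Exec (.store x y) s (1 + (s.reg x).size + (s.reg y).size)
        (s.setMem (s.reg x) (s.reg y))
  | seq {p q : Prog} {s s₁ s₂ : State} {t₁ t₂ : ℕ} :
      Exec p s t₁ s₁ → Exec q s₁ t₂ s₂ → Exec (.seq p q) s (t₁ + t₂) s₂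
  | ifPos_pos {x : ℕ} {p q : Prog} {s s' : State} {t : ℕ} :
      0 < s.reg x → Exec p s t s' → Exec (.ifPos x p q) s (1 + (s.reg x).size + t) s'
  | ifPos_zero {x : ℕ} {p q : Prog} {s s' : State} {t : ℕ} :
      s.reg x = 0 → Exec q s t s' → Exec (.ifPos x p q) s (1 + (s.reg x).size + t) s'
  | whilePos_pos {x : ℕ} {p : Prog} {s s₁ s₂ : State} {t₁ t₂ : ℕ} :
      0 < s.reg x → Exec p s t₁ s₁ → Exec (.whilePos x p) s₁ t₂ s₂ →
        Exec (.whilePos x p) s (1 + (s.reg x).size + t₁ + t₂) s₂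
  | whilePos_zero {x : ℕ} {p : Prog} {s : State} :
      s.reg x = 0 → Exec (.whilePos x p) s (1 + (s.reg x).size) s

/-- The initial configuration: the input word stands in the cells `0, 1, 2, …` of the memory,
all other cells and all registers hold `0`. -/
def initState (input : List ℕ) : State :=
  ⟨fun _ => 0, fun i => input.getD i 0⟩

/-- On the given input, the program halts within cost `t` and leaves in register `0` the
value `1` if the answer is yes and `0` if it is no. -/
def Prog.DecidesWithin (p : Prog) (input : List ℕ) (answer : Prop) (t : ℕ) : Prop :=
  ∃ (c : ℕ) (s : State), Exec p (initState input) c s ∧ c ≤ t ∧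
    (answer → s.reg 0 = 1) ∧ (¬ answer → s.reg 0 = 0)

end RAM

/-! ### Instances as inputs -/

open Classical in
/-- The input word of the instance `(G, T, k)` with vertex set `{0, …, n - 1}`: the number `n`
of vertices, the sign of `k` (`1` if negative, else `0`), the rows of the adjacency matrix of `G`,
the indicator vector of `T`, and the binary digits of `|k|`, least significant digit first, where
the digit `0` is written as `1`, the digit `1` as `2`; the zeros that follow mark the end. -/
noncomputable def sfvsInput {n : ℕ} (G : SimpleGraph (Fin n)) (T : Finset (Fin n)) (k : ℤ) :
    List ℕ :=
  [n, if k < 0 then 1 else 0]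
    ++ (List.finRange n).flatMap
        (fun i => (List.finRange n).map fun j => if G.Adj i j then 1 else 0)
    ++ (List.finRange n).map (fun i => if i ∈ T then 1 else 0)
    ++ k.natAbs.bits.map (fun b => if b then 2 else 1)

/-- The question of the original problem, without marked edges: is there a subset feedback
vertex set of size at most `k`? -/
def HasSubsetFVSOfSizeAtMost {n : ℕ} (G : SimpleGraph (Fin n)) (T : Finset (Fin n)) (k : ℤ) :
    Prop :=
  ∃ S : Finset (Fin n), (S.card : ℤ) ≤ k ∧
    G.IsSubsetFeedbackVertexSet (T : Set (Fin n)) (S : Set (Fin n))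

/-! Let `K` be the clique. A cycle through a terminal always yields a triangle through a terminal,
so only such triangles have to be destroyed (`isSubsetFeedbackVertexSet_iff`). If a solution leaves
at most two vertices of `K`, the optimum can be enumerated: deleting all but one vertex of `K`
suffices, and for a surviving pair the further deletions are forced (`pairSet`). If at least three
vertices of `K` survive, all terminals in `K` must go, and a selection problem remains. With `A = K
\ T` and `B = T \ K`, choose `C ⊆ A` so that `|C|` plus the number of `b ∈ B` with two neighbours
outside of `C` is small (`SplitGraph.exists_iff`).

The selection problem is solved by branching. A node `(P, D)` records elements of `A` that are kept
and deleted. Its lower bound charges only those `b` that have a neighbour in `P`; on sets avoiding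
`P` this function is submodular (`relCost_union_add_inter`). Its minimum is `|D|`, plus the number
of `b` with two kept neighbours, plus a bipartite vertex cover number (`relCost_eq`), which is
computed as a matching number by an auction (`Inv.card_owned_le`, `Inv.exists_cover`). By
submodularity, an element whose deletion leaves the bound unchanged may be deleted at once
(`feasible_essential`). When no active element is of this kind, both branches raise the bound;
keeping an element with two active neighbours raises it by two or makes further elements essential
(`lower_insert_left`). Hence the measure `1.3 ^ (k + 2 - lower) * 1.25 ^ #freeA * 1.121 ^ #activeB`
of a node is at least the sum over its children (`leafPotential_branch`). The budget may be cut down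
to `min #A #B`, and `1.3 * 1.25 * 1.121 < 1.3497 ^ 2`, so the root has measure at most `2 * 1.3497 ^
n` (`leafPotential_empty_le`).

For the machine, a language of bounded loops is compiled to programs. All values written are clamped
to `cap n`, so every command has polynomial cost (`Cmd.compile_spec`). The only unbounded loop is
the depth-first search. Each of its steps lowers the sum over the stack of `(2u + 1)` times the
measure by at least one, where `u` counts undecided elements (`SearchState.step`). A polynomial
times `1.3497 ^ n` is `O(1.350 ^ n)`. -/

/-! ### Polynomially bounded functions -/

/-- A function bounded by a polynomial. -/
def PolyBounded (f : ℕ → ℕ) : Prop :=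
  ∃ K d : ℕ, ∀ n, f n ≤ K * (n + 1) ^ d

namespace PolyBounded

theorem const (c : ℕ) : PolyBounded fun _ => c := ⟨c, 0, fun n => by simp⟩

theorem id : PolyBounded fun n => n := ⟨1, 1, fun n => by simp⟩

theorem add {f g : ℕ → ℕ} (hf : PolyBounded f) (hg : PolyBounded g) :
    PolyBounded fun n => f n + g n := by
  obtain ⟨K, d, hf⟩ := hf
  obtain ⟨L, e, hg⟩ := hg
  refine ⟨K + L, d + e, fun n => ?_⟩
  have h1 : (n + 1) ^ d ≤ (n + 1) ^ (d + e) := Nat.pow_le_pow_right (by omega) (by omega)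
  have h2 : (n + 1) ^ e ≤ (n + 1) ^ (d + e) := Nat.pow_le_pow_right (by omega) (by omega)
  calc f n + g n ≤ K * (n + 1) ^ d + L * (n + 1) ^ e := add_le_add (hf n) (hg n)
    _ ≤ K * (n + 1) ^ (d + e) + L * (n + 1) ^ (d + e) := by gcongr
    _ = _ := by ring

theorem mul {f g : ℕ → ℕ} (hf : PolyBounded f) (hg : PolyBounded g) :
    PolyBounded fun n => f n * g n := by
  obtain ⟨K, d, hf⟩ := hf
  obtain ⟨L, e, hg⟩ := hg
  refine ⟨K * L, d + e, fun n => ?_⟩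
  calc f n * g n ≤ (K * (n + 1) ^ d) * (L * (n + 1) ^ e) := Nat.mul_le_mul (hf n) (hg n)
    _ = _ := by ring

end PolyBounded

/-! ### Cost bounds for machine programs -/

namespace RAM

/-- The program `p`, started in `s`, halts within cost `b` in a state satisfying `Q`. -/
def Prog.Runs (p : Prog) (s : State) (b : ℕ) (Q : State → Prop) : Prop :=
  ∃ c s', Exec p s c s' ∧ c ≤ b ∧ Q s'

/-- Charging a value instead of its number of digits is affordable, since the values handled inside
one step of the algorithm are polynomial in `n`. -/
theorem size_le_self (x : ℕ) : x.size ≤ x := Nat.size_le.2 Nat.lt_two_pow_self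

namespace Prog.Runs

theorem mono {p : Prog} {s : State} {b b' : ℕ} {Q Q' : State → Prop} (h : p.Runs s b Q)
    (hb : b ≤ b') (hQ : ∀ s', Q s' → Q' s') : p.Runs s b' Q' := by
  obtain ⟨c, s', h1, h2, h3⟩ := h
  exact ⟨c, s', h1, h2.trans hb, hQ _ h3⟩

theorem const {s : State} {x c b : ℕ} {Q : State → Prop} (hb : 1 + c ≤ b)
    (hQ : Q (s.setReg x c)) : (Prog.const x c).Runs s b Q :=
  ⟨_, _, Exec.const s x c, by have := size_le_self c; omega, hQ⟩

theorem arith {s : State} {o : ArithOp} {x y z b : ℕ} {Q : State → Prop}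
    (hb : 1 + s.reg y + s.reg z ≤ b)
    (hQ : Q (s.setReg x (o.eval (s.reg y) (s.reg z)))) : (Prog.arith o x y z).Runs s b Q :=
  ⟨_, _, Exec.arith s o x y z,
    by have := size_le_self (s.reg y); have := size_le_self (s.reg z); omega, hQ⟩

theorem load {s : State} {x y b : ℕ} {Q : State → Prop}
    (hb : 1 + s.reg y + s.mem (s.reg y) ≤ b)
    (hQ : Q (s.setReg x (s.mem (s.reg y)))) : (Prog.load x y).Runs s b Q :=
  ⟨_, _, Exec.load s x y,
    by have := size_le_self (s.reg y); have := size_le_self (s.mem (s.reg y)); omega, hQ⟩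

theorem store {s : State} {x y b : ℕ} {Q : State → Prop}
    (hb : 1 + s.reg x + s.reg y ≤ b)
    (hQ : Q (s.setMem (s.reg x) (s.reg y))) : (Prog.store x y).Runs s b Q :=
  ⟨_, _, Exec.store s x y,
    by have := size_le_self (s.reg x); have := size_le_self (s.reg y); omega, hQ⟩

theorem seq {p q : Prog} {s : State} {b b₁ b₂ : ℕ} {R Q : State → Prop}
    (h₁ : p.Runs s b₁ R) (h₂ : ∀ s', R s' → q.Runs s' b₂ Q) (hb : b₁ + b₂ ≤ b) :
    (Prog.seq p q).Runs s b Q := by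
  obtain ⟨c, s', e, hc, hR⟩ := h₁
  obtain ⟨c', s'', e', hc', hQ⟩ := h₂ s' hR
  exact ⟨_, _, Exec.seq e e', by omega, hQ⟩

theorem ifPos {x : ℕ} {p q : Prog} {s : State} {b c : ℕ} {Q : State → Prop}
    (h₁ : 0 < s.reg x → p.Runs s c Q) (h₂ : s.reg x = 0 → q.Runs s c Q)
    (hb : 1 + s.reg x + c ≤ b) : (Prog.ifPos x p q).Runs s b Q := by
  have := size_le_self (s.reg x)
  rcases Nat.eq_zero_or_pos (s.reg x) with h | h
  · obtain ⟨c, s', e, hc, hQ⟩ := h₂ h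
    exact ⟨_, _, Exec.ifPos_zero h e, by omega, hQ⟩
  · obtain ⟨c, s', e, hc, hQ⟩ := h₁ h
    exact ⟨_, _, Exec.ifPos_pos h e, by omega, hQ⟩

/-- A loop whose counter register decreases by one in every iteration. -/
theorem countdown {x : ℕ} {p : Prog} {c : ℕ} {I : ℕ → State → Prop}
    (hx : ∀ j s, I j s → s.reg x = j)
    (h : ∀ j s, I (j + 1) s → p.Runs s c (I j)) :
    ∀ (m : ℕ) (s : State) (b : ℕ), I m s → m * (1 + m + c) + 1 ≤ b →
      (Prog.whilePos x p).Runs s b (I 0) := by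
  intro m
  induction m with
  | zero =>
    intro s b hI hb
    have h0 := hx _ _ hI
    refine ⟨_, _, Exec.whilePos_zero h0, ?_, hI⟩
    rw [h0]; simpa using hb
  | succ m ih =>
    intro s b hI hb
    have h0 := hx _ _ hI
    obtain ⟨c₁, s₁, e₁, hc₁, hI₁⟩ := h m s hI
    obtain ⟨c₂, s₂, e₂, hc₂, hI₂⟩ := ih s₁ _ hI₁ le_rfl
    refine ⟨_, _, Exec.whilePos_pos (by omega) e₁ e₂, ?_, hI₂⟩
    have := size_le_self (s.reg x)
    have h3 : m * (1 + m + c) ≤ m * (1 + (m + 1) + c) := by gcongr; omega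
    have h4 : (m + 1) * (1 + (m + 1) + c) = m * (1 + (m + 1) + c) + (1 + (m + 1) + c) := by ring
    omega

end Prog.Runs

/-! ### A small language of bounded loops, compiled to machine programs -/

/-- The register of a temporary. -/
def tmp (t : ℕ) : ℕ := 2 * t + 1

/-- The register of a variable. -/
def usr (x : ℕ) : ℕ := 2 * x + 2

@[simp] theorem tmp_inj {a b : ℕ} : tmp a = tmp b ↔ a = b := by unfold tmp; omega
@[simp] theorem usr_inj {a b : ℕ} : usr a = usr b ↔ a = b := by unfold usr; omega
@[simp] theorem tmp_ne_usr {a b : ℕ} : tmp a ≠ usr b := by unfold tmp usr; omega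
@[simp] theorem usr_ne_tmp {a b : ℕ} : usr a ≠ tmp b := by unfold tmp usr; omega
@[simp] theorem usr_ne_zero {a : ℕ} : usr a ≠ 0 := by unfold usr; omega
@[simp] theorem zero_ne_tmp {a : ℕ} : 0 ≠ tmp a := by unfold tmp; omega
@[simp] theorem zero_ne_usr {a : ℕ} : 0 ≠ usr a := by unfold usr; omega

/-- Expressions; `size` is the number `n` of vertices, and `sum x e` is the sum of the values of
`e` for `x = 0, …, n - 1`. -/
inductive Expr where
  | lit (c : ℕ)
  | size
  | var (x : ℕ)
  | load (e : Expr)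
  | op (o : ArithOp) (e f : Expr)
  | sum (x : ℕ) (e : Expr)

/-- The value of an expression, given the values of the variables and the memory. -/
def Expr.eval (n : ℕ) : Expr → (ℕ → ℕ) → (ℕ → ℕ) → ℕ
  | .lit c, _, _ => c
  | .size, _, _ => n
  | .var x, v, _ => v x
  | .load e, v, m => m (e.eval n v m)
  | .op o e f, v, m => o.eval (e.eval n v m) (f.eval n v m)
  | .sum x e, v, m => ∑ i ∈ Finset.range n, e.eval n (Function.update v x i) m

/-- Commands; `loop x c` executes `c` for `x = 0, …, n - 1`. -/
inductive Cmd where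
  | skip
  | set (x : ℕ) (e : Expr)
  | store (e f : Expr)
  | seq (c d : Cmd)
  | ite (e : Expr) (c d : Cmd)
  | loop (x : ℕ) (c : Cmd)

/-- Contents of the variables and of the memory. -/
structure Store where
  var : ℕ → ℕ
  mem : ℕ → ℕ

/-- Iteration with access to the index. -/
def iter {S : Type*} (f : ℕ → S → S) : ℕ → S → S
  | 0, s => s
  | k + 1, s => f k (iter f k s)

/-- The largest value that commands write. -/
def cap (n : ℕ) : ℕ := 3 * n + 5

/-- The effect of a command. -/
def Cmd.den (n : ℕ) : Cmd → Store → Store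
  | .skip, σ => σ
  | .set x e, σ => ⟨Function.update σ.var x (min (e.eval n σ.var σ.mem) (cap n)), σ.mem⟩
  | .store e f, σ => ⟨σ.var, Function.update σ.mem (e.eval n σ.var σ.mem)
      (min (f.eval n σ.var σ.mem) (cap n))⟩
  | .seq c d, σ => d.den n (c.den n σ)
  | .ite e c d, σ => if 0 < e.eval n σ.var σ.mem then c.den n σ else d.den n σ
  | .loop x c, σ => iter (fun i τ => c.den n ⟨Function.update τ.var x i, τ.mem⟩) n σ

/-- Compilation of an expression; the value is left in the temporary `t`. -/
def Expr.compile : Expr → ℕ → Prog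
  | .lit c, t => .const (tmp t) c
  -- A copy is an addition of zero. The bare `0` among the operands is the register number, and
  -- register `0` holds `n`.
  | .size, t => .seq (.const (tmp t) 0) (.arith .add (tmp t) 0 (tmp t))
  | .var x, t => .seq (.const (tmp t) 0) (.arith .add (tmp t) (usr x) (tmp t))
  | .load e, t => .seq (e.compile t) (.load (tmp t) (tmp t))
  | .op o e f, t =>
    .seq (e.compile t) (.seq (f.compile (t + 1)) (.arith o (tmp t) (tmp t) (tmp (t + 1))))
  | .sum x e, t =>
    -- Temporaries: `t` accumulates, `t + 1` counts down, `t + 2` saves the summation variable,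
    -- which is restored at the end, and `t + 3` is scratch.
    .seq (.const (tmp t) 0) <|
    .seq (.arith .add (tmp (t + 2)) (usr x) (tmp t)) <|
    .seq (.arith .add (tmp (t + 1)) 0 (tmp t)) <|
    .seq (.whilePos (tmp (t + 1))
      (.seq (.const (tmp (t + 3)) 1) <|
       .seq (.arith .sub (tmp (t + 1)) (tmp (t + 1)) (tmp (t + 3))) <|
       .seq (.const (tmp (t + 3)) 0) <|
       .seq (.arith .add (usr x) (tmp (t + 1)) (tmp (t + 3))) <|
       .seq (e.compile (t + 3)) <|
       .arith .add (tmp t) (tmp t) (tmp (t + 3)))) <|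
    .seq (.const (tmp (t + 3)) 0) <|
    .arith .add (usr x) (tmp (t + 2)) (tmp (t + 3))

/-- `tmp t := min (tmp t) (cap n)` -/
def clamp (t : ℕ) : Prog :=
  .seq (.const (tmp (t + 1)) 3) <|
  .seq (.arith .mul (tmp (t + 1)) (tmp (t + 1)) 0) <|
  .seq (.const (tmp (t + 2)) 5) <|
  .seq (.arith .add (tmp (t + 1)) (tmp (t + 1)) (tmp (t + 2))) <|
  -- With truncated subtraction, `x - (x - c)` is the minimum of `x` and `c`.
  .seq (.arith .sub (tmp (t + 1)) (tmp t) (tmp (t + 1))) <|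
  .arith .sub (tmp t) (tmp t) (tmp (t + 1))

/-- Compilation of a command, with temporaries from `t` on. -/
def Cmd.compile : Cmd → ℕ → Prog
  | .skip, t => .const (tmp t) 0
  | .set x e, t =>
    .seq (e.compile t) <| .seq (clamp t) <| .seq (.const (tmp (t + 1)) 0) <|
    .arith .add (usr x) (tmp t) (tmp (t + 1))
  | .store e f, t =>
    .seq (e.compile t) <| .seq (f.compile (t + 1)) <| .seq (clamp (t + 1)) <|
    .store (tmp t) (tmp (t + 1))
  | .seq c d, t => .seq (c.compile t) (d.compile t)
  | .ite e c d, t => .seq (e.compile t) (.ifPos (tmp t) (c.compile t) (d.compile t))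
  | .loop x c, t =>
    .seq (.const (tmp t) 0) <|
    .seq (.arith .add (tmp t) 0 (tmp t)) <|
    .whilePos (tmp t)
      -- The counter runs downwards from `n`; subtracting it from register `0` makes the index run
      -- upwards from zero.
      (.seq (.arith .sub (usr x) 0 (tmp t)) <|
       .seq (c.compile (t + 1)) <|
       .seq (.const (tmp (t + 1)) 1) <|
       .arith .sub (tmp t) (tmp t) (tmp (t + 1)))

/-- The machine state `s` represents `σ`. -/
structure Rep (n : ℕ) (σ : Store) (s : State) : Prop where
  size : s.reg 0 = n
  var : ∀ x, s.reg (usr x) = σ.var x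
  mem : s.mem = σ.mem

/-- All values are at most `cap n`. -/
structure Bdd (n : ℕ) (σ : Store) : Prop where
  var : ∀ x, σ.var x ≤ cap n
  mem : ∀ a, σ.mem a ≤ cap n

/-- The temporaries below `t` agree. -/
def Keeps (t : ℕ) (s s' : State) : Prop := ∀ i < t, s'.reg (tmp i) = s.reg (tmp i)

theorem Bdd.update {n : ℕ} {σ : Store} (h : Bdd n σ) (x i : ℕ) (hi : i ≤ cap n) :
    Bdd n ⟨Function.update σ.var x i, σ.mem⟩ :=
  ⟨fun y => by by_cases hy : y = x <;> simp [hy, hi, h.var], h.mem⟩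

theorem Bdd.updateMem {n : ℕ} {σ : Store} (h : Bdd n σ) (x i : ℕ) (hi : i ≤ cap n) :
    Bdd n ⟨σ.var, Function.update σ.mem x i⟩ :=
  ⟨h.var, fun y => by by_cases hy : y = x <;> simp [hy, hi, h.mem]⟩

theorem Keeps.refl (t : ℕ) (s : State) : Keeps t s s := fun _ _ => rfl

theorem Keeps.trans {t : ℕ} {s s' s'' : State} (h : Keeps t s s') (h' : Keeps t s' s'') :
    Keeps t s s'' := fun i hi => (h' i hi).trans (h i hi)

theorem Keeps.mono {t t' : ℕ} {s s' : State} (h : Keeps t s s') (ht : t' ≤ t) :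
    Keeps t' s s' := fun i hi => h i (hi.trans_le ht)

theorem Keeps.setReg_tmp {t u v : ℕ} {s s' : State} (h : Keeps t s s') (hu : t ≤ u) :
    Keeps t s (s'.setReg (tmp u) v) := fun i hi => by
  simp [State.setReg, show i ≠ u by omega, h i hi]

theorem Keeps.setReg_usr {t x v : ℕ} {s s' : State} (h : Keeps t s s') :
    Keeps t s (s'.setReg (usr x) v) := fun i hi => by
  simp [State.setReg, h i hi]

theorem Rep.setReg_tmp {n u v : ℕ} {σ : Store} {s : State} (h : Rep n σ s) :
    Rep n σ (s.setReg (tmp u) v) :=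
  ⟨by simp [State.setReg, h.size],
   fun x => by simp [State.setReg, h.var], h.mem⟩

theorem Rep.setReg_usr {n x v : ℕ} {σ : Store} {s : State} (h : Rep n σ s) :
    Rep n ⟨Function.update σ.var x v, σ.mem⟩ (s.setReg (usr x) v) :=
  ⟨by simp [State.setReg, h.size],
   fun y => by simp [State.setReg, Function.update_apply, h.var], h.mem⟩

@[simp] theorem State.setReg_reg (s : State) (x v y : ℕ) :
    (s.setReg x v).reg y = if y = x then v else s.reg y := by
  simp [State.setReg, Function.update_apply]

@[simp] theorem State.setReg_mem (s : State) (x v : ℕ) : (s.setReg x v).mem = s.mem := rfl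

/-! ### Correctness and cost of compiled expressions -/

theorem cap_polyBounded : PolyBounded cap :=
  ((PolyBounded.const 3).mul PolyBounded.id).add (PolyBounded.const 5)

theorem ArithOp.eval_le (o : ArithOp) {a b A B : ℕ} (ha : a ≤ A) (hb : b ≤ B) :
    o.eval a b ≤ A + B + A * B := by
  cases o
  · simp only [ArithOp.eval]; omega
  · simp only [ArithOp.eval]; omega
  · simp only [ArithOp.eval]; have := Nat.mul_le_mul ha hb; omega
  · simp only [ArithOp.eval]; have := Nat.div_le_self a b; omega

/-- Variables and cells are at most `cap n`, and each of the finitely many operations of a fixed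
expression, including a sum of `n` terms, keeps values polynomial. -/
theorem Expr.eval_bounded (e : Expr) : ∃ f, PolyBounded f ∧ ∀ n σ, Bdd n σ →
    e.eval n σ.var σ.mem ≤ f n := by
  induction e with
  | lit c => exact ⟨_, .const c, fun n σ _ => le_rfl⟩
  | size => exact ⟨_, .id, fun n σ _ => le_rfl⟩
  | var x => exact ⟨_, cap_polyBounded, fun n σ h => h.var x⟩
  | load e ih => exact ⟨_, cap_polyBounded, fun n σ h => h.mem _⟩
  | op o e f ihe ihf =>
    obtain ⟨F, hF, ihe⟩ := ihe
    obtain ⟨G, hG, ihf⟩ := ihf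
    exact ⟨_, (hF.add hG).add (hF.mul hG), fun n σ h => o.eval_le (ihe n σ h) (ihf n σ h)⟩
  | sum x e ih =>
    obtain ⟨F, hF, ih⟩ := ih
    refine ⟨_, PolyBounded.id.mul hF, fun n σ h => ?_⟩
    have := Finset.sum_le_card_nsmul (Finset.range n)
      (fun i => e.eval n (Function.update σ.var x i) σ.mem) (F n) fun i hi =>
        ih n _ (h.update x i (by have := Finset.mem_range.1 hi; unfold cap; omega))
    simpa [Expr.eval] using this

theorem Expr.compile_spec (e : Expr) : ∃ f, PolyBounded f ∧ ∀ n t σ s, Bdd n σ → Rep n σ s →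
    (e.compile t).Runs s (f n) fun s' => Rep n σ s' ∧ Keeps t s s' ∧
      s'.reg (tmp t) = e.eval n σ.var σ.mem := by
  induction e with
  | lit c =>
    exact ⟨_, .const (1 + c), fun n t σ s hb hr => .const le_rfl
      ⟨hr.setReg_tmp, (Keeps.refl t s).setReg_tmp le_rfl, by simp [Expr.eval]⟩⟩
  | size =>
    refine ⟨_, (PolyBounded.const 2).add .id, fun n t σ s hb hr => ?_⟩
    refine Prog.Runs.seq (b₁ := 1) (b₂ := 1 + n)
      (R := fun s' => s' = s.setReg (tmp t) 0) (.const le_rfl rfl) ?_ (by omega)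
    rintro _ rfl
    refine .arith (by simp [hr.size]) ⟨hr.setReg_tmp.setReg_tmp,
      ((Keeps.refl t s).setReg_tmp le_rfl).setReg_tmp le_rfl, ?_⟩
    simp [hr.size, ArithOp.eval, Expr.eval]
  | var x =>
    refine ⟨_, (PolyBounded.const 2).add cap_polyBounded, fun n t σ s hb hr => ?_⟩
    refine Prog.Runs.seq (b₁ := 1) (b₂ := 1 + cap n)
      (R := fun s' => s' = s.setReg (tmp t) 0) (.const le_rfl rfl) ?_ (by omega)
    rintro _ rfl
    refine .arith (by simpa [hr.var] using hb.var x) ⟨hr.setReg_tmp.setReg_tmp,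
      ((Keeps.refl t s).setReg_tmp le_rfl).setReg_tmp le_rfl, ?_⟩
    simp [hr.var, ArithOp.eval, Expr.eval]
  | load e ih =>
    obtain ⟨f, hf, ih⟩ := ih
    obtain ⟨g, hg, hv⟩ := e.eval_bounded
    refine ⟨_, (hf.add (.const 1)).add (hg.add cap_polyBounded), fun n t σ s hb hr => ?_⟩
    refine Prog.Runs.seq (b₁ := f n) (b₂ := 1 + g n + cap n) (ih n t σ s hb hr) ?_ (by omega)
    rintro s' ⟨hr', hk, he⟩
    refine .load ?_ ⟨hr'.setReg_tmp, hk.setReg_tmp le_rfl, ?_⟩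
    · have h1 := hv n σ hb
      have h2 := hb.mem (e.eval n σ.var σ.mem)
      rw [he, hr'.mem]; omega
    · simp [he, hr'.mem, Expr.eval]
  | op o e f ihe ihf =>
    obtain ⟨F, hF, ihe⟩ := ihe
    obtain ⟨G, hG, ihf⟩ := ihf
    obtain ⟨F', hF', hve⟩ := e.eval_bounded
    obtain ⟨G', hG', hvf⟩ := f.eval_bounded
    refine ⟨_, (hF.add hG).add ((PolyBounded.const 1).add (hF'.add hG')), fun n t σ s hb hr => ?_⟩
    refine Prog.Runs.seq (b₁ := F n) (b₂ := G n + (1 + F' n + G' n)) (ihe n t σ s hb hr) ?_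
      (by omega)
    rintro s' ⟨hr', hk, he⟩
    refine Prog.Runs.seq (ihf n (t + 1) σ s' hb hr') ?_ le_rfl
    rintro s'' ⟨hr'', hk', hf⟩
    have h3 : s''.reg (tmp t) = e.eval n σ.var σ.mem := by rw [hk' t (by omega), he]
    refine .arith ?_ ⟨hr''.setReg_tmp, (hk.trans (hk'.mono (by omega))).setReg_tmp le_rfl, ?_⟩
    · have h1 := hve n σ hb
      have h2 := hvf n σ hb
      rw [hf, h3]; omega
    · simp [h3, hf, Expr.eval]
  | sum x e ih =>
    obtain ⟨F, hF, ih⟩ := ih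
    obtain ⟨G, hG, hv⟩ := e.eval_bounded
    let c : ℕ → ℕ := fun n => 2 + (1 + (n + 1) + 1) + 1 + (1 + n) + F n + (1 + (n + 1) * G n + G n)
    have hc : PolyBounded c :=
      (((((PolyBounded.const 2).add (((PolyBounded.const 1).add (PolyBounded.id.add
        (.const 1))).add (.const 1))).add (.const 1)).add ((PolyBounded.const 1).add .id)).add
        hF).add (((PolyBounded.const 1).add ((PolyBounded.id.add (.const 1)).mul hG)).add hG)
    refine ⟨_, ((((PolyBounded.const 1).add ((PolyBounded.const 1).add cap_polyBounded)).add
      ((PolyBounded.const 1).add .id)).add ((PolyBounded.id.mul (((PolyBounded.const 1).add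
      .id).add hc)).add (.const 1))).add ((PolyBounded.const 2).add cap_polyBounded),
      fun n t σ s hb hr => ?_⟩
    let g : ℕ → ℕ := fun i => e.eval n (Function.update σ.var x i) σ.mem
    -- The index runs downwards, so the terms with index at least `j` have been added. The summation
    -- variable holds an unspecified `w`, being restored only after the loop.
    let I : ℕ → State → Prop := fun j s' => j ≤ n ∧
      (∃ w, Rep n ⟨Function.update σ.var x w, σ.mem⟩ s') ∧ Keeps t s s' ∧
      s'.reg (tmp (t + 1)) = j ∧ s'.reg (tmp (t + 2)) = σ.var x ∧
      s'.reg (tmp t) = ∑ i ∈ Finset.Ico j n, g i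
    have hg : ∀ i < n, g i ≤ G n := fun i hi =>
      hv n _ (hb.update x i (by unfold cap; omega))
    have hstep : ∀ j s', I (j + 1) s' → Prog.Runs
      (.seq (.const (tmp (t + 3)) 1) <|
       .seq (.arith .sub (tmp (t + 1)) (tmp (t + 1)) (tmp (t + 3))) <|
       .seq (.const (tmp (t + 3)) 0) <|
       .seq (.arith .add (usr x) (tmp (t + 1)) (tmp (t + 3))) <|
       .seq (e.compile (t + 3)) <|
       .arith .add (tmp t) (tmp t) (tmp (t + 3))) s' (c n) (I j) := by
      rintro j s' ⟨hj, ⟨w, hr'⟩, hk, h1, h2, h3⟩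
      refine Prog.Runs.seq (b₁ := 2)
        (b₂ := (1 + (n + 1) + 1) + 1 + (1 + n) + F n + (1 + (n + 1) * G n + G n))
        (.const le_rfl (Eq.refl _)) ?_ (by simp only [c]; omega)
      rintro _ rfl
      refine Prog.Runs.seq (b₁ := 1 + (n + 1) + 1)
        (b₂ := 1 + (1 + n) + F n + (1 + (n + 1) * G n + G n))
        (.arith (by simp [h1]; omega) (Eq.refl _)) ?_ (by omega)
      rintro _ rfl
      refine Prog.Runs.seq (b₁ := 1)
        (b₂ := (1 + n) + F n + (1 + (n + 1) * G n + G n))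
        (.const (by simp) (Eq.refl _)) ?_ (by omega)
      rintro _ rfl
      refine Prog.Runs.seq (b₁ := 1 + n)
        (b₂ := F n + (1 + (n + 1) * G n + G n))
        (.arith (by simp [h1, ArithOp.eval]; omega) (Eq.refl _)) ?_ (by omega)
      rintro _ rfl
      set s₁ := (((s'.setReg (tmp (t + 3)) 1).setReg (tmp (t + 1)) _).setReg (tmp (t + 3))
        0).setReg (usr x) _ with hs₁
      have hr₁ : Rep n ⟨Function.update σ.var x j, σ.mem⟩ s₁ := by
        have := ((hr'.setReg_tmp (u := t + 3) (v := 1)).setReg_tmp (u := t + 1) (v := j)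
          ).setReg_tmp (u := t + 3) (v := 0) |>.setReg_usr (x := x) (v := j)
        simpa [hs₁, h1, ArithOp.eval] using this
      refine Prog.Runs.seq (b₁ := F n) (ih n (t + 3) _ s₁ (hb.update x j (by unfold cap; omega))
        hr₁) ?_ le_rfl
      rintro s₂ ⟨hr₂, hk₂, h4⟩
      have e1 : s₂.reg (tmp t) = ∑ i ∈ Finset.Ico (j + 1) n, g i := by
        rw [hk₂ t (by omega), hs₁]; simp [h3]
      have e2 : s₂.reg (tmp (t + 1)) = j := by
        rw [hk₂ (t + 1) (by omega), hs₁]; simp [h1, ArithOp.eval]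
      have e3 : s₂.reg (tmp (t + 2)) = σ.var x := by
        rw [hk₂ (t + 2) (by omega), hs₁]; simp [h2]
      have e4 : s₂.reg (tmp (t + 3)) = g j := h4
      refine .arith ?_ ⟨by omega, ⟨j, hr₂.setReg_tmp⟩, ?_, by simp [e2], by simp [e3], ?_⟩
      · have b1 := hg j (by omega)
        have b2 : ∑ i ∈ Finset.Ico (j + 1) n, g i ≤ (n + 1) * G n := by
          refine (Finset.sum_le_card_nsmul _ _ (G n) fun i hi =>
            hg i (Finset.mem_Ico.1 hi).2).trans ?_
          simp only [Nat.card_Ico, smul_eq_mul]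
          gcongr; omega
        rw [e1, e4]; omega
      · refine Keeps.setReg_tmp (hk.trans ?_) le_rfl
        refine Keeps.trans ?_ (hk₂.mono (by omega))
        rw [hs₁]
        exact ((((Keeps.refl t s').setReg_tmp (by omega)).setReg_tmp (by omega)).setReg_tmp
          (by omega)).setReg_usr
      · simp only [State.setReg_reg, if_true, ArithOp.eval, e1, e4]
        rw [Finset.sum_eq_sum_Ico_succ_bot (by omega : j < n), add_comm]
    refine Prog.Runs.seq (b₁ := 1) (b₂ := (1 + cap n) + (1 + n) + (n * (1 + n + c n) + 1) +
      (2 + cap n)) (.const le_rfl (Eq.refl _)) ?_ (by omega)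
    rintro _ rfl
    refine Prog.Runs.seq (b₁ := 1 + cap n) (b₂ := (1 + n) + (n * (1 + n + c n) + 1) +
      (2 + cap n)) (.arith (by simpa [hr.var] using hb.var x) (Eq.refl _)) ?_ (by omega)
    rintro _ rfl
    refine Prog.Runs.seq (b₁ := 1 + n) (b₂ := (n * (1 + n + c n) + 1) + (2 + cap n))
      (.arith (by simp [hr.size]) (Eq.refl _)) ?_ (by omega)
    rintro _ rfl
    refine Prog.Runs.seq (b₁ := n * (1 + n + c n) + 1) (b₂ := 2 + cap n)
      (Prog.Runs.countdown (I := I) (fun j s h => h.2.2.2.1) hstep n _ _ ?_ le_rfl) ?_ (by omega)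
    · refine ⟨le_rfl, ⟨σ.var x, ?_⟩, ?_, ?_, ?_, ?_⟩
      · rw [Function.update_eq_self]
        exact hr.setReg_tmp.setReg_tmp.setReg_tmp
      · exact (((Keeps.refl t s).setReg_tmp le_rfl).setReg_tmp (by omega)).setReg_tmp (by omega)
      · simp [ArithOp.eval, hr.size]
      · simp [ArithOp.eval, hr.var]
      · simp
    rintro s₃ ⟨-, ⟨w, hr₃⟩, hk₃, -, h2, h3⟩
    refine Prog.Runs.seq (b₁ := 1) (b₂ := 1 + cap n) (.const (by simp) (Eq.refl _)) ?_ (by omega)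
    rintro _ rfl
    refine .arith (by simpa [h2] using hb.var x) ⟨?_, ?_, ?_⟩
    · have := (hr₃.setReg_tmp (u := t + 3) (v := 0)).setReg_usr (x := x) (v := σ.var x)
      rw [Function.update_idem, Function.update_eq_self] at this
      convert this using 2
      simp [h2, ArithOp.eval]
    · exact (hk₃.setReg_tmp (by omega)).setReg_usr
    · simp only [State.setReg_reg, tmp_ne_usr, tmp_inj, if_false, h3, Expr.eval, g,
        Finset.range_eq_Ico]
      simp

end RAM
-- Correctness and cost of compiled commands
namespace RAM

theorem iter_induction {S : Type*} {f : ℕ → S → S} (I : ℕ → S → Prop) {n : ℕ} {s : S}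
    (h0 : I 0 s) (h : ∀ i < n, ∀ t, I i t → I (i + 1) (f i t)) : I n (iter f n s) := by
  induction n with
  | zero => exact h0
  | succ k ih => exact h k (by omega) _ (ih fun i hi => h i (by omega))

/-- Every write is clamped and loop indices are below `n`. This invariant is what keeps costs
polynomial over exponentially many steps of the search. -/
theorem Cmd.den_bdd (c : Cmd) {n : ℕ} {σ : Store} (h : Bdd n σ) : Bdd n (c.den n σ) := by
  induction c generalizing σ with
  | skip => exact h
  | set x e => exact h.update _ _ (min_le_right _ _)
  | store e f => exact h.updateMem _ _ (min_le_right _ _)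
  | seq c d ihc ihd => exact ihd (ihc h)
  | ite e c d ihc ihd =>
    simp only [Cmd.den]
    split
    · exact ihc h
    · exact ihd h
  | loop x c ih =>
    exact iter_induction (fun _ τ => Bdd n τ) h fun i hi τ hτ =>
      ih (hτ.update x i (by unfold cap; omega))

theorem clamp_spec {n t V b : ℕ} {σ : Store} {s : State} (hr : Rep n σ s) (hV : s.reg (tmp t) ≤ V)
    (hb : 20 + 10 * n + 3 * V + 6 * cap n ≤ b) :
    (clamp t).Runs s b fun s' => Rep n σ s' ∧ Keeps t s s' ∧
      s'.reg (tmp t) = min (s.reg (tmp t)) (cap n) := by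
  have hcap : cap n = 3 * n + 5 := rfl
  refine Prog.Runs.seq (b₁ := 4) (b₂ := 14 + 10 * n + 3 * V + 6 * cap n)
    (.const le_rfl (Eq.refl _)) ?_ (by omega)
  rintro _ rfl
  refine Prog.Runs.seq (b₁ := 4 + n) (b₂ := 10 + 9 * n + 3 * V + 6 * cap n)
    (.arith (by simp [hr.size]) (Eq.refl _)) ?_ (by omega)
  rintro _ rfl
  refine Prog.Runs.seq (b₁ := 6) (b₂ := 4 + 9 * n + 3 * V + 6 * cap n)
    (.const le_rfl (Eq.refl _)) ?_ (by omega)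
  rintro _ rfl
  refine Prog.Runs.seq (b₁ := 6 + 3 * n) (b₂ := 3 * V + 5 * cap n)
    (.arith (by simp [hr.size, ArithOp.eval]; omega) (Eq.refl _)) ?_ (by omega)
  rintro _ rfl
  refine Prog.Runs.seq (b₁ := 1 + V + cap n) (b₂ := 1 + V + V)
    (.arith (by simp [hr.size, ArithOp.eval]; omega) (Eq.refl _)) ?_ (by omega)
  rintro _ rfl
  refine .arith (by simp [hr.size, ArithOp.eval]; omega)
    ⟨hr.setReg_tmp.setReg_tmp.setReg_tmp.setReg_tmp.setReg_tmp.setReg_tmp, ?_, ?_⟩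
  · exact ((((((Keeps.refl t s).setReg_tmp (by omega)).setReg_tmp (by omega)).setReg_tmp
      (by omega)).setReg_tmp (by omega)).setReg_tmp (by omega)).setReg_tmp (by omega)
  · simp [hr.size, ArithOp.eval]; omega

theorem Cmd.compile_spec (c : Cmd) : ∃ f, PolyBounded f ∧ ∀ n t σ s, Bdd n σ → Rep n σ s →
    (c.compile t).Runs s (f n) fun s' => Rep n (c.den n σ) s' ∧ Keeps t s s' := by
  induction c with
  | skip =>
    exact ⟨_, .const 1, fun n t σ s hb hr => .const le_rfl
      ⟨hr.setReg_tmp, (Keeps.refl t s).setReg_tmp le_rfl⟩⟩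
  | set x e =>
    obtain ⟨f, hf, he⟩ := e.compile_spec
    obtain ⟨g, hg, hv⟩ := e.eval_bounded
    refine ⟨_, (hf.add (((PolyBounded.const 20).add ((PolyBounded.const 10).mul .id)).add
      (((PolyBounded.const 3).mul hg).add ((PolyBounded.const 6).mul cap_polyBounded)))).add
      ((PolyBounded.const 2).add cap_polyBounded), fun n t σ s hb hr => ?_⟩
    have hv' := hv n σ hb
    refine Prog.Runs.seq (b₁ := f n) (b₂ := 20 + 10 * n + 3 * g n + 6 * cap n + (2 + cap n))
      (he n t σ s hb hr) ?_ (by omega)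
    rintro s₁ ⟨hr₁, hk₁, h₁⟩
    refine Prog.Runs.seq (b₁ := 20 + 10 * n + 3 * g n + 6 * cap n) (b₂ := 2 + cap n)
      (clamp_spec hr₁ (h₁.trans_le hv') le_rfl) ?_ le_rfl
    rintro s₂ ⟨hr₂, hk₂, h₂⟩
    refine Prog.Runs.seq (b₁ := 1) (b₂ := 1 + cap n) (.const le_rfl (Eq.refl _)) ?_ (by omega)
    rintro _ rfl
    refine .arith (by simp [h₂]) ⟨?_, ((hk₁.trans hk₂).setReg_tmp (by omega)).setReg_usr⟩
    have h4 := (hr₂.setReg_tmp (u := t + 1) (v := 0)).setReg_usr (x := x)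
      (v := min (e.eval n σ.var σ.mem) (cap n))
    simpa [h₂, h₁, ArithOp.eval, Cmd.den] using h4
  | store e f =>
    obtain ⟨F, hF, he⟩ := e.compile_spec
    obtain ⟨G, hG, hv⟩ := e.eval_bounded
    obtain ⟨F', hF', hf⟩ := f.compile_spec
    obtain ⟨G', hG', hv'⟩ := f.eval_bounded
    refine ⟨_, (hF.add hF').add ((((PolyBounded.const 20).add ((PolyBounded.const 10).mul
      .id)).add (((PolyBounded.const 3).mul hG').add ((PolyBounded.const 6).mul
      cap_polyBounded))).add (((PolyBounded.const 1).add hG).add cap_polyBounded)),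
      fun n t σ s hb hr => ?_⟩
    have hv := hv n σ hb
    have hv' := hv' n σ hb
    refine Prog.Runs.seq (b₁ := F n) (b₂ := F' n + (20 + 10 * n + 3 * G' n + 6 * cap n +
      (1 + G n + cap n))) (he n t σ s hb hr) ?_ (by omega)
    rintro s₁ ⟨hr₁, hk₁, h₁⟩
    refine Prog.Runs.seq (b₁ := F' n) (b₂ := 20 + 10 * n + 3 * G' n + 6 * cap n +
      (1 + G n + cap n)) (hf n (t + 1) σ s₁ hb hr₁) ?_ (by omega)
    rintro s₂ ⟨hr₂, hk₂, h₂⟩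
    refine Prog.Runs.seq (b₁ := 20 + 10 * n + 3 * G' n + 6 * cap n) (b₂ := 1 + G n + cap n)
      (clamp_spec hr₂ (h₂.trans_le hv') le_rfl) ?_ le_rfl
    rintro s₃ ⟨hr₃, hk₃, h₃⟩
    have h4 : s₃.reg (tmp t) = e.eval n σ.var σ.mem := by
      rw [hk₃ t (by omega), hk₂ t (by omega), h₁]
    rw [h₂] at h₃
    refine .store ?_ ⟨?_, hk₁.trans ((hk₂.trans hk₃).mono (by omega))⟩
    · rw [h₃, h4]
      have := min_le_right (f.eval n σ.var σ.mem) (cap n)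
      omega
    · rw [h₃, h4]
      exact ⟨hr₃.size, hr₃.var, by simp [State.setMem, hr₃.mem, Cmd.den]⟩
  | seq c d ihc ihd =>
    obtain ⟨f, hf, ihc⟩ := ihc
    obtain ⟨g, hg, ihd⟩ := ihd
    refine ⟨_, hf.add hg, fun n t σ s hb hr => ?_⟩
    refine Prog.Runs.seq (ihc n t σ s hb hr) ?_ le_rfl
    rintro s₁ ⟨hr₁, hk₁⟩
    exact (ihd n t _ s₁ (c.den_bdd hb) hr₁).mono le_rfl fun s₂ ⟨hr₂, hk₂⟩ =>
      ⟨hr₂, hk₁.trans hk₂⟩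
  | ite e c d ihc ihd =>
    obtain ⟨F, hF, he⟩ := e.compile_spec
    obtain ⟨G, hG, hv⟩ := e.eval_bounded
    obtain ⟨f, hf, ihc⟩ := ihc
    obtain ⟨g, hg, ihd⟩ := ihd
    refine ⟨_, hF.add (((PolyBounded.const 1).add hG).add (hf.add hg)), fun n t σ s hb hr => ?_⟩
    refine Prog.Runs.seq (he n t σ s hb hr) ?_ le_rfl
    rintro s₁ ⟨hr₁, hk₁, h₁⟩
    refine .ifPos (c := f n + g n) (fun h => ?_) (fun h => ?_) (by have := hv n σ hb; omega)
    · rw [h₁] at h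
      simp only [Cmd.den, h, if_true]
      exact (ihc n t _ s₁ hb hr₁).mono (by omega) fun s₂ ⟨hr₂, hk₂⟩ => ⟨hr₂, hk₁.trans hk₂⟩
    · rw [h₁] at h
      simp only [Cmd.den, h, lt_irrefl, if_false]
      exact (ihd n t _ s₁ hb hr₁).mono (by omega) fun s₂ ⟨hr₂, hk₂⟩ => ⟨hr₂, hk₁.trans hk₂⟩
  | loop x c ih =>
    obtain ⟨f, hf, ih⟩ := ih
    refine ⟨_, ((PolyBounded.const 2).add .id).add ((PolyBounded.id.mul (((PolyBounded.const
      1).add .id).add (((PolyBounded.const 1).add (PolyBounded.id.add .id)).add (hf.add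
      ((PolyBounded.const 4).add .id))))).add (.const 1)), fun n t σ s hb hr => ?_⟩
    let b : ℕ := 1 + (n + n) + (f n + (4 + n))
    let F : ℕ → Store → Store := fun i τ => c.den n ⟨Function.update τ.var x i, τ.mem⟩
    have hF : ∀ j ≤ n, Bdd n (iter F j σ) := fun j hj =>
      iter_induction (fun _ τ => Bdd n τ) hb fun i hi τ hτ =>
        c.den_bdd (hτ.update x i (by unfold cap; omega))
    -- With counter value `j`, exactly `n - j` iterations have been executed.
    let I : ℕ → State → Prop := fun j s' => j ≤ n ∧ Rep n (iter F (n - j) σ) s' ∧ Keeps t s s' ∧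
      s'.reg (tmp t) = j
    refine Prog.Runs.seq (b₁ := 1) (b₂ := 1 + n + (n * (1 + n + b) + 1)) (.const le_rfl
      (Eq.refl _)) ?_ (by simp only [b]; omega)
    rintro _ rfl
    refine Prog.Runs.seq (b₁ := 1 + n) (b₂ := n * (1 + n + b) + 1)
      (.arith (by simp [hr.size]) (Eq.refl _)) ?_ le_rfl
    rintro _ rfl
    refine (Prog.Runs.countdown (I := I) (c := b) (fun j s h => h.2.2.2) ?_ n _ _ ?_
      le_rfl).mono le_rfl ?_
    · rintro j s₁ ⟨hj, hr₁, hk₁, h₁⟩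
      refine Prog.Runs.seq (b₁ := 1 + (n + n)) (b₂ := f n + (4 + n))
        (.arith (by simp [hr₁.size, h₁]; omega) (Eq.refl _)) ?_ le_rfl
      rintro _ rfl
      have hj' : n - (j + 1) ≤ cap n := by unfold cap; omega
      have hr₂ : Rep n ⟨Function.update (iter F (n - (j + 1)) σ).var x (n - (j + 1)),
          (iter F (n - (j + 1)) σ).mem⟩ (s₁.setReg (usr x) (ArithOp.sub.eval (s₁.reg 0)
          (s₁.reg (tmp t)))) := by
        have := hr₁.setReg_usr (x := x) (v := n - (j + 1))
        simpa [hr₁.size, h₁, ArithOp.eval] using this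
      refine Prog.Runs.seq (b₁ := f n) (ih n (t + 1) _ _ ((hF _ (by omega)).update x _ hj') hr₂)
        ?_ le_rfl
      rintro s₃ ⟨hr₃, hk₃⟩
      have h3 : s₃.reg (tmp t) = j + 1 := by
        rw [hk₃ t (by omega)]; simp [h₁]
      refine Prog.Runs.seq (b₁ := 2) (b₂ := 2 + n) (.const le_rfl (Eq.refl _)) ?_ (by omega)
      rintro _ rfl
      refine .arith (by simp [h3]; omega) ⟨by omega, ?_, ?_, by simp [h3, ArithOp.eval]⟩
      · have e : n - j = (n - (j + 1)) + 1 := by omega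
        rw [e]
        exact hr₃.setReg_tmp.setReg_tmp
      · refine ((hk₁.trans ?_).setReg_tmp (by omega)).setReg_tmp (by omega)
        exact ((Keeps.refl t s₁).setReg_usr).trans (hk₃.mono (by omega))
    · refine ⟨le_rfl, ?_, ((Keeps.refl t s).setReg_tmp le_rfl).setReg_tmp le_rfl,
        by simp [hr.size, ArithOp.eval]⟩
      rw [Nat.sub_self]
      exact hr.setReg_tmp.setReg_tmp
    · rintro s₁ ⟨-, hr₁, hk₁, -⟩
      exact ⟨hr₁, hk₁⟩

/-- A loop whose body is a command, with an invariant that contains a decreasing potential. -/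
theorem Prog.Runs.whileCmd {x : ℕ} {c : Cmd} {n f : ℕ} (I : ℝ → Store → Prop)
    (hf : ∀ σ s, Bdd n σ → Rep n σ s → (c.compile 0).Runs s f fun s' => Rep n (c.den n σ) s')
    (hI : ∀ r σ, I r σ → Bdd n σ → 0 < σ.var x → ∃ r', I r' (c.den n σ) ∧ r' + 1 ≤ r)
    (h0 : ∀ r σ, I r σ → 0 ≤ r) :
    ∀ (m : ℕ) (r : ℝ) (σ : Store) (s : State), I r σ → Bdd n σ → Rep n σ s → r ≤ m →
      (Prog.whilePos (usr x) (c.compile 0)).Runs s ((m + 1) * (1 + cap n + f)) fun s' =>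
        ∃ r τ, I r τ ∧ Rep n τ s' ∧ τ.var x = 0 := by
  intro m
  induction m with
  | zero =>
    intro r σ s h hb hr hm
    have hs := size_le_self (s.reg (usr x))
    have hs' := hb.var x
    -- A nonnegative potential that is at most zero cannot drop by one, so the loop has ended.
    have hx : σ.var x = 0 := by
      by_contra hx
      obtain ⟨r', h1, h2⟩ := hI r σ h hb (by omega)
      have := h0 _ _ h1
      push_cast at hm
      linarith
    refine ⟨_, _, Exec.whilePos_zero (by rw [hr.var, hx]), ?_, r, σ, h, hr, hx⟩
    rw [hr.var] at *
    simp only [zero_add, one_mul]; omega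
  | succ m ih =>
    intro r σ s h hb hr hm
    have hs := size_le_self (s.reg (usr x))
    have hs' := hb.var x
    rw [hr.var] at hs
    have e : (m + 1 + 1) * (1 + cap n + f) = (m + 1) * (1 + cap n + f) + (1 + cap n + f) := by
      ring
    rcases Nat.eq_zero_or_pos (σ.var x) with hx | hx
    · refine ⟨_, _, Exec.whilePos_zero (by rw [hr.var, hx]), ?_, r, σ, h, hr, hx⟩
      rw [hr.var]; omega
    · obtain ⟨r', h1, h2⟩ := hI r σ h hb hx
      obtain ⟨c₁, s₁, e₁, hc₁, hr₁⟩ := hf σ s hb hr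
      obtain ⟨c₂, s₂, e₂, hc₂, hQ⟩ := ih r' _ s₁ h1 (c.den_bdd hb) hr₁
        (by push_cast at hm; linarith)
      refine ⟨_, _, Exec.whilePos_pos (by rw [hr.var]; exact hx) e₁ e₂, ?_, hQ⟩
      rw [hr.var]; omega

end RAM

/-! ### Selecting vertices of a bipartite graph

The sets `N b ⊆ A`, for `b ∈ B`, are given; a set `C ⊆ A` costs its size plus the number of
`b ∈ B` such that at least two elements of `N b` are outside of `C`. -/

namespace Selection

open Finset

variable {ι : Type*} [DecidableEq ι]

set_option linter.unusedSectionVars false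

/-- The cost of `C`. -/
def cost (B : Finset ι) (N : ι → Finset ι) (C : Finset ι) : ℕ :=
  #C + #{b ∈ B | 2 ≤ #(N b \ C)}

/-- The cost of `C`, where only those `b` are counted whose neighbourhood meets `P`. -/
def relCost (B : Finset ι) (N : ι → Finset ι) (P C : Finset ι) : ℕ :=
  #C + #{b ∈ B | (N b ∩ P).Nonempty ∧ 2 ≤ #(N b \ C)}

/-- `C` contains `D` and avoids `P`. -/
structure Extends (A P D C : Finset ι) : Prop where
  left : D ⊆ C
  right : C ⊆ A
  disj : Disjoint P C

/-- Disjoint subsets `P` (elements that are kept) and `D` (elements that are deleted). -/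
structure Valid (A P D : Finset ι) : Prop where
  left : P ⊆ A
  right : D ⊆ A
  disj : Disjoint P D

/-- The lower bound for the cost of a set that contains `D` and avoids `P`. -/
noncomputable def lower (A B : Finset ι) (N : ι → Finset ι) (P D : Finset ι) : ℕ :=
  sInf {m | ∃ C, Extends A P D C ∧ relCost B N P C = m}

/-- Some set that contains `D` and avoids `P` costs at most `k`. -/
def Feasible (A B : Finset ι) (N : ι → Finset ι) (P D : Finset ι) (k : ℕ) : Prop :=
  ∃ C, Extends A P D C ∧ cost B N C ≤ k

/-- The `b` that are not counted in the lower bound but may contribute to the cost. -/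
def activeB (B : Finset ι) (N : ι → Finset ι) (P D : Finset ι) : Finset ι :=
  {b ∈ B | N b ∩ P = ∅ ∧ 2 ≤ #(N b \ D)}

/-- The undecided elements of `A` with an active neighbour. -/
def activeA (A B : Finset ι) (N : ι → Finset ι) (P D : Finset ι) : Finset ι :=
  {a ∈ A | a ∉ P ∧ a ∉ D ∧ ∃ b ∈ activeB B N P D, a ∈ N b}

/-- The number of active neighbours. -/
def degree (B : Finset ι) (N : ι → Finset ι) (P D : Finset ι) (a : ι) : ℕ :=
  #{b ∈ activeB B N P D | a ∈ N b}

/-- Deleting `a` does not change the lower bound. -/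
def Essential (A B : Finset ι) (N : ι → Finset ι) (P D : Finset ι) (a : ι) : Prop :=
  lower A B N P (insert a D) = lower A B N P D

open Classical in
/-- The active elements of `A` that are not essential. -/
noncomputable def freeA (A B : Finset ι) (N : ι → Finset ι) (P D : Finset ι) : Finset ι :=
  {a ∈ activeA A B N P D | ¬ Essential A B N P D a}

/-- The potential for the number of leaves of the search tree. -/
noncomputable def leafPotential (A B : Finset ι) (N : ι → Finset ι) (k : ℕ) (P D : Finset ι) : ℝ :=
  -- The bases are chosen such that every case of `leafPotential_branch` closes while their product
  -- stays below `1.3497 ^ 2`. The offset `2` lets the truncated exponent lose up to two units at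
  -- any node with `lower ≤ k`.
  1.3 ^ (k + 2 - lower A B N P D) * 1.25 ^ #(freeA A B N P D) * 1.121 ^ #(activeB B N P D)

variable {A B : Finset ι} {N : ι → Finset ι} {P D : Finset ι} {k : ℕ}

/-! ### Submodularity and essential elements -/

theorem Valid.extends (h : Valid A P D) : Extends A P D D := ⟨Subset.rfl, h.right, h.disj⟩

theorem Valid.insert_left (h : Valid A P D) {a : ι} (ha : a ∈ A) (hD : a ∉ D) :
    Valid A (insert a P) D :=
  ⟨insert_subset ha h.left, h.right, disjoint_insert_left.2 ⟨hD, h.disj⟩⟩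

theorem Valid.insert_right (h : Valid A P D) {a : ι} (ha : a ∈ A) (hP : a ∉ P) :
    Valid A P (insert a D) :=
  ⟨h.left, insert_subset ha h.right, disjoint_insert_right.2 ⟨hP, h.disj⟩⟩

theorem Extends.inter {C C' : Finset ι} (h : Extends A P D C) (h' : Extends A P D C') :
    Extends A P D (C ∩ C') :=
  ⟨subset_inter h.left h'.left, inter_subset_left.trans h.right,
    h.disj.mono_right inter_subset_left⟩

theorem Extends.union {C C' : Finset ι} (h : Extends A P D C) (h' : Extends A P D C') :
    Extends A P D (C ∪ C') :=
  ⟨h.left.trans subset_union_left, union_subset h.right h'.right,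
    disjoint_union_right.2 ⟨h.disj, h'.disj⟩⟩

theorem Extends.of_insert {C : Finset ι} {a : ι} (h : Extends A P (insert a D) C) :
    Extends A P D C :=
  ⟨(subset_insert _ _).trans h.left, h.right, h.disj⟩

theorem lower_le {C : Finset ι} (h : Extends A P D C) : lower A B N P D ≤ relCost B N P C :=
  Nat.sInf_le ⟨C, h, rfl⟩

theorem exists_lower_eq (h : Valid A P D) :
    ∃ C, Extends A P D C ∧ relCost B N P C = lower A B N P D :=
  Nat.sInf_mem (s := {m | ∃ C, Extends A P D C ∧ relCost B N P C = m}) ⟨_, D, h.extends, rfl⟩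

theorem lower_le_lower_insert {a : ι} (h : Valid A P (insert a D)) :
    lower A B N P D ≤ lower A B N P (insert a D) := by
  obtain ⟨C, hC, e⟩ := exists_lower_eq (B := B) (N := N) h
  exact (lower_le hC.of_insert).trans_eq e

theorem Extends.valid_insert {C : Finset ι} {a : ι} (hv : Valid A P D) (hC : Extends A P D C)
    (ha : a ∈ C) : Valid A P (insert a D) :=
  hv.insert_right (hC.right ha) (disjoint_right.1 hC.disj ha)

/-- `a` is essential as soon as it lies in a set attaining the lower bound. -/
theorem essential_of_mem (hv : Valid A P D) {C : Finset ι} {a : ι} (hC : Extends A P D C)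
    (ha : a ∈ C) (e : relCost B N P C = lower A B N P D) : Essential A B N P D a :=
  le_antisymm ((lower_le ⟨insert_subset ha hC.left, hC.right, hC.disj⟩).trans_eq e)
    (lower_le_lower_insert (hC.valid_insert hv ha))

/-- Submodularity. -/
theorem relCost_union_add_inter {C C' : Finset ι} (hC : Disjoint P C) (hC' : Disjoint P C') :
    relCost B N P (C ∪ C') + relCost B N P (C ∩ C') ≤ relCost B N P C + relCost B N P C' := by
  set S : Finset ι → Finset ι := fun X => {b ∈ B | (N b ∩ P).Nonempty ∧ 2 ≤ #(N b \ X)} with hS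
  -- Submodularity holds for `#` and follows for the charged sets from two inclusions; this one is
  -- monotonicity.
  have h1 : S (C ∪ C') ⊆ S C ∩ S C' := by
    intro b
    simp only [hS, mem_filter, mem_inter]
    rintro ⟨hb, hP, h⟩
    exact ⟨⟨hb, hP, h.trans (card_le_card (sdiff_subset_sdiff Subset.rfl subset_union_left))⟩,
      hb, hP, h.trans (card_le_card (sdiff_subset_sdiff Subset.rfl subset_union_right))⟩
  have h2 : S (C ∩ C') ⊆ S C ∪ S C' := by
    intro b
    simp only [hS, mem_filter, mem_union]
    rintro ⟨hb, hP, h⟩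
    by_contra hcon
    have hc1 : #(N b \ C) ≤ 1 := by
      by_contra hc; exact hcon (Or.inl ⟨hb, hP, by omega⟩)
    have hc2 : #(N b \ C') ≤ 1 := by
      by_contra hc; exact hcon (Or.inr ⟨hb, hP, by omega⟩)
    -- The kept neighbour `p` avoids both sets. If `b` is charged for neither, then `p` is its only
    -- survivor in both cases, and hence also for the intersection. This is where the restriction to
    -- `b` meeting `P` is needed.
    obtain ⟨p, hp⟩ := hP
    rw [mem_inter] at hp
    have m1 : p ∈ N b \ C := mem_sdiff.2 ⟨hp.1, disjoint_left.1 hC hp.2⟩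
    have m2 : p ∈ N b \ C' := mem_sdiff.2 ⟨hp.1, disjoint_left.1 hC' hp.2⟩
    rw [card_le_one] at hc1 hc2
    have : N b \ (C ∩ C') ⊆ {p} := by
      intro x hx
      rw [mem_sdiff, mem_inter] at hx
      rw [mem_singleton]
      by_cases hxC : x ∈ C
      · exact hc2 x (mem_sdiff.2 ⟨hx.1, fun h => hx.2 ⟨hxC, h⟩⟩) p m2
      · exact hc1 x (mem_sdiff.2 ⟨hx.1, hxC⟩) p m1
    have := card_le_card this
    rw [card_singleton] at this
    omega
  have h3 := card_le_card h1
  have h4 := card_le_card h2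
  have h5 := card_union_add_card_inter (S C) (S C')
  have h6 := card_union_add_card_inter C C'
  simp only [hS] at h3 h4 h5
  unfold relCost
  omega

/-- The sets attaining the lower bound are closed under unions. -/
theorem relCost_union_eq {C C' : Finset ι} (hC : Extends A P D C) (hC' : Extends A P D C')
    (e : relCost B N P C = lower A B N P D) (e' : relCost B N P C' = lower A B N P D) :
    relCost B N P (C ∪ C') = lower A B N P D := by
  have h1 := relCost_union_add_inter (B := B) (N := N) hC.disj hC'.disj
  have h2 := lower_le (B := B) (N := N) (hC.inter hC')
  have h3 := lower_le (B := B) (N := N) (hC.union hC')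
  omega

/-- The part of the cost that the lower bound ignores. -/
theorem cost_eq (P C : Finset ι) :
    cost B N C = relCost B N P C + #{b ∈ B | N b ∩ P = ∅ ∧ 2 ≤ #(N b \ C)} := by
  have : ({b ∈ B | 2 ≤ #(N b \ C)} : Finset ι) =
      {b ∈ B | (N b ∩ P).Nonempty ∧ 2 ≤ #(N b \ C)} ∪
        {b ∈ B | N b ∩ P = ∅ ∧ 2 ≤ #(N b \ C)} := by
    ext b
    simp only [mem_filter, mem_union, nonempty_iff_ne_empty]
    tauto
  have hd : Disjoint ({b ∈ B | (N b ∩ P).Nonempty ∧ 2 ≤ #(N b \ C)} : Finset ι)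
      {b ∈ B | N b ∩ P = ∅ ∧ 2 ≤ #(N b \ C)} := by
    rw [disjoint_filter]
    rintro b - ⟨h, -⟩ ⟨h', -⟩
    exact h.ne_empty h'
  unfold cost relCost
  rw [this, card_union_of_disjoint hd]
  omega

theorem relCost_le_cost (P C : Finset ι) : relCost B N P C ≤ cost B N C := by
  rw [cost_eq P C]; omega

theorem Feasible.lower_le (h : Feasible A B N P D k) : lower A B N P D ≤ k := by
  obtain ⟨C, hC, hk⟩ := h
  exact (Selection.lower_le hC).trans ((relCost_le_cost P C).trans hk)

/-- Without active vertices, the lower bound is attained. -/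
theorem feasible_of_activeB_eq_empty (hv : Valid A P D) (h : activeB B N P D = ∅)
    (hk : lower A B N P D ≤ k) : Feasible A B N P D k := by
  obtain ⟨C, hC, e⟩ := exists_lower_eq (B := B) (N := N) hv
  refine ⟨C, hC, ?_⟩
  have : ({b ∈ B | N b ∩ P = ∅ ∧ 2 ≤ #(N b \ C)} : Finset ι) = ∅ := by
    refine subset_empty.1 (Subset.trans (fun b => ?_) h.subset)
    simp only [activeB, mem_filter]
    rintro ⟨h1, h2, h3⟩
    exact ⟨h1, h2, h3.trans (card_le_card (sdiff_subset_sdiff Subset.rfl hC.left))⟩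
  rw [cost_eq P C, this, e]
  simpa using hk

/-- An active `b` has neighbours outside of `D`, none of them kept; these are active elements of
`A`. -/
theorem activeB_eq_empty (hN : ∀ b, N b ⊆ A) (h : activeA A B N P D = ∅) :
    activeB B N P D = ∅ := by
  by_contra hne
  obtain ⟨b, hb⟩ := nonempty_iff_ne_empty.2 hne
  have hb' := hb
  simp only [activeB, mem_filter] at hb'
  obtain ⟨x, hx⟩ : (N b \ D).Nonempty := card_pos.1 (by omega)
  rw [mem_sdiff] at hx
  have : x ∈ activeA A B N P D := by
    refine mem_filter.2 ⟨hN b hx.1, fun hP => ?_, hx.2, b, hb, hx.1⟩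
    have : x ∈ N b ∩ P := mem_inter.2 ⟨hx.1, hP⟩
    rw [hb'.2.1] at this
    exact notMem_empty _ this
  rw [h] at this
  exact notMem_empty _ this

theorem feasible_branch (a : ι) :
    Feasible A B N P D k ↔ Feasible A B N (insert a P) D k ∨ Feasible A B N P (insert a D) k := by
  constructor
  · rintro ⟨C, hC, hk⟩
    by_cases h : a ∈ C
    · exact Or.inr ⟨C, ⟨insert_subset h hC.left, hC.right, hC.disj⟩, hk⟩
    · exact Or.inl ⟨C, ⟨hC.left, hC.right, disjoint_insert_left.2 ⟨h, hC.disj⟩⟩, hk⟩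
  · rintro (⟨C, hC, hk⟩ | ⟨C, hC, hk⟩)
    · exact ⟨C, ⟨hC.left, hC.right, (disjoint_insert_left.1 hC.disj).2⟩, hk⟩
    · exact ⟨C, hC.of_insert, hk⟩

/-- Persistency: join a solution `C` with an optimum `M` of the lower bound that contains `a`. The
intersection `C ∩ M` costs at least the bound, so by submodularity the union costs no more than `C`
in the charged part; the uncharged part only decreases when more is deleted. -/
theorem feasible_essential {a : ι} (hv : Valid A P D) (ha : a ∈ A) (hP : a ∉ P)
    (he : Essential A B N P D a) :
    Feasible A B N P D k ↔ Feasible A B N P (insert a D) k := by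
  refine ⟨?_, fun h => (feasible_branch a).2 (Or.inr h)⟩
  rintro ⟨C, hC, hk⟩
  obtain ⟨M, hM, e⟩ := exists_lower_eq (B := B) (N := N) (hv.insert_right ha hP)
  refine ⟨C ∪ M, ⟨hM.left.trans subset_union_right, union_subset hC.right hM.right,
    disjoint_union_right.2 ⟨hC.disj, hM.disj⟩⟩, ?_⟩
  have h1 := relCost_union_add_inter (B := B) (N := N) hC.disj hM.disj
  have h2 := lower_le (B := B) (N := N) (hC.inter hM.of_insert)
  have h3 : #{b ∈ B | N b ∩ P = ∅ ∧ 2 ≤ #(N b \ (C ∪ M))} ≤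
      #{b ∈ B | N b ∩ P = ∅ ∧ 2 ≤ #(N b \ C)} := by
    refine card_le_card fun b => ?_
    simp only [mem_filter]
    rintro ⟨hb, h, h'⟩
    exact ⟨hb, h, h'.trans (card_le_card (sdiff_subset_sdiff Subset.rfl subset_union_left))⟩
  rw [cost_eq P] at hk ⊢
  rw [he] at e
  omega

/-! #### The potential -/

theorem mem_activeA {a : ι} : a ∈ activeA A B N P D ↔
    a ∈ A ∧ a ∉ P ∧ a ∉ D ∧ ∃ b ∈ activeB B N P D, a ∈ N b := by
  simp [activeA]

theorem mem_activeB {b : ι} : b ∈ activeB B N P D ↔ b ∈ B ∧ N b ∩ P = ∅ ∧ 2 ≤ #(N b \ D) := by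
  simp [activeB]

theorem activeB_insert_right_subset (a : ι) :
    activeB B N P (insert a D) ⊆ activeB B N P D := by
  intro b
  simp only [mem_activeB]
  rintro ⟨h1, h2, h3⟩
  exact ⟨h1, h2, h3.trans (card_le_card (sdiff_subset_sdiff Subset.rfl (subset_insert _ _)))⟩

theorem activeA_insert_right_subset (a : ι) :
    activeA A B N P (insert a D) ⊆ (activeA A B N P D).erase a := by
  intro x
  simp only [mem_erase, mem_activeA, mem_insert, not_or]
  rintro ⟨h1, h2, ⟨h3, h3'⟩, b, h4, h5⟩
  exact ⟨h3, h1, h2, h3', b, activeB_insert_right_subset a h4, h5⟩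

theorem activeB_insert_left (a : ι) :
    activeB B N (insert a P) D = {b ∈ activeB B N P D | a ∉ N b} := by
  ext b
  simp only [mem_activeB, mem_filter]
  by_cases h : a ∈ N b
  · simp [h]
  · rw [inter_insert_of_notMem h]
    simp [h]

/-- Once `a` is kept, its active neighbours have a kept neighbour and are charged by the lower bound
from then on. -/
theorem card_activeB_insert_left (a : ι) :
    #(activeB B N (insert a P) D) + degree B N P D a = #(activeB B N P D) := by
  rw [activeB_insert_left, degree, add_comm]
  exact card_filter_add_card_filter_not _

theorem activeA_insert_left_subset (a : ι) :
    activeA A B N (insert a P) D ⊆ (activeA A B N P D).erase a := by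
  intro x
  simp only [mem_erase, mem_activeA, mem_insert, not_or, activeB_insert_left, mem_filter]
  rintro ⟨h1, ⟨h2, h2'⟩, h3, b, ⟨h4, -⟩, h5⟩
  exact ⟨h2, h1, h2', h3, b, h4, h5⟩

theorem freeA_subset : freeA A B N P D ⊆ activeA A B N P D := by
  classical
  exact filter_subset _ _

theorem leafPotential_pos : 0 < leafPotential A B N k P D := by
  unfold leafPotential; positivity

theorem one_le_leafPotential : 1 ≤ leafPotential A B N k P D := by
  unfold leafPotential
  have h1 : (1 : ℝ) ≤ 1.3 ^ (k + 2 - lower A B N P D) := one_le_pow₀ (by norm_num)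
  have h2 : (1 : ℝ) ≤ 1.25 ^ #(freeA A B N P D) := one_le_pow₀ (by norm_num)
  have h3 : (1 : ℝ) ≤ 1.121 ^ #(activeB B N P D) := one_le_pow₀ (by norm_num)
  exact one_le_mul_of_one_le_of_one_le (one_le_mul_of_one_le_of_one_le h1 h2) h3

/-- Translates drops of the three exponents by at least `i`, `j`, `l` into a factor `r`. The
conditions `lower ≤ k` and `i ≤ 2` make the truncated exponent fall by `i` even if the child exceeds
the budget. -/
theorem leafPotential_le {P' D' : Finset ι} {i j l : ℕ} {r : ℝ}
    (hk : lower A B N P D ≤ k) (hi : i ≤ 2)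
    (h1 : lower A B N P D + i ≤ lower A B N P' D')
    (h2 : #(freeA A B N P' D') + j ≤ #(freeA A B N P D))
    (h3 : #(activeB B N P' D') + l ≤ #(activeB B N P D))
    (hr : 1 ≤ r * (1.3 ^ i * 1.25 ^ j * 1.121 ^ l)) :
    leafPotential A B N k P' D' ≤ r * leafPotential A B N k P D := by
  have e1 : (1.3 : ℝ) ^ (k + 2 - lower A B N P' D') * 1.3 ^ i ≤
      1.3 ^ (k + 2 - lower A B N P D) := by
    rw [← pow_add]; exact pow_le_pow_right₀ (by norm_num) (by omega)
  have e2 : (1.25 : ℝ) ^ #(freeA A B N P' D') * 1.25 ^ j ≤ 1.25 ^ #(freeA A B N P D) := by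
    rw [← pow_add]; exact pow_le_pow_right₀ (by norm_num) h2
  have e3 : (1.121 : ℝ) ^ #(activeB B N P' D') * 1.121 ^ l ≤ 1.121 ^ #(activeB B N P D) := by
    rw [← pow_add]; exact pow_le_pow_right₀ (by norm_num) h3
  have hr0 : 0 < r := by
    by_contra h
    have : r * (1.3 ^ i * 1.25 ^ j * 1.121 ^ l) ≤ 0 :=
      mul_nonpos_of_nonpos_of_nonneg (by linarith) (by positivity)
    linarith
  have h4 : leafPotential A B N k P' D' * (1.3 ^ i * 1.25 ^ j * 1.121 ^ l) ≤
      leafPotential A B N k P D := by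
    unfold leafPotential
    calc _ = ((1.3 : ℝ) ^ (k + 2 - lower A B N P' D') * 1.3 ^ i) *
          (1.25 ^ #(freeA A B N P' D') * 1.25 ^ j) *
          (1.121 ^ #(activeB B N P' D') * 1.121 ^ l) := by ring
      _ ≤ _ := by gcongr
  have h0 := leafPotential_pos (A := A) (B := B) (N := N) (k := k) (P := P') (D := D')
  calc leafPotential A B N k P' D'
      ≤ leafPotential A B N k P' D' * (r * (1.3 ^ i * 1.25 ^ j * 1.121 ^ l)) :=
        le_mul_of_one_le_right h0.le hr
    _ = r * (leafPotential A B N k P' D' * (1.3 ^ i * 1.25 ^ j * 1.121 ^ l)) := by ring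
    _ ≤ _ := by gcongr

/-- Essential elements stay essential when an essential element is deleted. -/
theorem freeA_insert_right_subset {a : ι} (hv : Valid A P D) (ha : a ∈ A) (hP : a ∉ P)
    (he : Essential A B N P D a) : freeA A B N P (insert a D) ⊆ freeA A B N P D := by
  intro x hx
  simp only [freeA, mem_filter] at hx ⊢
  have hx' := (mem_activeA.1 hx.1)
  refine ⟨mem_of_mem_erase (activeA_insert_right_subset a hx.1), fun hex => hx.2 ?_⟩
  have hva := hv.insert_right ha hP
  obtain ⟨C, hC, e⟩ := exists_lower_eq (B := B) (N := N) hva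
  obtain ⟨C', hC', e'⟩ := exists_lower_eq (B := B) (N := N) (hv.insert_right hx'.1 hx'.2.1)
  rw [he] at e
  rw [hex] at e'
  -- Optima containing `a` and `x` respectively have an optimal union, which contains both; so `x`
  -- is still essential after `a` has been deleted.
  have h := relCost_union_eq hC.of_insert hC'.of_insert e e'
  have hU := hC.of_insert.union hC'.of_insert
  refine essential_of_mem hva (C := C ∪ C')
    ⟨insert_subset (mem_union_left _ (hC.left (mem_insert_self _ _))) hU.left, hU.right, hU.disj⟩
    (mem_union_right _ (hC'.left (mem_insert_self _ _))) (h.trans he.symm)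

/-- No exponent grows: the bound is unchanged by essentiality, and the free elements and the active
`b` can only become fewer. -/
theorem leafPotential_essential {a : ι} (hv : Valid A P D) (ha : a ∈ A) (hP : a ∉ P)
    (he : Essential A B N P D a) :
    leafPotential A B N k P (insert a D) ≤ leafPotential A B N k P D := by
  unfold leafPotential
  rw [he]
  gcongr
  · norm_num
  · exact freeA_insert_right_subset hv ha hP he
  · norm_num
  · exact activeB_insert_right_subset a

theorem lower_insert_right {a : ι} (hv : Valid A P D) (ha : a ∈ A) (hP : a ∉ P)
    (he : ¬ Essential A B N P D a) : lower A B N P D + 1 ≤ lower A B N P (insert a D) := by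
  have := lower_le_lower_insert (B := B) (N := N) (hv.insert_right ha hP)
  unfold Essential at he
  omega

/-- Keeping `a` increases the lower bound; if the increase is only `1` although `a` has two active
neighbours, then all neighbours of the active neighbours of `a` become essential. -/
theorem lower_insert_left {a : ι} (hv : Valid A P D) (ha : a ∈ activeA A B N P D)
    (hN : ∀ b, N b ⊆ A) (he : ∀ x ∈ activeA A B N P D, ¬ Essential A B N P D x) :
    lower A B N P D + 1 ≤ lower A B N (insert a P) D ∧
    (2 ≤ degree B N P D a → lower A B N P D + 2 ≤ lower A B N (insert a P) D ∨
      ∀ b ∈ activeB B N P D, a ∈ N b → ∀ x ∈ N b \ D, x ∉ freeA A B N (insert a P) D) := by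
  obtain ⟨haA, haP, haD, b₀, hb₀, hab₀⟩ := mem_activeA.1 ha
  have hva := hv.insert_left haA haD
  obtain ⟨C, hC, e⟩ := exists_lower_eq (B := B) (N := N) hva
  have hCP : Extends A P D C := ⟨hC.left, hC.right, (disjoint_insert_left.1 hC.disj).2⟩
  have haC : a ∉ C := (disjoint_insert_left.1 hC.disj).1
  -- For an optimum `C` of the node that keeps `a`, the set `E` consists of the `b` newly charged
  -- because of `a`. The new bound is the old relative cost of `C` plus `#E`.
  set E : Finset ι := {b ∈ activeB B N P D | a ∈ N b ∧ 2 ≤ #(N b \ C)} with hE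
  have hsum : relCost B N (insert a P) C = relCost B N P C + #E := by
    have h1 : ({b ∈ B | (N b ∩ insert a P).Nonempty ∧ 2 ≤ #(N b \ C)} : Finset ι) =
        {b ∈ B | (N b ∩ P).Nonempty ∧ 2 ≤ #(N b \ C)} ∪ E := by
      ext b
      have h3 : 2 ≤ #(N b \ C) → 2 ≤ #(N b \ D) := fun h =>
        h.trans (card_le_card (sdiff_subset_sdiff Subset.rfl hC.left))
      have h4 : (N b ∩ insert a P).Nonempty ↔ (N b ∩ P).Nonempty ∨ a ∈ N b := by
        by_cases h : a ∈ N b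
        · rw [inter_insert_of_mem h]; simp [h]
        · rw [inter_insert_of_notMem h]; simp [h]
      simp only [hE, mem_filter, mem_union, mem_activeB, h4]
      rw [← not_nonempty_iff_eq_empty]
      tauto
    have h2 : Disjoint ({b ∈ B | (N b ∩ P).Nonempty ∧ 2 ≤ #(N b \ C)} : Finset ι) E := by
      rw [disjoint_left]
      intro b hb hb'
      simp only [hE, mem_filter, mem_activeB] at hb hb'
      exact hb.2.1.ne_empty hb'.1.2.1
    unfold relCost
    rw [h1, card_union_of_disjoint h2]
    omega
  have hlow := lower_le (B := B) (N := N) hCP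
  have hfree : ∀ x ∈ C, x ∉ freeA A B N (insert a P) D := by
    intro x hx hxf
    simp only [freeA, mem_filter] at hxf
    exact hxf.2 (essential_of_mem hva hC hx e)
  -- If `C` is optimal for the old node, it contains no active element, as that would be essential.
  -- Then all active neighbours of `a` are newly charged and the bound rises by the degree.
  -- Otherwise the old cost of `C` is already one above the bound.
  by_cases hmin : relCost B N P C = lower A B N P D
  · have hEdeg : E = {b ∈ activeB B N P D | a ∈ N b} := by
      ext b
      simp only [hE, mem_filter]
      refine ⟨fun h => ⟨h.1, h.2.1⟩, fun h => ⟨h.1, h.2, ?_⟩⟩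
      have hb := mem_activeB.1 h.1
      have : N b \ C = N b \ D := by
        refine Subset.antisymm (sdiff_subset_sdiff Subset.rfl hC.left) fun x hx => ?_
        rw [mem_sdiff] at hx ⊢
        refine ⟨hx.1, fun hxC => he x (mem_activeA.2 ⟨hN b hx.1,
          disjoint_right.1 hCP.disj hxC, hx.2, b, h.1, hx.1⟩) (essential_of_mem hv hCP hxC hmin)⟩
      rw [this]
      exact hb.2.2
    have hdeg : #E = degree B N P D a := by rw [hEdeg, degree]
    have hpos : 1 ≤ #E := card_pos.2 ⟨b₀, by rw [hEdeg]; exact mem_filter.2 ⟨hb₀, hab₀⟩⟩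
    exact ⟨by omega, fun h => Or.inl (by omega)⟩
  · refine ⟨by omega, fun _ => ?_⟩
    -- If nothing is newly charged, `a` is the only survivor in `N b` for each active neighbour `b`.
    -- The other elements lie in the optimum `C` and are therefore essential, or already deleted.
    by_cases hE0 : E = ∅
    · right
      intro b hb hab x hx
      rw [mem_sdiff] at hx
      have hcard : #(N b \ C) ≤ 1 := by
        by_contra hc
        have : b ∈ E := mem_filter.2 ⟨hb, hab, by omega⟩
        rw [hE0] at this
        exact notMem_empty _ this
      by_cases hxC : x ∈ C
      · exact hfree x hxC
      · have : x = a := card_le_one.1 hcard x (mem_sdiff.2 ⟨hx.1, hxC⟩) a (mem_sdiff.2 ⟨hab, haC⟩)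
        subst this
        intro h
        exact (mem_activeA.1 (freeA_subset h)).2.1 (mem_insert_self _ _)
    · have : 1 ≤ #E := card_pos.2 (nonempty_iff_ne_empty.2 hE0)
      left
      omega

theorem freeA_eq_activeA (he : ∀ x ∈ activeA A B N P D, ¬ Essential A B N P D x) :
    freeA A B N P D = activeA A B N P D := by
  classical
  unfold freeA
  exact filter_true_of_mem he

/-- The branching rule: the potentials of the two branches add up to at most the potential of the
node. -/
theorem leafPotential_branch {a : ι} (hv : Valid A P D) (hN : ∀ b, N b ⊆ A)
    (hk : lower A B N P D ≤ k)
    (he : ∀ x ∈ activeA A B N P D, ¬ Essential A B N P D x) (ha : a ∈ activeA A B N P D)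
    (hdeg : 2 ≤ degree B N P D a ∨ ∀ x ∈ activeA A B N P D, degree B N P D x < 2) :
    leafPotential A B N k (insert a P) D + leafPotential A B N k P (insert a D) ≤
      leafPotential A B N k P D := by
  obtain ⟨haA, haP, haD, b, hb, hab⟩ := mem_activeA.1 ha
  have hfree := freeA_eq_activeA he
  have hR := lower_insert_right hv haA haP (he a ha)
  obtain ⟨hL1, hL2⟩ := lower_insert_left hv ha hN he
  have hpot := leafPotential_pos (A := A) (B := B) (N := N) (k := k) (P := P) (D := D)
  have hsubR : freeA A B N P (insert a D) ⊆ (activeA A B N P D).erase a :=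
    freeA_subset.trans (activeA_insert_right_subset a)
  have hsubL : freeA A B N (insert a P) D ⊆ (activeA A B N P D).erase a :=
    freeA_subset.trans (activeA_insert_left_subset a)
  have hcR : #(freeA A B N P (insert a D)) + 1 ≤ #(freeA A B N P D) := by
    rw [hfree, ← card_erase_add_one ha]
    exact Nat.add_le_add_right (card_le_card hsubR) 1
  have hcL : #(freeA A B N (insert a P) D) + 1 ≤ #(freeA A B N P D) := by
    rw [hfree, ← card_erase_add_one ha]
    exact Nat.add_le_add_right (card_le_card hsubL) 1
  have hBR := card_le_card (activeB_insert_right_subset (B := B) (N := N) (P := P) (D := D) a)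
  have hBL := card_activeB_insert_left (B := B) (N := N) (P := P) (D := D) a
  have hact : ∀ b' ∈ activeB B N P D, N b' \ D ⊆ activeA A B N P D := by
    intro b' hb' x hx
    rw [mem_sdiff] at hx
    refine mem_activeA.2 ⟨hN _ hx.1, fun hxP => ?_, hx.2, b', hb', hx.1⟩
    have h := (mem_activeB.1 hb').2.1
    exact notMem_empty x (h ▸ mem_inter.2 ⟨hx.1, hxP⟩)
  -- Before branching all active elements are free, so when the undeleted part of `N b'` ceases to
  -- be free, its whole size is lost from the second exponent.
  have hvanish : ∀ {b' P' D'}, b' ∈ activeB B N P D → freeA A B N P' D' ⊆ activeA A B N P D →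
      (∀ x ∈ N b' \ D, x ∉ freeA A B N P' D') →
      #(freeA A B N P' D') + #(N b' \ D) ≤ #(freeA A B N P D) := by
    intro b' P' D' hb' hs hn
    rw [hfree, ← card_union_of_disjoint (disjoint_right.2 hn)]
    exact card_le_card (union_subset hs (hact b' hb'))
  have hlose : ∀ b' ∈ activeB B N P D, a ∈ N b' → #(N b' \ D) = 2 →
      b' ∉ activeB B N P (insert a D) := by
    intro b' hb' hab' h2 hb''
    have h := (mem_activeB.1 hb'').2.2
    rw [sdiff_insert, card_erase_of_mem (mem_sdiff.2 ⟨hab', haD⟩), h2] at h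
    omega
  have hBR' : ∀ b' ∈ activeB B N P D, a ∈ N b' → #(N b' \ D) = 2 →
      #(activeB B N P (insert a D)) + 1 ≤ #(activeB B N P D) := by
    intro b' hb' hab' h2
    rw [← card_erase_add_one hb']
    refine Nat.add_le_add_right (card_le_card fun x hx => mem_erase.2 ⟨?_,
      activeB_insert_right_subset a hx⟩) 1
    rintro rfl
    exact hlose _ hb' hab' h2 hx
  by_cases hd2 : 2 ≤ degree B N P D a
  · have hL2 := hL2 hd2
    by_cases h2 : ∃ b' ∈ activeB B N P D, a ∈ N b' ∧ #(N b' \ D) = 2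
    · obtain ⟨b', hb', hab', hc⟩ := h2
      -- Deleting `a` leaves `b'` with a single neighbour, so `b'` becomes inactive. The shares of
      -- the two branches are `0.55` and `0.4`.
      have i1 := leafPotential_le (i := 1) (j := 1) (l := 1) (r := 0.55) hk (by omega) hR hcR
        (hBR' b' hb' hab' hc) (by norm_num)
      have i2 : leafPotential A B N k (insert a P) D ≤ 0.4 * leafPotential A B N k P D := by
        rcases hL2 with hL2 | hL2
        · exact leafPotential_le (i := 2) (j := 1) (l := 2) hk (by omega) hL2 hcL (by omega)
            (by norm_num)
        · refine leafPotential_le (i := 1) (j := 2) (l := 2) hk (by omega) hL1 ?_ (by omega)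
            (by norm_num)
          have := hvanish hb' (hsubL.trans (erase_subset _ _)) (hL2 b' hb' hab')
          omega
      linarith
    · push Not at h2
      -- The tightest case: `0.616 + 0.38 < 1`. All active neighbours have at least three undeleted
      -- neighbours, so deleting `a` need not deactivate any; in exchange, the second alternative
      -- for keeping `a` loses three free elements.
      have i1 := leafPotential_le (i := 1) (j := 1) (l := 0) (r := 0.616) hk (by omega) hR hcR
        (by omega) (by norm_num)
      have i2 : leafPotential A B N k (insert a P) D ≤ 0.38 * leafPotential A B N k P D := by
        rcases hL2 with hL2 | hL2
        · exact leafPotential_le (i := 2) (j := 1) (l := 2) hk (by omega) hL2 hcL (by omega)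
            (by norm_num)
        · refine leafPotential_le (i := 1) (j := 3) (l := 2) hk (by omega) hL1 ?_ (by omega)
            (by norm_num)
          have h3 := hvanish hb (hsubL.trans (erase_subset _ _)) (hL2 b hb hab)
          have h4 := h2 b hb hab
          have h5 := (mem_activeB.1 hb).2.2
          omega
      linarith
  · have hdeg : ∀ x ∈ activeA A B N P D, degree B N P D x < 2 := by tauto
    have hone : ∀ x ∈ N b \ D, ∀ b' ∈ activeB B N P D, x ∈ N b' → b' = b := by
      intro x hx b' hb' hxb'
      have h := hdeg x (hact b hb hx)
      have h' : #{b ∈ activeB B N P D | x ∈ N b} ≤ 1 := by unfold degree at h; omega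
      exact card_le_one.1 h' b' (mem_filter.2 ⟨hb', hxb'⟩) b
        (mem_filter.2 ⟨hb, (mem_sdiff.1 hx).1⟩)
    have hdpos : 1 ≤ degree B N P D a := card_pos.2 ⟨b, mem_filter.2 ⟨hb, hab⟩⟩
    have hvL : #(freeA A B N (insert a P) D) + #(N b \ D) ≤ #(freeA A B N P D) := by
      refine hvanish hb (hsubL.trans (erase_subset _ _)) fun x hx hxf => ?_
      obtain ⟨-, -, -, b', hb', hxb'⟩ := mem_activeA.1 (freeA_subset hxf)
      rw [activeB_insert_left, mem_filter] at hb'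
      rw [hone x hx b' hb'.1 hxb'] at hb'
      exact hb'.2 hab
    have h5 := (mem_activeB.1 hb).2.2
    by_cases hc : #(N b \ D) = 2
    · have hvR : #(freeA A B N P (insert a D)) + #(N b \ D) ≤ #(freeA A B N P D) := by
        refine hvanish hb (hsubR.trans (erase_subset _ _)) fun x hx hxf => ?_
        obtain ⟨-, -, -, b', hb', hxb'⟩ := mem_activeA.1 (freeA_subset hxf)
        rw [hone x hx b' (activeB_insert_right_subset a hb') hxb'] at hb'
        exact hlose b hb hab hc hb'
      have i1 := leafPotential_le (i := 1) (j := 2) (l := 1) (r := 0.5) hk (by omega) hR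
        (by omega) (hBR' b hb hab hc) (by norm_num)
      have i2 := leafPotential_le (i := 1) (j := 2) (l := 1) (r := 0.5) hk (by omega) hL1
        (by omega) (by omega) (by norm_num)
      linarith
    · have i1 := leafPotential_le (i := 1) (j := 1) (l := 0) (r := 0.616) hk (by omega) hR hcR
        (by omega) (by norm_num)
      have i2 := leafPotential_le (i := 1) (j := 3) (l := 1) (r := 0.36) hk (by omega) hL1
        (by omega) (by omega) (by norm_num)
      linarith

/-! #### The initial node -/

theorem feasible_empty_iff : Feasible A B N ∅ ∅ k ↔ ∃ C ⊆ A, cost B N C ≤ k :=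
  ⟨fun ⟨C, hC, h⟩ => ⟨C, hC.right, h⟩,
    fun ⟨C, hC, h⟩ => ⟨C, ⟨empty_subset _, hC, disjoint_empty_left _⟩, h⟩⟩

/-- The budget need not exceed the sizes of the two sides. -/
theorem feasible_min_iff (hN : ∀ b, N b ⊆ A) :
    Feasible A B N ∅ ∅ (min k (min #A #B)) ↔ Feasible A B N ∅ ∅ k := by
  rw [feasible_empty_iff, feasible_empty_iff]
  refine ⟨fun ⟨C, hC, h⟩ => ⟨C, hC, h.trans (min_le_left _ _)⟩, fun ⟨C, hC, h⟩ => ?_⟩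
  -- Deleting all of `A` costs at most `#A`, and deleting nothing costs at most `#B`. A budget above
  -- the smaller side therefore gains nothing.
  have h1 : cost B N A ≤ #A := by
    have : ({b ∈ B | 2 ≤ #(N b \ A)} : Finset ι) = ∅ := by
      rw [filter_eq_empty_iff]
      intro b _
      rw [sdiff_eq_empty_iff_subset.2 (hN b)]
      simp
    simp [cost, this]
  have h2 : cost B N ∅ ≤ #B := by
    simp only [cost, card_empty, zero_add]
    exact card_le_card (filter_subset _ _)
  rcases le_total k (min #A #B) with hle | hle
  · exact ⟨C, hC, by rwa [min_eq_left hle]⟩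
  · rw [min_eq_right hle]
    rcases le_total #A #B with h' | h'
    · exact ⟨A, Subset.rfl, by rwa [min_eq_left h']⟩
    · exact ⟨∅, empty_subset _, by rwa [min_eq_right h']⟩

/-- Since `k` is at most both `a` and `b`, each factor `1.3` can be grouped with one factor of
either other kind, and each group is at most `1.3497 ^ 2`. The remaining factors are below `1.3497`.
-/
theorem pow_min_le (k a b : ℕ) (ha : k ≤ a) (hb : k ≤ b) :
    (1.3 : ℝ) ^ k * 1.25 ^ a * 1.121 ^ b ≤ 1.3497 ^ (a + b) := by
  obtain ⟨a', rfl⟩ := Nat.exists_eq_add_of_le ha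
  obtain ⟨b', rfl⟩ := Nat.exists_eq_add_of_le hb
  calc (1.3 : ℝ) ^ k * 1.25 ^ (k + a') * 1.121 ^ (k + b')
      = (1.3 * 1.25 * 1.121) ^ k * 1.25 ^ a' * 1.121 ^ b' := by
        rw [pow_add, pow_add, mul_pow, mul_pow]; ring
    _ ≤ (1.3497 ^ 2) ^ k * 1.3497 ^ a' * 1.3497 ^ b' := by gcongr <;> norm_num
    _ = _ := by rw [← pow_mul, ← pow_add, ← pow_add]; congr 1; ring

/-- The offset in the exponent costs only `1.3 ^ 2 ≤ 2`. -/
theorem leafPotential_empty_le (ha : k ≤ #A) (hb : k ≤ #B) :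
    leafPotential A B N k ∅ ∅ ≤ 2 * 1.3497 ^ (#A + #B) := by
  have h1 : #(freeA A B N ∅ ∅) ≤ #A :=
    card_le_card (freeA_subset.trans (filter_subset _ _))
  have h2 : #(activeB B N ∅ ∅) ≤ #B := card_le_card (filter_subset _ _)
  calc leafPotential A B N k ∅ ∅ ≤ 1.3 ^ (k + 2) * 1.25 ^ #A * 1.121 ^ #B := by
        unfold leafPotential
        gcongr
        · norm_num
        · omega
        · norm_num
        · norm_num
    _ = 1.3 ^ 2 * (1.3 ^ k * 1.25 ^ #A * 1.121 ^ #B) := by ring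
    _ ≤ 2 * 1.3497 ^ (#A + #B) := by
        gcongr
        · norm_num
        · exact pow_min_le k _ _ ha hb

end Selection

/-! ### Bipartite matching by auction

Every vertex `a` has a price and at most one owner. An unmatched vertex bids for its cheapest
neighbour, whose price rises by one, and gives up if all its neighbours cost `n`. -/

namespace Auction

open Finset

variable {n : ℕ}

/-- The invariant of the auction: `Z` is the set of the vertices that have been processed,
`cur = c + 1` says that `c` is about to bid, and `ow a = b + 1` says that `b` owns `a`. -/
structure Inv (R : Fin n → Finset (Fin n)) (Z : Finset (Fin n)) (pr ow : Fin n → ℕ) (cur : ℕ) :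
    Prop where
  own_mem : ∀ a b : Fin n, ow a = b + 1 → b ∈ Z ∧ a ∈ R b
  inj : ∀ a a', 0 < ow a → ow a = ow a' → a = a'
  -- Complementary slackness up to one unit, the increment of a bid.
  slack : ∀ a b : Fin n, ow a = b + 1 → ∀ a' ∈ R b, pr a ≤ pr a' + 1
  owned : ∀ a, 0 < pr a → 0 < ow a
  pr_le : ∀ a, pr a ≤ n
  ow_le : ∀ a, ow a ≤ n
  cur_le : cur ≤ n
  cur_mem : ∀ c : Fin n, cur = c + 1 → c ∈ Z
  cur_ne : ∀ a, 0 < cur → ow a ≠ cur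
  done : ∀ b ∈ Z, (b : ℕ) + 1 ≠ cur → (∃ a, ow a = b + 1) ∨ ∀ a ∈ R b, pr a = n

variable {R : Fin n → Finset (Fin n)} {Z U : Finset (Fin n)} {pr ow : Fin n → ℕ} {cur : ℕ}

/-- Owners and bidders are stored shifted by one, so that `0` means none. -/
theorem exists_eq_succ {x : ℕ} (h0 : 0 < x) (h : x ≤ n) : ∃ b : Fin n, x = b + 1 :=
  ⟨⟨x - 1, by omega⟩, by simp only; omega⟩

theorem Inv.init (R : Fin n → Finset (Fin n)) : Inv R ∅ (fun _ => 0) (fun _ => 0) 0 := by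
  constructor <;> simp

theorem Inv.next (h : Inv R Z pr ow 0) {b : Fin n} (hb : b ∉ Z) :
    Inv R (insert b Z) pr ow (b + 1) where
  own_mem a c e := ⟨mem_insert_of_mem (h.own_mem a c e).1, (h.own_mem a c e).2⟩
  inj := h.inj
  slack := h.slack
  owned := h.owned
  pr_le := h.pr_le
  ow_le := h.ow_le
  cur_le := b.2
  cur_mem c e := by
    have : c = b := Fin.ext (by omega)
    rw [this]; exact mem_insert_self _ _
  cur_ne a _ e := hb (h.own_mem a b e).1
  done c hc hne := by
    rcases mem_insert.1 hc with rfl | hc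
    · exact absurd rfl hne
    · exact h.done c hc (by omega)

theorem Inv.giveUp (h : Inv R Z pr ow cur) {c : Fin n} (hc : cur = c + 1)
    (hR : ∀ a ∈ R c, ¬ pr a < n) : Inv R Z pr ow 0 where
  own_mem := h.own_mem
  inj := h.inj
  slack := h.slack
  owned := h.owned
  pr_le := h.pr_le
  ow_le := h.ow_le
  cur_le := Nat.zero_le n
  cur_mem c e := by omega
  cur_ne a h0 := absurd h0 (lt_irrefl 0)
  done b hb _ := by
    by_cases e : (b : ℕ) + 1 = cur
    · have : b = c := Fin.ext (by omega)
      subst this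
      exact Or.inr fun a ha => le_antisymm (h.pr_le a) (not_lt.1 (hR a ha))
    · exact h.done b hb e

/-- The displaced owner, if any, is the next bidder. Slackness holds for the new owner because `f`
was cheapest, and for the others because prices never fall. -/
theorem Inv.bid (h : Inv R Z pr ow cur) {c : Fin n} (hc : cur = c + 1) {f : Fin n}
    (hf : f ∈ R c) (hlt : pr f < n) (hmin : ∀ a ∈ R c, pr f ≤ pr a) :
    Inv R Z (Function.update pr f (pr f + 1)) (Function.update ow f cur) (ow f) where
  own_mem a b e := by
    by_cases ha : a = f
    · subst ha
      rw [Function.update_self, hc] at e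
      have : b = c := Fin.ext (by omega)
      subst this
      exact ⟨h.cur_mem b hc, hf⟩
    · rw [Function.update_of_ne ha] at e
      exact h.own_mem a b e
  inj a a' h0 e := by
    by_cases ha : a = f <;> by_cases ha' : a' = f
    · rw [ha, ha']
    · rw [ha, Function.update_self, Function.update_of_ne ha'] at e
      exact absurd e.symm (h.cur_ne a' (by omega))
    · rw [ha', Function.update_self, Function.update_of_ne ha] at e
      exact absurd e (h.cur_ne a (by omega))
    · rw [Function.update_of_ne ha] at h0 e
      rw [Function.update_of_ne ha'] at e
      exact h.inj a a' h0 e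
  slack a b e a' ha' := by
    have hle : pr a' ≤ Function.update pr f (pr f + 1) a' := by
      by_cases h' : a' = f
      · subst h'; rw [Function.update_self]; omega
      · rw [Function.update_of_ne h']
    by_cases ha : a = f
    · subst ha
      rw [Function.update_self, hc] at e
      have : b = c := Fin.ext (by omega)
      subst this
      have := hmin a' ha'
      rw [Function.update_self]; omega
    · rw [Function.update_of_ne ha] at e ⊢
      have := h.slack a b e a' ha'
      omega
  owned a h0 := by
    by_cases ha : a = f
    · subst ha; rw [Function.update_self]; omega
    · rw [Function.update_of_ne ha] at h0 ⊢
      exact h.owned a h0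
  pr_le a := by
    by_cases ha : a = f
    · subst ha; rw [Function.update_self]; omega
    · rw [Function.update_of_ne ha]; exact h.pr_le a
  ow_le a := by
    by_cases ha : a = f
    · subst ha; rw [Function.update_self]; exact h.cur_le
    · rw [Function.update_of_ne ha]; exact h.ow_le a
  cur_le := h.ow_le f
  cur_mem b e := (h.own_mem f b e).1
  cur_ne a h0 e := by
    by_cases ha : a = f
    · subst ha
      rw [Function.update_self] at e
      exact h.cur_ne a (by omega) e.symm
    · rw [Function.update_of_ne ha] at e
      exact ha (h.inj f a h0 e.symm).symm
  done b hb hne := by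
    by_cases e : (b : ℕ) + 1 = cur
    · exact Or.inl ⟨f, by rw [Function.update_self, e]⟩
    · rcases h.done b hb e with ⟨a, ha⟩ | hall
      · have haf : a ≠ f := by rintro rfl; exact hne ha.symm
        exact Or.inl ⟨a, by rw [Function.update_of_ne haf, ha]⟩
      · refine Or.inr fun a ha => ?_
        have haf : a ≠ f := by
          rintro rfl
          have := hall a ha
          omega
        rw [Function.update_of_ne haf]
        exact hall a ha

/-- Only owned vertices have a positive price, and they lie in `U`, which has fewer than `n`
elements. As each bid raises the sum by one, this bounds the number of bids. -/
theorem Inv.sum_le (h : Inv R Z pr ow cur) (hR : ∀ b, R b ⊆ U) (hU : #U < n) :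
    ∑ a, pr a < n * n := by
  have h1 : ∑ a, pr a = ∑ a ∈ U, pr a := by
    refine (sum_subset (subset_univ U) fun a _ ha => ?_).symm
    by_contra h0
    obtain ⟨b, hb⟩ := exists_eq_succ (h.owned a (Nat.pos_of_ne_zero h0)) (h.ow_le a)
    exact ha (hR b (h.own_mem a b hb).2)
  have h2 := sum_le_card_nsmul U pr n fun a _ => h.pr_le a
  rw [h1]
  refine h2.trans_lt ?_
  rw [smul_eq_mul]
  exact Nat.mul_lt_mul_of_pos_right hU (by omega)

/-- Weak duality: an owned vertex lies in `C`, or its owner is a `b` that is not covered by `C`;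
distinct vertices have distinct owners. -/
theorem Inv.card_owned_le (h : Inv R Z pr ow 0) (C : Finset (Fin n)) :
    #{a | 0 < ow a} ≤ #C + #{b ∈ Z | ¬ R b ⊆ C} := by
  have h1 : ∀ a : Fin n, ∃ b : Fin n, 0 < ow a → ow a = b + 1 := by
    intro a
    by_cases h0 : 0 < ow a
    · obtain ⟨b, hb⟩ := exists_eq_succ h0 (h.ow_le a)
      exact ⟨b, fun _ => hb⟩
    · exact ⟨a, fun h' => absurd h' h0⟩
  choose f hf using h1
  have h2 : #{a | 0 < ow a ∧ a ∉ C} ≤ #{b ∈ Z | ¬ R b ⊆ C} := by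
    refine card_le_card_of_injOn f (fun a ha => ?_) fun a ha a' ha' e => ?_
    · simp only [coe_filter, mem_univ, true_and, Set.mem_ofPred_eq] at ha
      obtain ⟨hz, hr⟩ := h.own_mem a _ (hf a ha.1)
      simp only [coe_filter, Set.mem_ofPred_eq]
      exact ⟨hz, fun hs => ha.2 (hs hr)⟩
    · simp only [coe_filter, mem_univ, true_and, Set.mem_ofPred_eq] at ha ha'
      exact h.inj a a' ha.1 (by rw [hf a ha.1, hf a' ha'.1, e])
  have h3 : ({a | 0 < ow a} : Finset (Fin n)) ⊆ C ∪ ({a | 0 < ow a ∧ a ∉ C} : Finset (Fin n)) := by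
    intro a ha
    simp only [mem_filter, mem_univ, true_and, mem_union] at ha ⊢
    tauto
  have := (card_le_card h3).trans (card_union_le _ _)
  omega

/-- Strong duality from a gap in the prices. Elements priced above the gap are all owned. By
slackness, an owner of such an element has its whole neighbourhood above the gap, so each uncovered
`b` owns an element below it. The two groups of owned elements are disjoint. -/
theorem Inv.exists_cover (h : Inv R Z pr ow 0) (hR : ∀ b, R b ⊆ U) (hZ : Z.Nonempty → #U < n) :
    ∃ C ⊆ U, #C + #{b ∈ Z | ¬ R b ⊆ C} ≤ #{a | 0 < ow a} := by
  rcases Z.eq_empty_or_nonempty with rfl | hne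
  · exact ⟨∅, empty_subset _, by simp⟩
  have hU := hZ hne
  -- There are `n` possible levels below the ceiling and fewer than `n` elements in `U`, so some
  -- level `l` is not a price. Those who gave up see only prices `n > l` and are covered.
  obtain ⟨l, hl, hlU⟩ : ∃ l ∈ range n, l ∉ U.image pr :=
    exists_mem_notMem_of_card_lt_card (by rw [card_range]; exact card_image_le.trans_lt hU)
  rw [mem_range] at hl
  have hlU : ∀ a ∈ U, pr a ≠ l := fun a ha e => hlU (mem_image.2 ⟨a, ha, e⟩)
  set C : Finset (Fin n) := {a ∈ U | l < pr a} with hC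
  refine ⟨C, filter_subset _ _, ?_⟩
  have key : ∀ b : Fin n, ∃ a : Fin n, b ∈ Z → ¬ R b ⊆ C → ow a = b + 1 ∧ a ∉ C := by
    intro b
    by_cases hb : b ∈ Z ∧ ¬ R b ⊆ C
    · obtain ⟨hb, hs⟩ := hb
      rcases h.done b hb (by omega) with ⟨a, ha⟩ | hall
      · refine ⟨a, fun _ _ => ⟨ha, fun haC => hs fun a' ha' => ?_⟩⟩
        have h1 := h.slack a b ha a' ha'
        have h2 := hlU a' (hR b ha')
        have h3 := (mem_filter.1 haC).2
        exact mem_filter.2 ⟨hR b ha', by omega⟩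
      · exact absurd (fun a ha => mem_filter.2 ⟨hR b ha, by rw [hall a ha]; exact hl⟩) hs
    · exact ⟨b, fun h1 h2 => absurd ⟨h1, h2⟩ hb⟩
  choose g hg using key
  have h2 : #{b ∈ Z | ¬ R b ⊆ C} ≤ #{a | 0 < ow a ∧ a ∉ C} := by
    refine card_le_card_of_injOn g (fun b hb => ?_) fun b hb b' hb' e => ?_
    · simp only [coe_filter, Set.mem_ofPred_eq] at hb
      obtain ⟨h1, h2⟩ := hg b hb.1 hb.2
      simp only [coe_filter, mem_univ, true_and, Set.mem_ofPred_eq]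
      exact ⟨by omega, h2⟩
    · simp only [coe_filter, Set.mem_ofPred_eq] at hb hb'
      have e1 := (hg b hb.1 hb.2).1
      have e2 := (hg b' hb'.1 hb'.2).1
      rw [e] at e1
      exact Fin.ext (by omega)
  have h3 : C ∪ ({a | 0 < ow a ∧ a ∉ C} : Finset (Fin n)) ⊆ ({a | 0 < ow a} : Finset (Fin n)) := by
    intro a ha
    simp only [mem_filter, mem_univ, true_and, mem_union] at ha ⊢
    rcases ha with ha | ha
    · exact h.owned a (by have := (mem_filter.1 ha).2; omega)
    · exact ha.1
  have h4 : Disjoint C ({a | 0 < ow a ∧ a ∉ C} : Finset (Fin n)) := by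
    rw [disjoint_left]
    intro a ha ha'
    exact (mem_filter.1 ha').2.2 ha
  have := card_le_card h3
  rw [card_union_of_disjoint h4] at this
  omega

end Auction

/-! ### The lower bound as a vertex cover number -/

namespace Selection

open Finset

variable {ι : Type*} [DecidableEq ι] {A B : Finset ι} {N : ι → Finset ι} {P D : Finset ι}

/-- Kept neighbours always survive. So a `b` with two of them is charged for every `C`, and a `b`
with exactly one is charged unless all its undecided neighbours are deleted. The last summand is
thus the size of a vertex cover. -/
theorem relCost_eq {C : Finset ι} (hN : ∀ b, N b ⊆ A) (hC : Extends A P D C) :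
    relCost B N P C = #D + #{b ∈ B | 2 ≤ #(N b ∩ P)} + (#(C \ D) +
      #{b ∈ ({b ∈ B | #(N b ∩ P) = 1} : Finset ι) | ¬ N b ∩ (A \ (P ∪ D)) ⊆ C \ D}) := by
  have h1 : #C = #D + #(C \ D) := by
    have := card_sdiff_add_card_eq_card hC.left
    omega
  have h2 : ({b ∈ B | (N b ∩ P).Nonempty ∧ 2 ≤ #(N b \ C)} : Finset ι) =
      {b ∈ B | 2 ≤ #(N b ∩ P)} ∪
        {b ∈ ({b ∈ B | #(N b ∩ P) = 1} : Finset ι) | ¬ N b ∩ (A \ (P ∪ D)) ⊆ C \ D} := by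
    ext b
    simp only [mem_filter, mem_union, and_assoc, ← and_or_left]
    refine and_congr_right fun _ => ?_
    have hsub : N b ∩ P ⊆ N b \ C := fun x hx => by
      rw [mem_inter] at hx
      exact mem_sdiff.2 ⟨hx.1, disjoint_left.1 hC.disj hx.2⟩
    have hle := card_le_card hsub
    have key : #(N b ∩ P) = 1 → (2 ≤ #(N b \ C) ↔ ¬ N b ∩ (A \ (P ∪ D)) ⊆ C \ D) := by
      intro h
      have : 2 ≤ #(N b \ C) ↔ N b ∩ P ≠ N b \ C := by
        constructor
        · intro h' e
          rw [e] at h; omega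
        · intro hne
          have := card_lt_card (hsub.ssubset_of_ne hne)
          omega
      rw [this, not_iff_not]
      constructor
      · intro e x hx
        simp only [mem_inter, mem_sdiff, mem_union, not_or] at hx ⊢
        refine ⟨?_, hx.2.2.2⟩
        by_contra hxC
        have : x ∈ N b ∩ P := e ▸ mem_sdiff.2 ⟨hx.1, hxC⟩
        exact hx.2.2.1 (mem_inter.1 this).2
      · intro hs
        refine Subset.antisymm hsub fun x hx => ?_
        rw [mem_sdiff] at hx
        refine mem_inter.2 ⟨hx.1, ?_⟩
        by_contra hxP
        have : x ∈ C \ D := hs (by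
          simp only [mem_inter, mem_sdiff, mem_union, not_or]
          exact ⟨hx.1, hN b hx.1, hxP, fun hxD => hx.2 (hC.left hxD)⟩)
        exact hx.2 (mem_sdiff.1 this).1
    rw [← card_pos]
    by_cases h : #(N b ∩ P) = 1
    · rw [← key h]; omega
    · simp only [h, false_and, or_false]
      omega
  have h3 : Disjoint ({b ∈ B | 2 ≤ #(N b ∩ P)} : Finset ι)
      {b ∈ ({b ∈ B | #(N b ∩ P) = 1} : Finset ι) | ¬ N b ∩ (A \ (P ∪ D)) ⊆ C \ D} := by
    rw [disjoint_left]
    intro b hb hb'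
    simp only [mem_filter] at hb hb'
    omega
  unfold relCost
  rw [h2, card_union_of_disjoint h3]
  omega

/-- Reduces the computation of `lower` to a dual certificate `m`: a lower bound for all covers (the
matching) and a cover attaining it. -/
theorem lower_eq {m : ℕ} (hv : Valid A P D) (hN : ∀ b, N b ⊆ A)
    (h1 : ∀ C, m ≤ #C +
      #{b ∈ ({b ∈ B | #(N b ∩ P) = 1} : Finset ι) | ¬ N b ∩ (A \ (P ∪ D)) ⊆ C})
    (h2 : ∃ C ⊆ A \ (P ∪ D), #C +
      #{b ∈ ({b ∈ B | #(N b ∩ P) = 1} : Finset ι) | ¬ N b ∩ (A \ (P ∪ D)) ⊆ C} ≤ m) :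
    lower A B N P D = #D + #{b ∈ B | 2 ≤ #(N b ∩ P)} + m := by
  refine le_antisymm ?_ ?_
  · obtain ⟨C, hC, hm⟩ := h2
    have hCx : ∀ x ∈ C, x ∈ A ∧ x ∉ P ∧ x ∉ D := fun x hx => by
      have := hC hx
      simp only [mem_sdiff, mem_union, not_or] at this
      exact this
    have hE : Extends A P D (D ∪ C) := ⟨subset_union_left,
      union_subset hv.right fun x hx => (hCx x hx).1,
      disjoint_union_right.2 ⟨hv.disj, disjoint_right.2 fun x hx => (hCx x hx).2.1⟩⟩
    have e : (D ∪ C) \ D = C := by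
      rw [union_sdiff_left, Finset.sdiff_eq_self_iff_disjoint, disjoint_left]
      exact fun x hx hx' => (hCx x (by assumption)).2.2 (by assumption)
    refine (lower_le hE).trans ?_
    rw [relCost_eq hN hE, e]
    omega
  · obtain ⟨C, hC, e⟩ := exists_lower_eq (B := B) (N := N) hv
    rw [← e, relCost_eq hN hC]
    have := h1 (C \ D)
    omega

end Selection

/-! ### Subset feedback vertex sets of split graphs -/

namespace SplitGraph

open Finset

set_option linter.unusedSectionVars false

variable {V : Type*} {G : SimpleGraph V}

/-- The vertices outside of `K` are pairwise not adjacent, those in `K` are pairwise adjacent. -/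
structure IsPartition (G : SimpleGraph V) (K : Finset V) : Prop where
  clique : ∀ u ∈ K, ∀ v ∈ K, u ≠ v → G.Adj u v
  indep : ∀ u, u ∉ K → ∀ v, v ∉ K → ¬ G.Adj u v

/-- No triangle outside of `S` contains an element of `T`. -/
def HitsTriangles (G : SimpleGraph V) (T S : Finset V) : Prop :=
  ∀ x y z, x ∉ S → y ∉ S → z ∉ S → G.Adj x y → G.Adj y z → G.Adj x z → x ∉ T

/-- After rotating the cycle to start at `x`, take its second and its penultimate vertex. -/
theorem exists_two_neighbours {v x : V} {c : G.Walk v v} (hc : c.IsCycle) (hx : x ∈ c.support) :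
    ∃ y z, y ≠ z ∧ G.Adj x y ∧ G.Adj x z ∧ y ∈ c.support ∧ z ∈ c.support := by
  classical
  have h := hc.rotate hx
  have hm : ∀ w, w ∈ (c.rotate x hx).support → w ∈ c.support := fun w hw =>
    (SimpleGraph.Walk.mem_support_rotate_iff _ _ _).1 hw
  have hn := h.not_nil
  exact ⟨(c.rotate x hx).snd, (c.rotate x hx).penultimate, h.snd_ne_penultimate,
    (c.rotate x hx).adj_snd hn, ((c.rotate x hx).adj_penultimate hn).symm,
    hm _ ((c.rotate x hx).getVert_mem_support _), hm _ ((c.rotate x hx).getVert_mem_support _)⟩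

/-- Let the terminal `u` lie on a cycle. If both neighbours of `u` on the cycle are in `K`, they are
adjacent. If a neighbour `y` is outside of `K`, then `u` and both cycle neighbours of `y` are in
`K`, and the one different from `u` closes a triangle. -/
theorem isSubsetFeedbackVertexSet_iff {K T S : Finset V} (hK : IsPartition G K) :
    G.IsSubsetFeedbackVertexSet (T : Set V) (S : Set V) ↔ HitsTriangles G T S := by
  constructor
  · intro h x y z hx hy hz hxy hyz hxz hT
    let x' : ((S : Set V)ᶜ : Set V) := ⟨x, hx⟩
    let y' : ((S : Set V)ᶜ : Set V) := ⟨y, hy⟩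
    let z' : ((S : Set V)ᶜ : Set V) := ⟨z, hz⟩
    have h1 : (G.induce ((S : Set V)ᶜ)).Adj x' y' := hxy
    have h2 : (G.induce ((S : Set V)ᶜ)).Adj y' z' := hyz
    have h3 : (G.induce ((S : Set V)ᶜ)).Adj z' x' := hxz.symm
    have n1 : x' ≠ y' := h1.ne
    have n2 : y' ≠ z' := h2.ne
    have n3 : z' ≠ x' := h3.ne
    refine h x' (.cons h1 (.cons h2 (.cons h3 .nil))) ?_ x' (by simp) hT
    rw [SimpleGraph.Walk.isCycle_def]
    simp only [SimpleGraph.Walk.isTrail_def]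
    aesop
  · intro h v c hc u hu hT
    have two : ∀ w ∈ c.support, ∃ y z, y ≠ z ∧ (y ∉ S ∧ z ∉ S) ∧ G.Adj w y ∧ G.Adj w z ∧
        (∃ hy : y ∉ S, (⟨y, hy⟩ : ((S : Set V)ᶜ : Set V)) ∈ c.support) ∧
        (∃ hz : z ∉ S, (⟨z, hz⟩ : ((S : Set V)ᶜ : Set V)) ∈ c.support) := by
      intro w hw
      obtain ⟨y, z, hyz, h1, h2, h3, h4⟩ := exists_two_neighbours hc hw
      exact ⟨y, z, fun e => hyz (Subtype.ext e), ⟨y.2, z.2⟩, h1, h2, ⟨y.2, h3⟩, ⟨z.2, h4⟩⟩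
    have huS : (u : V) ∉ S := u.2
    have side : ∀ y, (hy : y ∉ S) → (⟨y, hy⟩ : ((S : Set V)ᶜ : Set V)) ∈ c.support →
        G.Adj u y → y ∉ K → False := by
      intro y hy hyc huy hyK
      obtain ⟨a, b, hab, ⟨ha, hb⟩, h1, h2, -, -⟩ := two _ hyc
      have huK : (u : V) ∈ K := by
        by_contra huK
        exact hK.indep _ huK _ hyK huy
      have inK : ∀ w, G.Adj y w → w ∈ K := fun w hw => by
        by_contra hwK
        exact hK.indep _ hyK _ hwK hw
      by_cases hau : a = u
      · subst hau
        exact h u b y huS hb hy (hK.clique _ huK _ (inK b h2) hab) h2.symm huy hT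
      · exact h u a y huS ha hy (hK.clique _ huK _ (inK a h1) (Ne.symm hau)) h1.symm huy hT
    obtain ⟨y, z, hyz, ⟨hy, hz⟩, h1, h2, ⟨hy', h3⟩, ⟨hz', h4⟩⟩ := two u hu
    have hyK : y ∈ K := by by_contra hn; exact side y hy h3 h1 hn
    have hzK : z ∈ K := by by_contra hn; exact side z hz h4 h2 hn
    exact h u y z huS hy hz h1 (hK.clique _ hyK _ hzK hyz) h2 hT

/-! #### Finding the partition -/

variable [Fintype V] [DecidableEq V] [DecidableRel G.Adj]

/-- The vertices of degree at least `t` and the other vertices form a split partition, for a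
suitable `t`. -/
theorem exists_threshold (hG : G.IsSplitGraph) : ∃ t ≤ Fintype.card V,
    IsPartition G {v | t ≤ #{u | G.Adj v u}} := by
  classical
  obtain ⟨K₀, hK₀, hI₀⟩ := hG
  have hne : ({K : Finset V | IsPartition G K} : Finset (Finset V)).Nonempty := by
    refine ⟨({v | v ∈ K₀} : Finset V), ?_⟩
    simp only [mem_filter, mem_univ, true_and]
    refine ⟨fun u hu v hv huv => ?_, fun u hu v hv huv => ?_⟩
    · simp only [mem_filter, mem_univ, true_and] at hu hv
      exact hK₀ hu hv huv
    · simp only [mem_filter, mem_univ, true_and] at hu hv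
      exact hI₀ hu hv huv.ne huv
  -- A largest clique side: inside, degrees are at least `#K - 1`; outside, they are at most `#K -
  -- 1`, since a vertex adjacent to all of `K` could be added.
  obtain ⟨K, hK, hmax⟩ := exists_max_image _ (fun K : Finset V => #K) hne
  simp only [mem_filter, mem_univ, true_and] at hK hmax
  have degK : ∀ u ∈ K, K.erase u ⊆ ({w | G.Adj u w} : Finset V) := by
    intro u hu w hw
    rw [mem_erase] at hw
    exact mem_filter.2 ⟨mem_univ _, hK.clique u hu w hw.2 hw.1.symm⟩
  have degK' : ∀ u ∈ K, #K ≤ #{w | G.Adj u w} + 1 := by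
    intro u hu
    have h := card_le_card (degK u hu)
    have := card_erase_add_one hu
    omega
  have degI : ∀ v, v ∉ K → ({w | G.Adj v w} : Finset V) ⊆ K := by
    intro v hv w hw
    by_contra hwK
    exact hK.indep v hv w hwK (mem_filter.1 hw).2
  have degI' : ∀ v, v ∉ K → #{w | G.Adj v w} + 1 ≤ #K := by
    intro v hv
    refine card_lt_card ((degI v hv).ssubset_of_ne fun e => ?_)
    have hall : ∀ w ∈ K, G.Adj v w := fun w hw => by
      rw [← e] at hw
      exact (mem_filter.1 hw).2
    have := hmax (insert v K) ⟨fun a ha b hb hab => ?_, fun a ha b hb => ?_⟩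
    · rw [card_insert_of_notMem hv] at this; omega
    · rw [mem_insert] at ha hb
      rcases ha with rfl | ha <;> rcases hb with rfl | hb
      · exact absurd rfl hab
      · exact hall b hb
      · exact (hall a ha).symm
      · exact hK.clique a ha b hb hab
    · rw [mem_insert, not_or] at ha hb
      exact hK.indep a ha.2 b hb.2
  -- The degree `#K - 1` is ambiguous only if an outer vertex `v` attains it. Then the threshold
  -- `#K` is used, which moves the vertices of `K` without outer neighbours to the independent side.
  by_cases hcase : ∃ v, v ∉ K ∧ #{w | G.Adj v w} + 1 = #K
  · obtain ⟨v, hv, hdv⟩ := hcase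
    refine ⟨#K, card_le_univ K, ⟨fun u hu w hw huw => ?_, fun u hu w hw huw => ?_⟩⟩
    · simp only [mem_filter, mem_univ, true_and] at hu hw
      have hu' : u ∈ K := by
        by_contra hn
        have := degI' u hn; omega
      have hw' : w ∈ K := by
        by_contra hn
        have := degI' w hn; omega
      exact hK.clique u hu' w hw' huw
    · simp only [mem_filter, mem_univ, true_and, not_le] at hu hw
      have only : ∀ u ∈ K, #{w | G.Adj u w} < #K → ({w | G.Adj u w} : Finset V) = K.erase u := by
        intro u hu hd
        refine (eq_of_subset_of_card_le (degK u hu) ?_).symm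
        have := card_erase_add_one hu
        omega
      have out : ∀ u ∈ K, #{w | G.Adj u w} < #K → ∀ w, G.Adj u w → w ∈ K := by
        intro u hu hd w hw
        have h : w ∈ ({w | G.Adj u w} : Finset V) := mem_filter.2 ⟨mem_univ _, hw⟩
        rw [only u hu hd] at h
        exact mem_of_mem_erase h
      by_cases huK : u ∈ K
      · have hwK := out u huK hu w huw
        -- Two such vertices `u`, `w` of `K` would both be missing from the neighbourhood of `v`,
        -- which has room for only one missing vertex.
        have hsub : ({x | G.Adj v x} : Finset V) ⊆ (K.erase u).erase w := by
          intro x hx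
          have hx' := (mem_filter.1 hx).2
          refine mem_erase.2 ⟨?_, mem_erase.2 ⟨?_, degI v hv hx⟩⟩
          · rintro rfl
            exact hv (out _ hwK hw v hx'.symm)
          · rintro rfl
            exact hv (out _ huK hu v hx'.symm)
        have h1 := card_le_card hsub
        have h2 := card_erase_add_one huK
        have h3 := card_erase_add_one (mem_erase.2 ⟨huw.ne.symm, hwK⟩)
        omega
      · by_cases hwK : w ∈ K
        · exact huK (out w hwK hw u huw.symm)
        · exact hK.indep u huK w hwK huw
  · push Not at hcase
    have e : ({v | #K - 1 ≤ #{u | G.Adj v u}} : Finset V) = K := by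
      ext v
      simp only [mem_filter, mem_univ, true_and]
      refine ⟨fun h => ?_, fun h => ?_⟩
      · by_contra hv
        have h1 := degI' v hv
        have h2 := hcase v hv
        omega
      · have := degK' v h
        omega
    refine ⟨#K - 1, (Nat.sub_le _ _).trans (card_le_univ K), ?_⟩
    rw [e]
    exact hK

/-! #### Reduction to the selection problem -/

/-- The vertices to be deleted if the clique is to be reduced to `u` and `v`, apart from those in
the clique. -/
def pairSet (G : SimpleGraph V) [DecidableRel G.Adj] (K T : Finset V) (u v : V) : Finset V :=
  {w | w ∉ K ∧ G.Adj u w ∧ G.Adj v w ∧ (u ∈ T ∨ v ∈ T ∨ w ∈ T)}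

/-- The neighbours of `b` in `K \ T`. -/
def nbrs (G : SimpleGraph V) [DecidableRel G.Adj] (K T : Finset V) (b : V) : Finset V :=
  {a ∈ K \ T | G.Adj b a}

/-- Every triangle uses two vertices of `K`, so sparing a single vertex of `K` destroys all
triangles. -/
theorem HitsTriangles.of_le_one {K T : Finset V} (hK : IsPartition G K) {k : ℕ}
    (h : #K ≤ k + 1) : ∃ S : Finset V, #S ≤ k ∧ HitsTriangles G T S := by
  have two : ∀ x y z, G.Adj x y → G.Adj y z → G.Adj x z →
      (x ∈ K ∧ y ∈ K) ∨ (y ∈ K ∧ z ∈ K) ∨ (x ∈ K ∧ z ∈ K) := by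
    intro x y z h1 h2 h3
    have i1 : x ∉ K → y ∉ K → False := fun hx hy => hK.indep x hx y hy h1
    have i2 : y ∉ K → z ∉ K → False := fun hx hy => hK.indep y hx z hy h2
    have i3 : x ∉ K → z ∉ K → False := fun hx hy => hK.indep x hx z hy h3
    tauto
  rcases K.eq_empty_or_nonempty with rfl | ⟨u, hu⟩
  · refine ⟨∅, by simp, fun x y z _ _ _ h1 h2 h3 _ => ?_⟩
    have := two x y z h1 h2 h3
    simp at this
  · refine ⟨K.erase u, by rw [card_erase_of_mem hu]; omega, fun x y z hx hy hz h1 h2 h3 _ => ?_⟩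
    simp only [mem_erase, not_and] at hx hy hz
    have e : ∀ w, (w ≠ u → w ∉ K) → w ∈ K → w = u := fun w h h' => by
      by_contra hn; exact h hn h'
    rcases two x y z h1 h2 h3 with ⟨a, b⟩ | ⟨a, b⟩ | ⟨a, b⟩
    · exact h1.ne ((e x hx a).trans (e y hy b).symm)
    · exact h2.ne ((e y hy a).trans (e z hz b).symm)
    · exact h3.ne ((e x hx a).trans (e z hz b).symm)

/-- A surviving triangle must consist of `u`, `v` and an outer vertex, and `pairSet` removes those
outer vertices that complete a triangle with a terminal. -/
theorem HitsTriangles.of_pair {K T : Finset V} (hK : IsPartition G K) {u v : V} (huv : u ≠ v)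
    (hu : u ∈ K) (hv : v ∈ K) : HitsTriangles G T ((K.erase u).erase v ∪ pairSet G K T u v) := by
  intro x y z hx hy hz h1 h2 h3 hT
  have only : ∀ w ∈ K, w ∉ (K.erase u).erase v ∪ pairSet G K T u v → w = u ∨ w = v := by
    intro w hw hn
    by_contra hne
    rw [not_or] at hne
    exact hn (mem_union_left _ (mem_erase.2 ⟨hne.2, mem_erase.2 ⟨hne.1, hw⟩⟩))
  have third : ∀ w, w ∉ K → w ∉ (K.erase u).erase v ∪ pairSet G K T u v → G.Adj u w →
      G.Adj v w → u ∉ T ∧ v ∉ T ∧ w ∉ T := by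
    intro w hw hn hu hv
    by_contra hc
    refine hn (mem_union_right _ (mem_filter.2 ⟨mem_univ _, hw, hu, hv, ?_⟩))
    tauto
  have key : ∀ a b w, a ∈ K → b ∈ K → a ∉ (K.erase u).erase v ∪ pairSet G K T u v →
      b ∉ (K.erase u).erase v ∪ pairSet G K T u v → w ∉ (K.erase u).erase v ∪ pairSet G K T u v →
      G.Adj a b → G.Adj a w → G.Adj b w → a ∉ T ∧ b ∉ T ∧ w ∉ T := by
    intro a b w ha hb ha' hb' hw' hab haw hbw
    have hwK : w ∉ K := by
      intro hw
      have e1 := only a ha ha'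
      have e2 := only b hb hb'
      have e3 := only w hw hw'
      have n1 := hab.ne
      have n2 := haw.ne
      have n3 := hbw.ne
      rcases e1 with rfl | rfl <;> rcases e2 with rfl | rfl <;> rcases e3 with rfl | rfl <;>
        simp_all
    rcases only a ha ha' with rfl | rfl <;> rcases only b hb hb' with rfl | rfl
    · exact absurd rfl hab.ne
    · exact third w hwK hw' haw hbw
    · have := third w hwK hw' hbw haw
      tauto
    · exact absurd rfl hab.ne
  by_cases hxK : x ∈ K <;> by_cases hyK : y ∈ K
  · exact (key x y z hxK hyK hx hy hz h1 h3 h2).1 hT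
  · have hzK : z ∈ K := by by_contra hn; exact hK.indep _ hyK _ hn h2
    exact (key x z y hxK hzK hx hz hy h3 h1 h2.symm).1 hT
  · have hzK : z ∈ K := by by_contra hn; exact hK.indep _ hxK _ hn h3
    exact (key y z x hyK hzK hy hz hx h2 h1.symm h3.symm).2.2 hT
  · exact hK.indep _ hxK _ hyK h1

/-- A surviving terminal in a triangle is outside of `K`, so the other two vertices are surviving
elements of `nbrs`, contrary to the deletion rule. -/
theorem HitsTriangles.of_selection {K T C : Finset V} (hK : IsPartition G K) :
    HitsTriangles G T
      (K ∩ T ∪ (C ∪ {b ∈ T \ K | 2 ≤ #(nbrs G K T b \ C)})) := by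
  intro x y z hx hy hz h1 h2 h3 hT
  simp only [mem_union, mem_inter, mem_filter, mem_sdiff, not_or, not_and] at hx hy hz
  have hxK : x ∉ K := fun h => hx.1 h hT
  have hyK : y ∈ K := by by_contra hn; exact hK.indep _ hxK _ hn h1
  have hzK : z ∈ K := by by_contra hn; exact hK.indep _ hxK _ hn h3
  refine hx.2.2 ⟨hT, hxK⟩ (one_lt_card.2 ⟨y, ?_, z, ?_, h2.ne⟩)
  · exact mem_sdiff.2 ⟨mem_filter.2 ⟨mem_sdiff.2 ⟨hyK, hy.1 hyK⟩, h1⟩, hy.2.1⟩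
  · exact mem_sdiff.2 ⟨mem_filter.2 ⟨mem_sdiff.2 ⟨hzK, hz.1 hzK⟩, h3⟩, hz.2.1⟩

/-- The cases correspond to at most one, exactly two, or at least three vertices of `K` outside of
`S`. -/
theorem HitsTriangles.cases {K T S : Finset V} (hK : IsPartition G K) (h : HitsTriangles G T S) :
    #K ≤ #S + 1 ∨ (∃ u ∈ K, ∃ v ∈ K, u ≠ v ∧ #K + #(pairSet G K T u v) ≤ #S + 2) ∨
      ∃ C ⊆ K \ T, #(K ∩ T) + Selection.cost (T \ K) (nbrs G K T) C ≤ #S := by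
  have hcard := card_sdiff_add_card K S
  have hKS : #K ≤ #(K \ S) + #S := by
    have := card_le_card (subset_union_left (s₁ := K) (s₂ := S))
    omega
  by_cases h1 : #(K \ S) ≤ 1
  · left; omega
  right
  by_cases h2 : #(K \ S) = 2
  · left
    obtain ⟨u, v, huv, e⟩ := card_eq_two.1 h2
    have hu : u ∈ K \ S := by rw [e]; simp
    have hv : v ∈ K \ S := by rw [e]; simp
    rw [mem_sdiff] at hu hv
    refine ⟨u, hu.1, v, hv.1, huv, ?_⟩
    have hsub : K ∩ S ∪ pairSet G K T u v ⊆ S := by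
      refine union_subset inter_subset_right fun w hw => ?_
      obtain ⟨-, hwK, h1, h2, h3⟩ := mem_filter.1 hw
      by_contra hwS
      have huv' := hK.clique u hu.1 v hv.1 huv
      rcases h3 with h3 | h3 | h3
      · exact h u v w hu.2 hv.2 hwS huv' h2 h1 h3
      · exact h v u w hv.2 hu.2 hwS huv'.symm h1 h2 h3
      · exact h w u v hwS hu.2 hv.2 h1.symm huv' h2.symm h3
    have hd : Disjoint (K ∩ S) (pairSet G K T u v) := by
      rw [disjoint_left]
      intro w hw hw'
      exact (mem_filter.1 hw').2.1 (mem_inter.1 hw).1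
    have h3 := card_le_card hsub
    rw [card_union_of_disjoint hd] at h3
    have h4 := card_sdiff_add_card_inter K S
    omega
  · right
    have h3 : 2 < #(K \ S) := by omega
    -- A surviving terminal in `K` would form a triangle with two further survivors.
    have hKT : K ∩ T ⊆ S := by
      intro x hx
      rw [mem_inter] at hx
      by_contra hxS
      have hx' : x ∈ K \ S := mem_sdiff.2 ⟨hx.1, hxS⟩
      have h4 : 1 < #((K \ S).erase x) := by rw [card_erase_of_mem hx']; omega
      obtain ⟨y, hy, z, hz, hyz⟩ := one_lt_card.1 h4
      simp only [mem_erase, mem_sdiff] at hy hz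
      exact h x y z hxS hy.2.2 hz.2.2 (hK.clique x hx.1 y hy.2.1 (Ne.symm hy.1))
        (hK.clique y hy.2.1 z hz.2.1 hyz) (hK.clique x hx.1 z hz.2.1 (Ne.symm hz.1)) hx.2
    refine ⟨S ∩ (K \ T), inter_subset_right, ?_⟩
    set W : Finset V := {b ∈ T \ K | 2 ≤ #(nbrs G K T b \ (S ∩ (K \ T)))} with hW
    have hWS : W ⊆ S := by
      intro b hb
      simp only [hW, mem_filter, mem_sdiff] at hb
      by_contra hbS
      obtain ⟨y, hy, z, hz, hyz⟩ := one_lt_card.1 (by omega : 1 < #(nbrs G K T b \ (S ∩ (K \ T))))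
      simp only [nbrs, mem_sdiff, mem_filter, mem_inter, not_and] at hy hz
      have hyS : y ∉ S := fun hs => hy.2 hs hy.1.1.1 hy.1.1.2
      have hzS : z ∉ S := fun hs => hz.2 hs hz.1.1.1 hz.1.1.2
      exact h b y z hbS hyS hzS hy.1.2 (hK.clique y hy.1.1.1 z hz.1.1.1 hyz) hz.1.2 hb.1.1
    have hd1 : Disjoint (S ∩ (K \ T)) W := by
      rw [disjoint_left]
      intro x hx hx'
      simp only [hW, mem_filter, mem_sdiff, mem_inter] at hx hx'
      exact hx'.1.2 hx.2.1
    have hd2 : Disjoint (K ∩ T) (S ∩ (K \ T) ∪ W) := by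
      rw [disjoint_left]
      intro x hx hx'
      simp only [hW, mem_filter, mem_sdiff, mem_inter, mem_union] at hx hx'
      tauto
    have h5 := card_le_card (union_subset hKT (union_subset (inter_subset_left (s₂ := K \ T)) hWS))
    rw [card_union_of_disjoint hd2, card_union_of_disjoint hd1] at h5
    unfold Selection.cost
    omega

/-- The three ways in which a subset feedback vertex set of size at most `k` may arise. -/
theorem exists_iff {K T : Finset V} (hK : IsPartition G K) (k : ℕ) :
    (∃ S : Finset V, #S ≤ k ∧ G.IsSubsetFeedbackVertexSet (T : Set V) (S : Set V)) ↔
      #K ≤ k + 1 ∨ (∃ u ∈ K, ∃ v ∈ K, u ≠ v ∧ #K + #(pairSet G K T u v) ≤ k + 2) ∨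
      (#(K ∩ T) ≤ k ∧ Selection.Feasible (K \ T) (T \ K) (nbrs G K T) ∅ ∅ (k - #(K ∩ T))) := by
  simp only [isSubsetFeedbackVertexSet_iff hK]
  constructor
  · rintro ⟨S, hS, h⟩
    rcases h.cases hK with h | ⟨u, hu, v, hv, huv, h⟩ | ⟨C, hC, h⟩
    · left; omega
    · exact Or.inr (Or.inl ⟨u, hu, v, hv, huv, by omega⟩)
    · refine Or.inr (Or.inr ⟨by omega, Selection.feasible_empty_iff.2 ⟨C, hC, by omega⟩⟩)
  · rintro (h | ⟨u, hu, v, hv, huv, h⟩ | ⟨h, h'⟩)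
    · exact HitsTriangles.of_le_one hK h
    · refine ⟨_, ?_, HitsTriangles.of_pair hK huv hu hv⟩
      have h1 := card_union_le ((K.erase u).erase v) (pairSet G K T u v)
      have h2 := card_erase_add_one hu
      have h3 := card_erase_add_one (mem_erase.2 ⟨huv.symm, hv⟩ : v ∈ K.erase u)
      omega
    · obtain ⟨C, hC, hc⟩ := Selection.feasible_empty_iff.1 h'
      refine ⟨_, ?_, HitsTriangles.of_selection (C := C) hK⟩
      have h1 := card_union_le (K ∩ T) (C ∪ {b ∈ T \ K | 2 ≤ #(nbrs G K T b \ C)})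
      have h2 := card_union_le C {b ∈ T \ K | 2 ≤ #(nbrs G K T b \ C)}
      unfold Selection.cost at hc
      omega

end SplitGraph

/-! ### Building blocks of the program -/

namespace RAM

open Finset

/-! ### Logic and counting as arithmetic -/

namespace Expr

/-- Positive values stand for `true`. -/
def Holds (n : ℕ) (e : Expr) (v m : ℕ → ℕ) : Prop := 0 < e.eval n v m

instance (n : ℕ) (e : Expr) (v m : ℕ → ℕ) : Decidable (e.Holds n v m) :=
  inferInstanceAs (Decidable (0 < e.eval n v m))

def add (e f : Expr) : Expr := .op .add e f
def sub (e f : Expr) : Expr := .op .sub e f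
def mul (e f : Expr) : Expr := .op .mul e f
def not (e : Expr) : Expr := sub (lit 1) e
-- Truncated subtraction is positive exactly for a strict inequality; likewise a product expresses a
-- conjunction, and a sum a disjunction or an existential quantifier.
def lt (e f : Expr) : Expr := sub f e
def le (e f : Expr) : Expr := not (lt f e)
def and (e f : Expr) : Expr := mul e f
def or (e f : Expr) : Expr := add e f
def eq (e f : Expr) : Expr := and (le e f) (le f e)
def ex (x : ℕ) (e : Expr) : Expr := sum x e
def all (x : ℕ) (e : Expr) : Expr := not (ex x (not e))

/-- The number of `x` with `e`. -/
def cnt (x : ℕ) (e : Expr) : Expr := sum x (not (not e))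

/-- The first `y` with `e`, or `n`; the variable `x` is auxiliary. -/
def first (x y : ℕ) (e : Expr) : Expr := cnt x (not (ex y (and (le (var y) (var x)) e)))

variable {n : ℕ} {e f : Expr} {v m : ℕ → ℕ} {x y : ℕ}

@[simp] theorem eval_lit (c : ℕ) : (lit c).eval n v m = c := rfl
@[simp] theorem eval_size : size.eval n v m = n := rfl
@[simp] theorem eval_var : (var x).eval n v m = v x := rfl
@[simp] theorem eval_load : (load e).eval n v m = m (e.eval n v m) := rfl
@[simp] theorem eval_add : (add e f).eval n v m = e.eval n v m + f.eval n v m := rfl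
@[simp] theorem eval_sub : (sub e f).eval n v m = e.eval n v m - f.eval n v m := rfl
@[simp] theorem eval_mul : (mul e f).eval n v m = e.eval n v m * f.eval n v m := rfl

theorem eval_not : (not e).eval n v m = if e.Holds n v m then 0 else 1 := by
  simp only [not, eval_sub, eval_lit]
  by_cases h : e.Holds n v m
  · rw [if_pos h]
    unfold Holds at h
    omega
  · rw [if_neg h]
    unfold Holds at h
    omega

theorem holds_load : (load e).Holds n v m ↔ 0 < m (e.eval n v m) := Iff.rfl
theorem holds_var : (var x).Holds n v m ↔ 0 < v x := Iff.rfl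

@[simp] theorem holds_not : (not e).Holds n v m ↔ ¬ e.Holds n v m := by
  rw [Holds, eval_not]
  split <;> simp [*]

@[simp] theorem holds_lt : (lt e f).Holds n v m ↔ e.eval n v m < f.eval n v m := by
  simp only [Holds, lt, eval_sub]; omega

@[simp] theorem holds_le : (le e f).Holds n v m ↔ e.eval n v m ≤ f.eval n v m := by
  rw [le, holds_not, holds_lt, not_lt]

@[simp] theorem holds_and : (and e f).Holds n v m ↔ e.Holds n v m ∧ f.Holds n v m := by
  simp only [Holds, and, eval_mul, CanonicallyOrderedAdd.mul_pos]

@[simp] theorem holds_or : (or e f).Holds n v m ↔ e.Holds n v m ∨ f.Holds n v m := by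
  simp only [Holds, or, eval_add]; omega

@[simp] theorem holds_eq : (eq e f).Holds n v m ↔ e.eval n v m = f.eval n v m := by
  rw [eq, holds_and, holds_le, holds_le]; omega

@[simp] theorem holds_ex : (ex x e).Holds n v m ↔
    ∃ i : Fin n, e.Holds n (Function.update v x i) m := by
  simp only [Holds, ex, eval]
  rw [Finset.sum_range (fun i => e.eval n (Function.update v x i) m), Finset.sum_pos_iff]
  simp

@[simp] theorem holds_all : (all x e).Holds n v m ↔
    ∀ i : Fin n, e.Holds n (Function.update v x i) m := by
  simp [all]

theorem eval_cnt : (cnt x e).eval n v m = #{i : Fin n | e.Holds n (Function.update v x i) m} := by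
  simp only [cnt, eval]
  rw [Finset.sum_range (fun i => (not (not e)).eval n (Function.update v x i) m),
    Finset.card_filter]
  refine Finset.sum_congr rfl fun i _ => ?_
  rw [eval_not]
  by_cases h : e.Holds n (Function.update v x i) m <;> simp [h]

theorem eval_cnt_eq {s : Finset (Fin n)}
    (h : ∀ i : Fin n, e.Holds n (Function.update v x i) m ↔ i ∈ s) :
    (cnt x e).eval n v m = #s := by
  rw [eval_cnt]
  congr 1
  ext i
  simp [h]

/-- The value of `first`. -/
theorem eval_first (p : Fin n → Prop) (hxy : x ≠ y)
    (h : ∀ i j : Fin n, e.Holds n (Function.update (Function.update v x i) y j) m ↔ p j) :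
    (∃ w : Fin n, (first x y e).eval n v m = w ∧ p w) ∨
      ((first x y e).eval n v m = n ∧ ∀ j, ¬ p j) := by
  classical
  -- `first` counts the indices that precede every witness.
  have hq : (first x y e).eval n v m = #{i : Fin n | ∀ j ≤ i, ¬ p j} := by
    refine eval_cnt_eq fun i => ?_
    simp only [holds_not, holds_ex, holds_and, holds_le, eval_var, h, mem_filter, mem_univ,
      true_and, not_exists, not_and, Function.update_self, Function.update_of_ne hxy]
    exact forall_congr' fun j => Iff.rfl
  by_cases hp : ∃ j, p j
  · left
    obtain ⟨j, hj⟩ := hp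
    have hne : ({j | p j} : Finset (Fin n)).Nonempty := ⟨j, by simpa using hj⟩
    obtain ⟨w, hw, hmin⟩ := exists_min_image _ id hne
    simp only [mem_filter, mem_univ, true_and, id] at hw hmin
    refine ⟨w, ?_, hw⟩
    have : ({i | ∀ j ≤ i, ¬ p j} : Finset (Fin n)) = Iio w := by
      ext i
      simp only [mem_filter, mem_univ, true_and, mem_Iio]
      refine ⟨fun hi => ?_, fun hi j hj hpj => absurd (hmin j hpj) (not_le.2 (hj.trans_lt hi))⟩
      by_contra hn
      exact hi w (not_lt.1 hn) hw
    rw [hq, this, Fin.card_Iio]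
  · right
    push Not at hp
    exact ⟨by rw [hq, filter_true_of_mem fun i _ j _ => hp j]; simp, hp⟩

end Expr

/-- The variables that a command may change. -/
def Cmd.writes : Cmd → List ℕ
  | .skip => []
  | .set x _ => [x]
  | .store _ _ => []
  | .seq c d => c.writes ++ d.writes
  | .ite _ c d => c.writes ++ d.writes
  | .loop x c => x :: c.writes

/-- Frame rule: the finite list of written variables can be checked by `decide`. -/
theorem Cmd.den_var {n : ℕ} {c : Cmd} {σ : Store} {x : ℕ} (h : x ∉ c.writes) :
    (c.den n σ).var x = σ.var x := by
  induction c generalizing σ with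
  | skip => rfl
  | set y e =>
    simp only [writes, List.mem_singleton] at h
    simp [den, Function.update_of_ne h]
  | store e f => rfl
  | seq c d ihc ihd =>
    simp only [writes, List.mem_append, not_or] at h
    simp only [den]
    rw [ihd h.2, ihc h.1]
  | ite e c d ihc ihd =>
    simp only [writes, List.mem_append, not_or] at h
    simp only [den]
    split
    · exact ihc h.1
    · exact ihd h.2
  | loop y c ih =>
    simp only [writes, List.mem_cons, not_or] at h
    refine iter_induction (fun _ (τ : Store) => τ.var x = σ.var x) rfl fun i _ τ hτ => ?_
    rw [ih h.2, ← hτ]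
    exact Function.update_of_ne h.1 _ _

theorem Cmd.den_seq {n : ℕ} {c d : Cmd} {σ : Store} :
    (Cmd.seq c d).den n σ = d.den n (c.den n σ) := rfl

/-- Induction on the iterations of a loop. -/
theorem Cmd.den_loop {n : ℕ} {x : ℕ} {c : Cmd} {σ : Store} (I : ℕ → Store → Prop) (h0 : I 0 σ)
    (h : ∀ (i : Fin n) (τ : Store), I i τ →
      I (i + 1) (c.den n ⟨Function.update τ.var x i, τ.mem⟩)) :
    I n ((Cmd.loop x c).den n σ) :=
  iter_induction I h0 fun i hi τ hτ => h ⟨i, hi⟩ τ hτ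

/-! #### Memory layout -/

/-- The start of the work space. -/
def base (n : ℕ) : ℕ := 2 + (n * n + n)

/-- The address of the price of `a`. -/
def prAddr (n a : ℕ) : ℕ := base n + 4 * a

/-- The address of the owner of `a`. -/
def owAddr (n a : ℕ) : ℕ := base n + (4 * a + 1)

/-- The address of the cell `i` of the slot `c`. -/
def slotAddr (n c i : ℕ) : ℕ := base n + (4 * (n * c + i) + 2)

/-- The memory holds the graph `G` and the terminal set `T`. -/
structure HoldsGraph {n : ℕ} (G : SimpleGraph (Fin n)) [DecidableRel G.Adj] (T : Finset (Fin n))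
    (m : ℕ → ℕ) : Prop where
  adj : ∀ i j : Fin n, m (2 + (i * n + j)) = if G.Adj i j then 1 else 0
  term : ∀ i : Fin n, m (2 + (n * n + i)) = if i ∈ T then 1 else 0

/-- Encoding of a node of the search tree. -/
def code {n : ℕ} (A B P D : Finset (Fin n)) (i : Fin n) : ℕ :=
  if i ∈ P then 1 else if i ∈ D then 2 else if i ∈ A then 0 else if i ∈ B then 3 else 4

/-- The slot `c` of the memory holds the node `(P, D)`. -/
def HoldsNode {n : ℕ} (A B P D : Finset (Fin n)) (c : ℕ) (m : ℕ → ℕ) : Prop :=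
  ∀ i : Fin n, m (slotAddr n c i) = code A B P D i

/-- The memories `m` and `m'` agree except for prices and owners. -/
def SameData (n : ℕ) (m m' : ℕ → ℕ) : Prop :=
  ∀ a, (∀ i, a ≠ prAddr n i ∧ a ≠ owAddr n i) → m' a = m a

section

variable {n : ℕ} {A B P D T : Finset (Fin n)} {G : SimpleGraph (Fin n)} [DecidableRel G.Adj]
  {m m' : ℕ → ℕ} {c : ℕ}

theorem SameData.refl (n : ℕ) (m : ℕ → ℕ) : SameData n m m := fun _ _ => rfl

theorem SameData.trans {m'' : ℕ → ℕ} (h : SameData n m m') (h' : SameData n m' m'') :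
    SameData n m m'' := fun a ha => (h' a ha).trans (h a ha)

theorem SameData.pr (h : SameData n m m') (i x : ℕ) :
    SameData n m (Function.update m' (prAddr n i) x) := fun a ha => by
  rw [Function.update_of_ne (ha i).1, h a ha]

theorem SameData.ow (h : SameData n m m') (i x : ℕ) :
    SameData n m (Function.update m' (owAddr n i) x) := fun a ha => by
  rw [Function.update_of_ne (ha i).2, h a ha]

/-- Relative to `base n`, prices, owners and slots occupy the residue classes 0, 1, 2 modulo 4, so
they never collide. -/
theorem SameData.slot (h : SameData n m m') (c i : ℕ) :
    m' (slotAddr n c i) = m (slotAddr n c i) :=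
  h _ fun j => by unfold slotAddr prAddr owAddr; omega

theorem SameData.input (h : SameData n m m') {a : ℕ} (ha : a < base n) : m' a = m a :=
  h _ fun j => by unfold prAddr owAddr; omega

theorem adj_addr_lt (i j : Fin n) : 2 + ((i : ℕ) * n + j) < base n := by
  have h1 : (i : ℕ) * n + n ≤ n * n := by
    have := Nat.mul_le_mul_right n i.2
    rwa [Nat.succ_mul] at this
  have := j.2
  unfold base
  omega

theorem HoldsGraph.congr (h : HoldsGraph G T m) (hm : ∀ a < base n, m' a = m a) :
    HoldsGraph G T m' :=
  ⟨fun i j => by rw [hm _ (adj_addr_lt i j), h.adj],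
    fun i => by rw [hm _ (by have := i.2; unfold base; omega), h.term]⟩

theorem HoldsGraph.sameData (h : HoldsGraph G T m) (hm : SameData n m m') : HoldsGraph G T m' :=
  h.congr fun _ ha => hm.input ha

theorem HoldsNode.sameData (h : HoldsNode A B P D c m) (hm : SameData n m m') :
    HoldsNode A B P D c m' := fun i => by rw [hm.slot, h i]

theorem code_eq_one (i : Fin n) : code A B P D i = 1 ↔ i ∈ P := by
  unfold code; split_ifs <;> simp_all

theorem code_eq_two (hv : Selection.Valid A P D) (i : Fin n) : code A B P D i = 2 ↔ i ∈ D := by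
  have : i ∈ P → i ∉ D := fun h => disjoint_left.1 hv.disj h
  unfold code; split_ifs <;> simp_all

theorem code_eq_zero (i : Fin n) : code A B P D i = 0 ↔ i ∈ A \ (P ∪ D) := by
  unfold code; split_ifs <;> simp_all

theorem code_eq_three (hv : Selection.Valid A P D) (hAB : Disjoint A B) (i : Fin n) :
    code A B P D i = 3 ↔ i ∈ B := by
  have h1 : i ∈ P → i ∉ B := fun h => disjoint_left.1 hAB (hv.left h)
  have h2 : i ∈ D → i ∉ B := fun h => disjoint_left.1 hAB (hv.right h)
  have h3 : i ∈ A → i ∉ B := fun h => disjoint_left.1 hAB h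
  unfold code; split_ifs <;> simp_all

/-- The neighbourhoods of the selection problem. -/
def nbr (G : SimpleGraph (Fin n)) [DecidableRel G.Adj] (A : Finset (Fin n)) (b : Fin n) :
    Finset (Fin n) :=
  {a ∈ A | G.Adj b a}

theorem nbr_subset (b : Fin n) : nbr G A b ⊆ A := filter_subset _ _

end

/-! ### The current node as seen by the program -/

namespace Expr

/-- Is the vertex `e` adjacent to the vertex `f`? -/
def adj (e f : Expr) : Expr := load (add (lit 2) (add (mul e size) f))

/-- Is the vertex `e` a terminal? -/
def term (e : Expr) : Expr := load (add (lit 2) (add (mul size size) e))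

def baseE : Expr := add (lit 2) (add (mul size size) size)

def prA (e : Expr) : Expr := add baseE (mul (lit 4) e)

def owA (e : Expr) : Expr := add baseE (add (mul (lit 4) e) (lit 1))

def slotA (c e : Expr) : Expr :=
  add baseE (add (mul (lit 4) (add (mul size c) e)) (lit 2))

/-- The state of the vertex `e` in the current slot, whose number is in the variable `6`. -/
def st (e : Expr) : Expr := load (slotA (var 6) e)

def isU (e : Expr) : Expr := eq (st e) (lit 0)
def isP (e : Expr) : Expr := eq (st e) (lit 1)
def isD (e : Expr) : Expr := eq (st e) (lit 2)
def isB (e : Expr) : Expr := eq (st e) (lit 3)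

/-- The number of neighbours of `x` that are kept. -/
def kept (x : ℕ) : Expr := cnt 20 (and (adj (var x) (var 20)) (isP (var 20)))

/-- The number of neighbours of `x` that are not deleted. -/
def rest (x : ℕ) : Expr :=
  cnt 20 (and (adj (var x) (var 20)) (or (isU (var 20)) (isP (var 20))))

/-- Counts serve as truth values: `not (kept x)` states that the count is zero. -/
def actB (x : ℕ) : Expr := and (isB (var x)) (and (not (kept x)) (lt (lit 1) (rest x)))

/-- The number of active neighbours of `x`. -/
def deg (x : ℕ) : Expr := cnt 21 (and (adj (var 21) (var x)) (actB 21))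

def actA (x : ℕ) : Expr := and (isU (var x)) (deg x)

variable {n : ℕ} {A B P D T : Finset (Fin n)} {G : SimpleGraph (Fin n)} [DecidableRel G.Adj]
  {m v : ℕ → ℕ} {e f c : Expr} {x : ℕ}

theorem holds_adj (hG : HoldsGraph G T m) {i j : Fin n} (he : e.eval n v m = i)
    (hf : f.eval n v m = j) : (adj e f).Holds n v m ↔ G.Adj i j := by
  rw [adj, holds_load]
  simp only [eval_add, eval_mul, eval_lit, eval_size, he, hf, hG.adj]
  split <;> simp [*]

theorem holds_term (hG : HoldsGraph G T m) {i : Fin n} (he : e.eval n v m = i) :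
    (term e).Holds n v m ↔ i ∈ T := by
  rw [term, holds_load]
  simp only [eval_add, eval_mul, eval_lit, eval_size, he, hG.term]
  split <;> simp [*]

@[simp] theorem eval_baseE : baseE.eval n v m = base n := rfl

@[simp] theorem eval_prA : (prA e).eval n v m = prAddr n (e.eval n v m) := rfl

@[simp] theorem eval_owA : (owA e).eval n v m = owAddr n (e.eval n v m) := rfl

@[simp] theorem eval_slotA : (slotA c e).eval n v m = slotAddr n (c.eval n v m) (e.eval n v m) :=
  rfl

theorem eval_st (hs : HoldsNode A B P D (v 6) m) {i : Fin n} (he : e.eval n v m = i) :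
    (st e).eval n v m = code A B P D i := by
  rw [st, eval_load, eval_slotA, he, eval_var, hs i]

theorem holds_isU (hs : HoldsNode A B P D (v 6) m) {i : Fin n} (he : e.eval n v m = i) :
    (isU e).Holds n v m ↔ i ∈ A \ (P ∪ D) := by
  rw [isU, holds_eq, eval_st hs he, eval_lit, code_eq_zero]

theorem holds_isP (hs : HoldsNode A B P D (v 6) m) {i : Fin n} (he : e.eval n v m = i) :
    (isP e).Holds n v m ↔ i ∈ P := by
  rw [isP, holds_eq, eval_st hs he, eval_lit, code_eq_one]

theorem holds_isD (hs : HoldsNode A B P D (v 6) m) (hv : Selection.Valid A P D) {i : Fin n}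
    (he : e.eval n v m = i) : (isD e).Holds n v m ↔ i ∈ D := by
  rw [isD, holds_eq, eval_st hs he, eval_lit, code_eq_two hv]

theorem holds_isB (hs : HoldsNode A B P D (v 6) m) (hv : Selection.Valid A P D)
    (hAB : Disjoint A B) {i : Fin n} (he : e.eval n v m = i) : (isB e).Holds n v m ↔ i ∈ B := by
  rw [isB, holds_eq, eval_st hs he, eval_lit, code_eq_three hv hAB]

theorem HoldsNode.update {v : ℕ → ℕ} (hs : HoldsNode A B P D (v 6) m) {y : ℕ} (hy : 6 ≠ y)
    (i : ℕ) : HoldsNode A B P D (Function.update v y i 6) m := by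
  rwa [Function.update_of_ne hy]

theorem eval_kept (hG : HoldsGraph G T m) (hs : HoldsNode A B P D (v 6) m)
    (hv : Selection.Valid A P D) {b : Fin n} (hx : x ≠ 20) (hb : v x = b) :
    (kept x).eval n v m = #(nbr G A b ∩ P) := by
  refine eval_cnt_eq fun i => ?_
  rw [holds_and, holds_adj hG (i := b) (j := i) (by simp [Function.update_of_ne hx, hb]) (by simp),
    holds_isP (HoldsNode.update hs (by decide) i) (i := i) (by simp), nbr, mem_inter, mem_filter]
  have := fun h : i ∈ P => hv.left h
  tauto

theorem eval_rest (hG : HoldsGraph G T m) (hs : HoldsNode A B P D (v 6) m)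
    (hv : Selection.Valid A P D) {b : Fin n} (hx : x ≠ 20) (hb : v x = b) :
    (rest x).eval n v m = #(nbr G A b \ D) := by
  refine eval_cnt_eq fun i => ?_
  rw [holds_and, holds_or, holds_adj hG (i := b) (j := i) (by simp [Function.update_of_ne hx, hb])
    (by simp), holds_isP (HoldsNode.update hs (by decide) i) (i := i) (by simp),
    holds_isU (HoldsNode.update hs (by decide) i) (i := i) (by simp), nbr]
  simp only [mem_sdiff, mem_filter, mem_union]
  have h1 := fun h : i ∈ P => hv.left h
  have h2 : i ∈ P → i ∉ D := fun h => disjoint_left.1 hv.disj h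
  tauto

theorem holds_actB (hG : HoldsGraph G T m) (hs : HoldsNode A B P D (v 6) m)
    (hv : Selection.Valid A P D) (hAB : Disjoint A B) {b : Fin n} (hx : x ≠ 20) (hb : v x = b) :
    (actB x).Holds n v m ↔ b ∈ Selection.activeB B (nbr G A) P D := by
  rw [actB, holds_and, holds_and, holds_not, holds_lt, holds_isB hs hv hAB (i := b) (by simp [hb]),
    Holds, eval_kept hG hs hv hx hb, eval_rest hG hs hv hx hb, eval_lit, Selection.mem_activeB,
    not_lt, Nat.le_zero, card_eq_zero]
  rfl

theorem eval_deg (hG : HoldsGraph G T m) (hs : HoldsNode A B P D (v 6) m)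
    (hv : Selection.Valid A P D) (hAB : Disjoint A B) {a : Fin n} (hx : x ≠ 21) (ha : v x = a)
    (haA : a ∈ A) :
    (deg x).eval n v m = Selection.degree B (nbr G A) P D a := by
  refine eval_cnt_eq fun i => ?_
  rw [holds_and, holds_adj hG (i := i) (j := a) (by simp) (by simp [Function.update_of_ne hx, ha]),
    holds_actB hG (HoldsNode.update hs (by decide) i) hv hAB (b := i) (by decide) (by simp),
    mem_filter, nbr, mem_filter]
  tauto

theorem holds_actA (hG : HoldsGraph G T m) (hs : HoldsNode A B P D (v 6) m)
    (hv : Selection.Valid A P D) (hAB : Disjoint A B) {a : Fin n} (hx : x ≠ 21) (ha : v x = a) :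
    (actA x).Holds n v m ↔ a ∈ Selection.activeA A B (nbr G A) P D := by
  rw [actA, holds_and, holds_isU hs (i := a) (by simp [ha]), Selection.mem_activeA, mem_sdiff,
    mem_union, not_or]
  by_cases haA : a ∈ A
  · rw [Holds, eval_deg hG hs hv hAB hx ha haA, Selection.degree, card_pos, filter_nonempty_iff]
    tauto
  · simp [haA]

end Expr

end RAM

/-! ### The program for the lower bound -/

namespace RAM

open Finset

/-- The clamp is invisible for values that fit; in each use the bound by `cap n` has to be supplied.
-/
theorem Cmd.den_set {n x : ℕ} {e : Expr} {σ : Store} (h : e.eval n σ.var σ.mem ≤ cap n) :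
    (Cmd.set x e).den n σ = ⟨Function.update σ.var x (e.eval n σ.var σ.mem), σ.mem⟩ := by
  simp only [Cmd.den, min_eq_left h]

theorem Cmd.den_store {n : ℕ} {e f : Expr} {σ : Store} (h : f.eval n σ.var σ.mem ≤ cap n) :
    (Cmd.store e f).den n σ =
      ⟨σ.var, Function.update σ.mem (e.eval n σ.var σ.mem) (f.eval n σ.var σ.mem)⟩ := by
  simp only [Cmd.den, min_eq_left h]

theorem Cmd.den_ite_pos {n : ℕ} {e : Expr} {c d : Cmd} {σ : Store}
    (h : e.Holds n σ.var σ.mem) : (Cmd.ite e c d).den n σ = c.den n σ := if_pos h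

theorem Cmd.den_ite_neg {n : ℕ} {e : Expr} {c d : Cmd} {σ : Store}
    (h : ¬ e.Holds n σ.var σ.mem) : (Cmd.ite e c d).den n σ = d.den n σ := if_neg h

theorem le_cap {n x : ℕ} (h : x ≤ n) : x ≤ cap n := by unfold cap; omega

open RAM.Expr in
/-- `22` is a cheapest possible bid of the vertex before `9`. -/
def candidate : Expr :=
  and (and (adj (sub (var 9) (lit 1)) (var 22)) (isU (var 22))) <|
  and (lt (load (prA (var 22))) size) <|
  all 23 (or (not (and (adj (sub (var 9) (lit 1)) (var 23)) (isU (var 23))))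
    (le (load (prA (var 22))) (load (prA (var 23)))))

open RAM.Expr RAM.Cmd in
/-- One bid. -/
def bidStep : Cmd :=
  ite (var 9)
    (seq (set 10 (first 24 22 candidate)) <|
      ite (lt (var 10) size)
        -- The previous owner is saved before being overwritten, since it is the next bidder.
        (seq (set 11 (load (owA (var 10)))) <|
         seq (store (owA (var 10)) (var 9)) <|
         seq (store (prA (var 10)) (add (load (prA (var 10))) (lit 1))) <|
         set 9 (var 11))
        (set 9 (lit 0)))
    skip

open RAM.Expr RAM.Cmd in
/-- Processing of the vertex `15`. -/
def bidFor : Cmd :=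
  ite (and (isB (var 15)) (eq (kept 15) (lit 1)))
    (seq (set 9 (add (var 15) (lit 1))) (loop 16 (loop 17 bidStep)))
    skip

open RAM.Expr RAM.Cmd in
/-- The lower bound for the current slot is written into the variable `7`. -/
def lowerCmd : Cmd :=
  seq (loop 14 (seq (store (prA (var 14)) (lit 0)) (store (owA (var 14)) (lit 0)))) <|
  seq (set 9 (lit 0)) <|
  seq (loop 15 bidFor) <|
  set 7 (add (cnt 20 (isD (var 20))) (add (cnt 21 (and (isB (var 21)) (lt (lit 1) (kept 21))))
    (cnt 20 (load (owA (var 20))))))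

/-! ### Correctness of the auction program -/

section

variable {n : ℕ} {A B P D T Z : Finset (Fin n)} {G : SimpleGraph (Fin n)} [DecidableRel G.Adj]
  {σ τ : Store}

/-- The price of a vertex. -/
def price (n : ℕ) (m : ℕ → ℕ) (a : Fin n) : ℕ := m (prAddr n a)

/-- The owner of a vertex. -/
def owner (n : ℕ) (m : ℕ → ℕ) (a : Fin n) : ℕ := m (owAddr n a)

/-- The undecided neighbours. -/
def bidSet (G : SimpleGraph (Fin n)) [DecidableRel G.Adj] (A P D : Finset (Fin n)) (b : Fin n) :
    Finset (Fin n) :=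
  nbr G A b ∩ (A \ (P ∪ D))

/-- The state of the auction. -/
structure AuctionState (G : SimpleGraph (Fin n)) [DecidableRel G.Adj] (A P D : Finset (Fin n))
    (σ : Store) (Z : Finset (Fin n)) (τ : Store) : Prop where
  slot : τ.var 6 = σ.var 6
  same : SameData n σ.mem τ.mem
  inv : Auction.Inv (bidSet G A P D) Z (price n τ.mem) (owner n τ.mem) (τ.var 9)

theorem AuctionState.update (h : AuctionState G A P D σ Z τ) {x i : ℕ} (h6 : 6 ≠ x) (h9 : 9 ≠ x) :
    AuctionState G A P D σ Z ⟨Function.update τ.var x i, τ.mem⟩ :=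
  ⟨by simp only [Function.update_of_ne h6, h.slot], h.same,
    by simpa only [Function.update_of_ne h9] using h.inv⟩

theorem mem_bidSet {a b : Fin n} : a ∈ bidSet G A P D b ↔ G.Adj b a ∧ a ∈ A \ (P ∪ D) := by
  simp only [bidSet, nbr, mem_inter, mem_filter, mem_sdiff]
  tauto

theorem holds_candidate {m v : ℕ → ℕ} (hG : HoldsGraph G T m) (hs : HoldsNode A B P D (v 6) m)
    {c f : Fin n} (hc : v 9 = c + 1) (hf : v 22 = f) :
    candidate.Holds n v m ↔ f ∈ bidSet G A P D c ∧ price n m f < n ∧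
      ∀ a ∈ bidSet G A P D c, price n m f ≤ price n m a := by
  have h1 : ∀ (w : ℕ → ℕ) (a : Fin n), w 9 = c + 1 →
      (Expr.sub (.var 9) (.lit 1)).eval n w m = c := by
    intro w a hw; simp [hw]
  simp only [candidate, Expr.holds_and, Expr.holds_lt, Expr.holds_all, Expr.holds_or,
    Expr.holds_not, Expr.holds_le, Expr.eval_load, Expr.eval_prA, Expr.eval_var, Expr.eval_size]
  rw [Expr.holds_adj hG (i := c) (j := f) (h1 _ f hc) (by simpa using hf),
    Expr.holds_isU hs (i := f) (by simpa using hf), mem_bidSet, hf]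
  refine and_congr_right fun _ => and_congr_right fun _ => forall_congr' fun a => ?_
  rw [Expr.holds_adj hG (i := c) (j := a) (h1 _ a (by simp [hc])) (by simp),
    Expr.holds_isU (Expr.HoldsNode.update hs (by decide) a) (i := a) (by simp), mem_bidSet]
  simp only [Function.update_self, ne_eq, Nat.reduceEqDiff, not_false_eq_true, Function.update_of_ne, hf]
  exact imp_iff_not_or.symm

theorem prAddr_inj {a b : Fin n} : prAddr n a = prAddr n b ↔ a = b := by
  unfold prAddr
  rw [Fin.ext_iff]; omega

theorem owAddr_inj {a b : Fin n} : owAddr n a = owAddr n b ↔ a = b := by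
  unfold owAddr
  rw [Fin.ext_iff]; omega

theorem prAddr_ne_owAddr {a b : ℕ} : prAddr n a ≠ owAddr n b := by
  unfold prAddr owAddr; omega

theorem price_update_pr (m : ℕ → ℕ) (f : Fin n) (x : ℕ) :
    price n (Function.update m (prAddr n f) x) = Function.update (price n m) f x := by
  ext a
  simp only [price, Function.update_apply, prAddr_inj]

theorem price_update_ow (m : ℕ → ℕ) (f : ℕ) (x : ℕ) :
    price n (Function.update m (owAddr n f) x) = price n m := by
  ext a
  simp only [price, Function.update_apply, prAddr_ne_owAddr, if_false]

theorem owner_update_ow (m : ℕ → ℕ) (f : Fin n) (x : ℕ) :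
    owner n (Function.update m (owAddr n f) x) = Function.update (owner n m) f x := by
  ext a
  simp only [owner, Function.update_apply, owAddr_inj]

theorem owner_update_pr (m : ℕ → ℕ) (f : ℕ) (x : ℕ) :
    owner n (Function.update m (prAddr n f) x) = owner n m := by
  ext a
  simp only [owner, Function.update_apply, prAddr_ne_owAddr.symm, if_false]

/-- Each call either finds or leaves the auction idle, or raises the sum of the prices by one; this
is the progress measure of the two nested loops. -/
theorem AuctionState.bidStep (hG : HoldsGraph G T σ.mem)
    (hs : HoldsNode A B P D (σ.var 6) σ.mem) (h : AuctionState G A P D σ Z τ) {j : ℕ}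
    (hj : τ.var 9 = 0 ∨ j ≤ ∑ a, price n τ.mem a) :
    AuctionState G A P D σ Z (bidStep.den n τ) ∧
      ((bidStep.den n τ).var 9 = 0 ∨ j + 1 ≤ ∑ a, price n (bidStep.den n τ).mem a) := by
  rw [RAM.bidStep]
  rcases Nat.eq_zero_or_pos (τ.var 9) with h0 | h0
  · rw [Cmd.den_ite_neg (by rw [Expr.holds_var]; omega)]
    exact ⟨h, Or.inl h0⟩
  have hj : j ≤ ∑ a, price n τ.mem a := by omega
  rw [Cmd.den_ite_pos (Expr.holds_var.2 h0)]
  obtain ⟨c, hc⟩ := Auction.exists_eq_succ h0 h.inv.cur_le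
  have hG' := hG.sameData h.same
  have hs' : HoldsNode A B P D (τ.var 6) τ.mem := by
    rw [h.slot]; exact hs.sameData h.same
  have hfirst := Expr.eval_first (n := n) (x := 24) (y := 22) (e := candidate) (v := τ.var)
    (m := τ.mem) (fun f => f ∈ bidSet G A P D c ∧ price n τ.mem f < n ∧
      ∀ a ∈ bidSet G A P D c, price n τ.mem f ≤ price n τ.mem a) (by decide)
    (fun i f => holds_candidate hG' (Expr.HoldsNode.update (Expr.HoldsNode.update hs' (by decide) i)
      (by decide) f) (by simp [hc]) (by simp))
  rw [Cmd.den_seq]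
  rcases hfirst with ⟨f, hf, hfc, hfn, hfmin⟩ | ⟨hf, hnone⟩
  · rw [Cmd.den_set (by rw [hf]; exact le_cap f.2.le), hf, Cmd.den_ite_pos (by simp)]
    rw [Cmd.den_seq, Cmd.den_set (by simpa [owner] using le_cap (h.inv.ow_le f)), Cmd.den_seq,
      Cmd.den_store (by simpa using le_cap h.inv.cur_le), Cmd.den_seq,
      Cmd.den_store (by
        simp [Function.update_of_ne prAddr_ne_owAddr]; exact le_cap (n := n) hfn),
      Cmd.den_set (by simpa [owner] using le_cap (h.inv.ow_le f))]
    have hb := h.inv.bid hc hfc hfn hfmin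
    simp only [Expr.eval_load, Expr.eval_owA, Expr.eval_prA, Expr.eval_var, Expr.eval_add,
      Expr.eval_lit, Function.update_self, ne_eq, Nat.reduceEqDiff,
      not_false_eq_true, Function.update_of_ne, prAddr_ne_owAddr]
    refine ⟨⟨by simp [h.slot], (h.same.ow _ _).pr _ _, ?_⟩, Or.inr ?_⟩
    · simp only [price_update_pr, price_update_ow, owner_update_ow, owner_update_pr,
        Function.update_self]
      exact hb
    · simp only [price_update_pr, price_update_ow]
      rw [Finset.sum_update_of_mem (mem_univ f)]
      have := Finset.sum_sdiff (f := price n τ.mem) (subset_univ ({f} : Finset (Fin n)))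
      rw [sum_singleton] at this
      have e : τ.mem (prAddr n f) = price n τ.mem f := rfl
      omega
  · rw [Cmd.den_set (by rw [hf]; exact le_cap le_rfl), hf, Cmd.den_ite_neg (by simp), Cmd.den_set (by simp)]
    refine ⟨⟨by simp [h.slot], h.same, ?_⟩, Or.inl (by simp)⟩
    simp only [Function.update_self, Expr.eval_lit]
    refine h.inv.giveUp hc fun a ha han => ?_
    obtain ⟨f, hf, hmin⟩ := exists_min_image _ (price n τ.mem) ⟨a, ha⟩
    exact hnone f ⟨hf, (hmin a ha).trans_lt han, hmin⟩

/-- The nested loops make `n * n` bids. If a bidder were still waiting, the prices would sum to at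
least `n * n`, contrary to `Inv.sum_le`. -/
theorem AuctionState.bidLoop (hG : HoldsGraph G T σ.mem)
    (hs : HoldsNode A B P D (σ.var 6) σ.mem) (h : AuctionState G A P D σ Z τ)
    (hU : #(A \ (P ∪ D)) < n) :
    AuctionState G A P D σ Z ((Cmd.loop 16 (.loop 17 RAM.bidStep)).den n τ) ∧
      ((Cmd.loop 16 (.loop 17 RAM.bidStep)).den n τ).var 9 = 0 := by
  have key := Cmd.den_loop (n := n) (x := 16) (c := .loop 17 RAM.bidStep) (σ := τ)
    (fun i τ' => AuctionState G A P D σ Z τ' ∧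
      (τ'.var 9 = 0 ∨ i * n ≤ ∑ a, price n τ'.mem a)) ⟨h, Or.inr (by simp)⟩ ?_
  · refine ⟨key.1, key.2.resolve_right ?_⟩
    have := key.1.inv.sum_le (U := A \ (P ∪ D)) (fun b => inter_subset_right) hU
    omega
  · rintro i τ₁ ⟨h₁, hp₁⟩
    have := Cmd.den_loop (n := n) (x := 17) (c := RAM.bidStep)
      (σ := ⟨Function.update τ₁.var 16 i, τ₁.mem⟩)
      (fun j τ' => AuctionState G A P D σ Z τ' ∧
        (τ'.var 9 = 0 ∨ i * n + j ≤ ∑ a, price n τ'.mem a))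
      ⟨h₁.update (by decide) (by decide), by simpa using hp₁⟩
      (fun j τ₂ h₂ => (h₂.1.update (by decide) (by decide)).bidStep hG hs (by simpa using h₂.2))
    rwa [Nat.succ_mul]

theorem AuctionState.bidFor (hG : HoldsGraph G T σ.mem)
    (hs : HoldsNode A B P D (σ.var 6) σ.mem) (hv : Selection.Valid A P D) (hAB : Disjoint A B)
    {b : Fin n} (hb : b ∉ Z) (h : AuctionState G A P D σ Z τ) (h9 : τ.var 9 = 0)
    (h15 : τ.var 15 = b) :
    AuctionState G A P D σ (if b ∈ B ∧ #(nbr G A b ∩ P) = 1 then insert b Z else Z)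
      (bidFor.den n τ) ∧ (bidFor.den n τ).var 9 = 0 := by
  have hG' := hG.sameData h.same
  have hs' : HoldsNode A B P D (τ.var 6) τ.mem := by
    rw [h.slot]; exact hs.sameData h.same
  have hcond : (Expr.and (Expr.isB (.var 15)) (Expr.eq (Expr.kept 15) (.lit 1))).Holds n τ.var τ.mem
      ↔ b ∈ B ∧ #(nbr G A b ∩ P) = 1 := by
    rw [Expr.holds_and, Expr.holds_isB hs' hv hAB (i := b) (by simp [h15]), Expr.holds_eq,
      Expr.eval_kept hG' hs' hv (by decide) h15, Expr.eval_lit]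
  rw [RAM.bidFor]
  by_cases hc : b ∈ B ∧ #(nbr G A b ∩ P) = 1
  -- The bidder `b` itself is outside of `A`, which gives the strict inequality.
  · have hU : #(A \ (P ∪ D)) < n := by
      have : A \ (P ∪ D) ⊆ univ.erase b := fun a ha => mem_erase.2
        ⟨fun e => disjoint_left.1 hAB (mem_sdiff.1 ha).1 (e ▸ hc.1), mem_univ a⟩
      have := card_le_card this
      rw [card_erase_of_mem (mem_univ b), card_univ, Fintype.card_fin] at this
      have := b.2
      omega
    rw [if_pos hc, Cmd.den_ite_pos (hcond.2 hc), Cmd.den_seq, Cmd.den_set (by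
      simpa [h15] using le_cap b.2)]
    refine AuctionState.bidLoop hG hs ⟨by simp [h.slot], h.same, ?_⟩ hU
    have := h.inv
    rw [h9] at this
    simpa [h15] using this.next hb
  · rw [if_neg hc, Cmd.den_ite_neg (fun h' => hc (hcond.1 h'))]
    exact ⟨h, h9⟩

/-- Correctness of `lowerCmd`. -/
theorem lowerCmd_spec (hG : HoldsGraph G T σ.mem)
    (hs : HoldsNode A B P D (σ.var 6) σ.mem) (hv : Selection.Valid A P D) (hAB : Disjoint A B) :
    (lowerCmd.den n σ).var 7 = Selection.lower A B (nbr G A) P D ∧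
      SameData n σ.mem (lowerCmd.den n σ).mem := by
  rw [lowerCmd, Cmd.den_seq]
  set c₁ : Cmd := .loop 14 (.seq (.store (Expr.prA (.var 14)) (.lit 0))
    (.store (Expr.owA (.var 14)) (.lit 0))) with hc₁
  have key₁ : SameData n σ.mem (c₁.den n σ).mem ∧ ∀ a : Fin n, (a : ℕ) < n →
      price n (c₁.den n σ).mem a = 0 ∧ owner n (c₁.den n σ).mem a = 0 := by
    refine Cmd.den_loop (n := n) (fun i τ => SameData n σ.mem τ.mem ∧ ∀ a : Fin n, (a : ℕ) < i →
      price n τ.mem a = 0 ∧ owner n τ.mem a = 0) ⟨SameData.refl n _, by simp⟩ ?_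
    rintro i τ ⟨h1, h2⟩
    rw [Cmd.den_seq, Cmd.den_store (by simp), Cmd.den_store (by simp)]
    simp only [Expr.eval_prA, Expr.eval_owA, Expr.eval_var, Function.update_self, Expr.eval_lit]
    refine ⟨(h1.pr _ _).ow _ _, fun a ha => ?_⟩
    rw [price_update_ow, price_update_pr, owner_update_ow, owner_update_pr]
    by_cases hai : a = i
    · simp [hai]
    · rw [Function.update_of_ne hai, Function.update_of_ne hai]
      refine h2 a ?_
      have : (a : ℕ) ≠ i := fun e => hai (Fin.ext e)
      omega
  have h6₁ : (c₁.den n σ).var 6 = σ.var 6 := Cmd.den_var (by simp [hc₁, Cmd.writes])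
  rw [Cmd.den_seq, Cmd.den_set (by simp), Expr.eval_lit]
  set τ₁ : Store := ⟨Function.update (c₁.den n σ).var 9 0, (c₁.den n σ).mem⟩ with hτ₁
  have h₁ : AuctionState G A P D σ ∅ τ₁ := by
    refine ⟨by simp [hτ₁, h6₁], key₁.1, ?_⟩
    have e1 : price n τ₁.mem = fun _ => 0 := by ext a; exact (key₁.2 a a.2).1
    have e2 : owner n τ₁.mem = fun _ => 0 := by ext a; exact (key₁.2 a a.2).2
    rw [e1, e2]
    simpa [hτ₁] using Auction.Inv.init (bidSet G A P D)
  -- Only the `b` with exactly one kept neighbour bid; with two or more they are charged anyway,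
  -- with none they are ignored.
  set B₀ : Finset (Fin n) := {b ∈ B | #(nbr G A b ∩ P) = 1} with hB₀
  have key₂ : AuctionState G A P D σ {b ∈ B₀ | (b : ℕ) < n} ((Cmd.loop 15 RAM.bidFor).den n τ₁) ∧
      ((Cmd.loop 15 RAM.bidFor).den n τ₁).var 9 = 0 := by
    refine Cmd.den_loop (n := n) (fun i τ => AuctionState G A P D σ {b ∈ B₀ | (b : ℕ) < i} τ ∧
      τ.var 9 = 0) ⟨by simpa using h₁, by simp [hτ₁]⟩ ?_
    rintro i τ ⟨h2, h3⟩
    have := (h2.update (x := 15) (i := i) (by decide) (by decide)).bidFor hG hs hv hAB (b := i)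
      (by simp) (by simpa using h3) (by simp)
    convert this using 2
    ext b
    have hb : (b : ℕ) < i + 1 ↔ b = i ∨ (b : ℕ) < i := by rw [Fin.ext_iff]; omega
    split_ifs with hi
    · simp only [mem_insert, mem_filter, hb, hB₀]
      constructor
      · rintro ⟨h, rfl | h'⟩
        · exact Or.inl rfl
        · exact Or.inr ⟨h, h'⟩
      · rintro (rfl | ⟨h, h'⟩)
        · exact ⟨hi, Or.inl rfl⟩
        · exact ⟨h, Or.inr h'⟩
    · simp only [mem_filter, hb, hB₀]
      constructor
      · rintro ⟨h, rfl | h'⟩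
        · exact absurd h hi
        · exact ⟨h, h'⟩
      · rintro ⟨h, h'⟩
        exact ⟨h, Or.inr h'⟩
  rw [Cmd.den_seq]
  set τ₂ := (Cmd.loop 15 RAM.bidFor).den n τ₁ with hτ₂
  obtain ⟨h₂, h9⟩ := key₂
  rw [filter_true_of_mem fun b _ => b.2] at h₂
  have hinv := h₂.inv
  rw [h9] at hinv
  have hG₂ := hG.sameData h₂.same
  have hs₂ : HoldsNode A B P D (τ₂.var 6) τ₂.mem := by
    rw [h₂.slot]; exact hs.sameData h₂.same
  -- The number of owned vertices is the size of a matching; both duality statements together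
  -- identify it with the cover number.
  have hlow := Selection.lower_eq (A := A) (B := B) (N := nbr G A)
    (m := #{a | 0 < owner n τ₂.mem a}) hv nbr_subset
    (fun C => hinv.card_owned_le C)
    (hinv.exists_cover (U := A \ (P ∪ D)) (fun b => inter_subset_right) (by
      rintro ⟨b, hb⟩
      have : A \ (P ∪ D) ⊆ univ.erase b := fun a ha => mem_erase.2
        ⟨fun e => disjoint_left.1 hAB (mem_sdiff.1 ha).1 (e ▸ (mem_filter.1 hb).1), mem_univ a⟩
      have := card_le_card this
      rw [card_erase_of_mem (mem_univ b), card_univ, Fintype.card_fin] at this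
      have := b.2
      omega))
  have e1 : (Expr.cnt 20 (Expr.isD (.var 20))).eval n τ₂.var τ₂.mem = #D :=
    Expr.eval_cnt_eq fun i => Expr.holds_isD (Expr.HoldsNode.update hs₂ (by decide) i) hv (by simp)
  have e2 : (Expr.cnt 21 (Expr.and (Expr.isB (.var 21)) (Expr.lt (.lit 1) (Expr.kept 21)))).eval n
      τ₂.var τ₂.mem = #{b ∈ B | 2 ≤ #(nbr G A b ∩ P)} := by
    refine Expr.eval_cnt_eq fun i => ?_
    rw [Expr.holds_and, Expr.holds_isB (Expr.HoldsNode.update hs₂ (by decide) i) hv hAB (i := i)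
      (by simp), Expr.holds_lt, Expr.eval_kept hG₂ (Expr.HoldsNode.update hs₂ (by decide) i) hv
      (b := i) (by decide) (by simp), mem_filter]
    rfl
  have e3 : (Expr.cnt 20 (.load (Expr.owA (.var 20)))).eval n τ₂.var τ₂.mem =
      #{a | 0 < owner n τ₂.mem a} := by
    refine Expr.eval_cnt_eq fun i => ?_
    rw [Expr.holds_load, mem_filter_univ]
    simp [owner]
  have hcard : ∀ s : Finset (Fin n), #s ≤ n := fun s => by
    simpa using card_le_univ s
  -- The three counts sum to at most `3 * n`, which `cap n` accommodates.
  rw [Cmd.den_set (by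
    simp only [Expr.eval_add, e1, e2, e3]
    have h1 := hcard D
    have h2 := hcard {b ∈ B | 2 ≤ #(nbr G A b ∩ P)}
    have h3 := hcard {a | 0 < owner n τ₂.mem a}
    unfold cap; omega)]
  simp only [Expr.eval_add, e1, e2, e3, Function.update_self]
  exact ⟨by rw [hlow]; ring, h₂.same⟩

end

end RAM

/-! ### The search -/

namespace RAM

open Finset

open RAM.Expr RAM.Cmd in
/-- Is the vertex `18` essential? -/
def scanStep : Cmd :=
  ite (actA 18)
    (seq (store (slotA (var 6) (var 18)) (lit 2)) <|
     seq lowerCmd <|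
     seq (store (slotA (var 6) (var 18)) (lit 0)) <|
     ite (eq (var 7) (var 8)) (set 12 (var 18)) skip)
    skip

open RAM.Expr RAM.Cmd in
/-- The vertex on which to branch. -/
def pickCmd : Cmd :=
  seq (set 13 (first 24 22 (and (actA 22) (lt (lit 1) (deg 22))))) <|
  ite (lt (var 13) size) skip (set 13 (first 24 22 (actA 22)))

open RAM.Expr RAM.Cmd in
/-- Branching on the vertex `13`. -/
def splitCmd : Cmd :=
  seq (loop 19 (store (slotA (var 5) (var 19)) (load (slotA (var 6) (var 19))))) <|
  seq (store (slotA (var 6) (var 13)) (lit 2)) <|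
  seq (store (slotA (var 5) (var 13)) (lit 1)) <|
  set 5 (add (var 5) (lit 1))

open RAM.Expr RAM.Cmd in
/-- Replacement of the current node by its children, where `12` is an essential vertex, or `n`. -/
def expandCmd : Cmd :=
  ite (lt (var 12) size)
    (store (slotA (var 6) (var 12)) (lit 2))
    (seq pickCmd <|
     ite (lt (var 13) size) splitCmd (seq (set 0 (lit 1)) (set 5 (lit 0))))

open RAM.Expr RAM.Cmd in
/-- One step of the search; the stack has `5` nodes. -/
def searchStep : Cmd :=
  seq (set 6 (sub (var 5) (lit 1))) <|
  seq lowerCmd <|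
  ite (le (var 7) (var 4))
    (seq (set 8 (var 7)) <|
     seq (set 12 size) <|
     seq (loop 18 scanStep) <|
     expandCmd)
    (set 5 (sub (var 5) (lit 1)))

/-! ### Correctness of the search -/

section

variable {n k c : ℕ} {A B P D T : Finset (Fin n)} {G : SimpleGraph (Fin n)} [DecidableRel G.Adj]
  {σ τ : Store} {m m' : ℕ → ℕ}

theorem slotAddr_inj {c' : ℕ} {i j : Fin n} (h : slotAddr n c i = slotAddr n c' j) :
    c = c' ∧ i = j := by
  have h : n * c + i = n * c' + j := by unfold slotAddr at h; omega
  have hn : 0 < n := i.pos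
  have h1 := congrArg (· / n) h
  have h2 := congrArg (· % n) h
  simp only [Nat.mul_add_div hn, Nat.mul_add_mod, Nat.div_eq_of_lt i.2, Nat.div_eq_of_lt j.2,
    Nat.mod_eq_of_lt i.2, Nat.mod_eq_of_lt j.2] at h1 h2
  exact ⟨by simpa using h1, Fin.ext h2⟩

theorem slotAddr_inj_iff {i j : Fin n} : slotAddr n c i = slotAddr n c j ↔ i = j :=
  ⟨fun h => (slotAddr_inj h).2, fun h => by rw [h]⟩

theorem HoldsNode.insert_right (h : HoldsNode A B P D c m) {a : Fin n} (ha : a ∈ A \ (P ∪ D)) :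
    HoldsNode A B P (insert a D) c (Function.update m (slotAddr n c a) 2) := by
  intro i
  simp only [mem_sdiff, mem_union, not_or] at ha
  by_cases hi : i = a
  · subst hi
    simp [code, ha]
  · rw [Function.update_of_ne (mt slotAddr_inj_iff.1 hi), h i]
    simp [code, hi]

theorem HoldsNode.insert_left (h : HoldsNode A B P D c m) (a : Fin n) :
    HoldsNode A B (insert a P) D c (Function.update m (slotAddr n c a) 1) := by
  intro i
  by_cases hi : i = a
  · subst hi
    simp [code]
  · rw [Function.update_of_ne (mt slotAddr_inj_iff.1 hi), h i]
    simp [code, hi]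

theorem HoldsNode.congr {c' : ℕ} (h : HoldsNode A B P D c m)
    (hm : ∀ i : Fin n, m' (slotAddr n c' i) = m (slotAddr n c i)) : HoldsNode A B P D c' m' :=
  fun i => by rw [hm, h i]

theorem base_le_slotAddr (n c i : ℕ) : base n ≤ slotAddr n c i := by unfold slotAddr; omega

theorem HoldsGraph.updateSlot (h : HoldsGraph G T m) (c i x : ℕ) :
    HoldsGraph G T (Function.update m (slotAddr n c i) x) :=
  h.congr fun a ha => Function.update_of_ne (by have := base_le_slotAddr n c i; omega) _ _

/-- The search for an essential vertex. -/
theorem scan_spec (hG : HoldsGraph G T σ.mem)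
    (hs : HoldsNode A B P D (σ.var 6) σ.mem) (hv : Selection.Valid A P D) (hAB : Disjoint A B)
    (h8 : σ.var 8 = Selection.lower A B (nbr G A) P D) (h12 : σ.var 12 = n) :
    SameData n σ.mem ((Cmd.loop 18 scanStep).den n σ).mem ∧
      ((∃ a ∈ Selection.activeA A B (nbr G A) P D, Selection.Essential A B (nbr G A) P D a ∧
        ((Cmd.loop 18 scanStep).den n σ).var 12 = a) ∨
      (((Cmd.loop 18 scanStep).den n σ).var 12 = n ∧
        ∀ a ∈ Selection.activeA A B (nbr G A) P D, ¬ Selection.Essential A B (nbr G A) P D a)) := by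
  have key := Cmd.den_loop (n := n) (x := 18) (c := scanStep) (σ := σ)
    (fun i τ => (τ.var 6 = σ.var 6 ∧ τ.var 8 = σ.var 8) ∧ SameData n σ.mem τ.mem ∧
      ((∃ a ∈ Selection.activeA A B (nbr G A) P D, Selection.Essential A B (nbr G A) P D a ∧
        τ.var 12 = a) ∨
      (τ.var 12 = n ∧ ∀ a ∈ Selection.activeA A B (nbr G A) P D, (a : ℕ) < i →
        ¬ Selection.Essential A B (nbr G A) P D a)))
    ⟨⟨rfl, rfl⟩, SameData.refl n _, Or.inr ⟨h12, by simp⟩⟩ ?_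
  · refine ⟨key.2.1, key.2.2.imp id fun h => ⟨h.1, fun a ha => h.2 a ha a.2⟩⟩
  rintro i τ ⟨⟨h6', h8'⟩, hsame, hres⟩
  have hG' := hG.sameData hsame
  have hs' : HoldsNode A B P D (τ.var 6) τ.mem := by rw [h6']; exact hs.sameData hsame
  have hcond := Expr.holds_actA (v := Function.update τ.var 18 i) (x := 18) hG'
    (Expr.HoldsNode.update hs' (by decide) i) hv hAB (a := i) (by decide) (by simp)
  have hlt : ∀ a : Fin n, (a : ℕ) < i + 1 → a = i ∨ (a : ℕ) < i := fun a ha => by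
    rw [Fin.ext_iff]; omega
  by_cases hi : i ∈ Selection.activeA A B (nbr G A) P D
  · rw [scanStep, Cmd.den_ite_pos (hcond.2 hi), Cmd.den_seq,
      Cmd.den_store (by simp only [Expr.eval_lit, cap]; omega), Cmd.den_seq]
    simp only [Expr.eval_slotA, Expr.eval_var, Expr.eval_lit, Function.update_self, ne_eq,
      Nat.reduceEqDiff, not_false_eq_true, Function.update_of_ne]
    set ρ : Store := ⟨Function.update τ.var 18 i,
      Function.update τ.mem (slotAddr n (τ.var 6) i) 2⟩ with hρ
    obtain ⟨hiA, hiP, hiD, -⟩ := Selection.mem_activeA.1 hi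
    have hiU : i ∈ A \ (P ∪ D) := by simp [hiA, hiP, hiD]
    have hρ6 : ρ.var 6 = τ.var 6 := by simp [hρ]
    obtain ⟨hl, hls⟩ := lowerCmd_spec (σ := ρ) (T := T) (hG'.updateSlot _ _ _)
      (by rw [hρ6]; exact hs'.insert_right hiU) (hv.insert_right hiA hiP) hAB
    have hvar : ∀ x ∉ lowerCmd.writes, (lowerCmd.den n ρ).var x = ρ.var x :=
      fun x hx => Cmd.den_var hx
    set π := lowerCmd.den n ρ with hπ
    have π6 : π.var 6 = τ.var 6 := by rw [hvar 6 (by decide)]; simp [hρ]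
    have π8 : π.var 8 = τ.var 8 := by rw [hvar 8 (by decide)]; simp [hρ]
    have π12 : π.var 12 = τ.var 12 := by rw [hvar 12 (by decide)]; simp [hρ]
    have π18 : π.var 18 = i := by rw [hvar 18 (by decide)]; simp [hρ]
    rw [Cmd.den_seq, Cmd.den_store (by simp)]
    simp only [Expr.eval_slotA, Expr.eval_var, Expr.eval_lit, π6, π18]
    -- The tentative deletion of `i` is undone: `i` was undecided, so writing code `0` restores the
    -- slot, and only prices and owners differ.
    have hmem : SameData n τ.mem (Function.update π.mem (slotAddr n (τ.var 6) i) 0) := by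
      intro a ha
      by_cases hai : a = slotAddr n (τ.var 6) i
      · subst hai
        rw [Function.update_self, hs' i, (code_eq_zero i).2 hiU]
      · rw [Function.update_of_ne hai, hls a ha]
        exact Function.update_of_ne hai _ _
    have hess : (Expr.eq (.var 7) (.var 8)).Holds n π.var
        (Function.update π.mem (slotAddr n (τ.var 6) i) 0) ↔
        Selection.Essential A B (nbr G A) P D i := by
      rw [Expr.holds_eq, Expr.eval_var, Expr.eval_var, hl, π8, h8', h8]
      exact Iff.rfl
    by_cases he : Selection.Essential A B (nbr G A) P D i
    · rw [Cmd.den_ite_pos (hess.2 he), Cmd.den_set (by simpa [π18] using le_cap i.2.le)]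
      exact ⟨⟨by simp [π6, h6'], by simp [π8, h8']⟩, hsame.trans hmem,
        Or.inl ⟨i, hi, he, by simp [π18]⟩⟩
    · rw [Cmd.den_ite_neg (mt hess.1 he)]
      refine ⟨⟨by simp [Cmd.den, π6, h6'], by simp [Cmd.den, π8, h8']⟩, hsame.trans hmem, ?_⟩
      simp only [Cmd.den, π12]
      refine hres.imp id fun h => ⟨h.1, fun a ha hai => ?_⟩
      rcases hlt a hai with rfl | h'
      · exact he
      · exact h.2 a ha h'
  · rw [scanStep, Cmd.den_ite_neg (mt hcond.1 hi)]
    refine ⟨⟨by simp [Cmd.den, h6'], by simp [Cmd.den, h8']⟩, hsame, ?_⟩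
    refine hres.imp (by simp [Cmd.den]) fun h => ⟨by simp [Cmd.den, h.1], fun a ha hai => ?_⟩
    rcases hlt a hai with rfl | h'
    · exact absurd ha hi
    · exact h.2 a ha h'

/-- An active element of degree at least two is preferred; another one is chosen only if none
exists, as `leafPotential_branch` requires. -/
theorem pick_spec (hG : HoldsGraph G T σ.mem)
    (hs : HoldsNode A B P D (σ.var 6) σ.mem) (hv : Selection.Valid A P D) (hAB : Disjoint A B) :
    ∃ g ≤ n, pickCmd.den n σ = ⟨Function.update σ.var 13 g, σ.mem⟩ ∧
      ((∃ a ∈ Selection.activeA A B (nbr G A) P D, g = a ∧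
        (2 ≤ Selection.degree B (nbr G A) P D a ∨
          ∀ x ∈ Selection.activeA A B (nbr G A) P D, Selection.degree B (nbr G A) P D x < 2)) ∨
      (g = n ∧ Selection.activeA A B (nbr G A) P D = ∅)) := by
  have hact : ∀ (v : ℕ → ℕ) (i j : Fin n), v 6 = σ.var 6 →
      ((Expr.actA 22).Holds n (Function.update (Function.update v 24 i) 22 j) σ.mem ↔
        j ∈ Selection.activeA A B (nbr G A) P D) := fun v i j hv6 =>
    Expr.holds_actA hG (by simpa [hv6] using hs) hv hAB (by decide) (by simp)
  have h1 := Expr.eval_first (n := n) (x := 24) (y := 22)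
    (e := .and (.actA 22) (.lt (.lit 1) (.deg 22))) (v := σ.var) (m := σ.mem)
    (fun j => j ∈ Selection.activeA A B (nbr G A) P D ∧
      2 ≤ Selection.degree B (nbr G A) P D j) (by decide) (fun i j => by
        rw [Expr.holds_and, hact _ i j rfl, Expr.holds_lt]
        refine and_congr_right fun hj => ?_
        rw [Expr.eval_deg hG (by simpa using hs) hv hAB (a := j) (by decide) (by simp)
          (Selection.mem_activeA.1 hj).1]
        exact Iff.rfl)
  rw [pickCmd, Cmd.den_seq]
  rcases h1 with ⟨w, hw, hwa, hwd⟩ | ⟨hw, hnone⟩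
  · rw [Cmd.den_set (by rw [hw]; exact le_cap w.2.le), hw, Cmd.den_ite_pos (by simp)]
    exact ⟨w, w.2.le, rfl, Or.inl ⟨w, hwa, rfl, Or.inl hwd⟩⟩
  · rw [Cmd.den_set (by rw [hw]; exact le_cap le_rfl), hw, Cmd.den_ite_neg (by simp)]
    have h2 := Expr.eval_first (n := n) (x := 24) (y := 22) (e := .actA 22)
      (v := Function.update σ.var 13 n) (m := σ.mem)
      (fun j => j ∈ Selection.activeA A B (nbr G A) P D) (by decide)
      (fun i j => hact _ i j (by simp))
    rcases h2 with ⟨w, hw, hwa⟩ | ⟨hw, hnone'⟩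
    · rw [Cmd.den_set (by rw [hw]; exact le_cap w.2.le), hw]
      refine ⟨w, w.2.le, by simp, Or.inl ⟨w, hwa, rfl, Or.inr fun x hx => ?_⟩⟩
      exact not_le.1 fun h => hnone x ⟨hx, h⟩
    · rw [Cmd.den_set (by rw [hw]; exact le_cap le_rfl), hw]
      exact ⟨n, le_rfl, by simp, Or.inr ⟨rfl, eq_empty_of_forall_notMem hnone'⟩⟩

/-- The child that deletes `a` reuses the current slot, and the child that keeps `a` is a modified
copy on top of the stack. -/
theorem split_spec (hG : HoldsGraph G T σ.mem)
    (hs : HoldsNode A B P D (σ.var 6) σ.mem) {a : Fin n} (ha : a ∈ A \ (P ∪ D))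
    (h13 : σ.var 13 = a) (h56 : σ.var 5 = σ.var 6 + 1) (h5 : σ.var 5 ≤ n) :
    HoldsGraph G T (splitCmd.den n σ).mem ∧
      HoldsNode A B P (insert a D) (σ.var 6) (splitCmd.den n σ).mem ∧
      HoldsNode A B (insert a P) D (σ.var 5) (splitCmd.den n σ).mem ∧
      (∀ c < σ.var 6, ∀ i : Fin n,
        (splitCmd.den n σ).mem (slotAddr n c i) = σ.mem (slotAddr n c i)) ∧
      (splitCmd.den n σ).var 0 = σ.var 0 ∧ (splitCmd.den n σ).var 4 = σ.var 4 ∧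
      (splitCmd.den n σ).var 5 = σ.var 5 + 1 := by
  have key := Cmd.den_loop (n := n) (x := 19) (c := .store (.slotA (.var 5) (.var 19))
      (.load (.slotA (.var 6) (.var 19)))) (σ := σ)
    (fun i τ => (∀ x, x ≠ 19 → τ.var x = σ.var x) ∧ HoldsGraph G T τ.mem ∧
      (∀ c ≤ σ.var 6, ∀ j : Fin n, τ.mem (slotAddr n c j) = σ.mem (slotAddr n c j)) ∧
      ∀ j : Fin n, (j : ℕ) < i → τ.mem (slotAddr n (σ.var 5) j) = σ.mem (slotAddr n (σ.var 6) j))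
    ⟨fun _ _ => rfl, hG, fun _ _ _ => rfl, by simp⟩ ?_
  · rw [splitCmd, Cmd.den_seq]
    set ρ := (Cmd.loop 19 (.store (.slotA (.var 5) (.var 19))
      (.load (.slotA (.var 6) (.var 19))))).den n σ
    obtain ⟨hvar, hρG, hold, hnew⟩ := key
    have ρ5 := hvar 5 (by decide)
    have ρ6 := hvar 6 (by decide)
    have ρ13 := hvar 13 (by decide)
    rw [Cmd.den_seq, Cmd.den_store (by simp only [Expr.eval_lit, cap]; omega), Cmd.den_seq,
      Cmd.den_store (by simp [cap]),
      Cmd.den_set (by simp [ρ5]; unfold cap; omega)]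
    simp only [Expr.eval_slotA, Expr.eval_var, Expr.eval_lit, Expr.eval_add, ρ5, ρ6, ρ13, h13]
    have hne : ∀ c c' : ℕ, c ≠ c' → ∀ i j : Fin n, slotAddr n c i ≠ slotAddr n c' j :=
      fun c c' h i j e => h (slotAddr_inj e).1
    refine ⟨(hρG.updateSlot _ _ _).updateSlot _ _ _, ?_, ?_, ?_, ?_, ?_, ?_⟩
    · refine (HoldsNode.insert_right (hs.congr (hold _ le_rfl)) ha).congr fun i => ?_
      rw [Function.update_of_ne (hne _ _ (by omega) _ _)]
    · refine HoldsNode.insert_left (hs.congr fun i => ?_) a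
      rw [Function.update_of_ne (hne _ _ (by omega) _ _), hnew i i.2]
    · intro c hc i
      rw [Function.update_of_ne (hne _ _ (by omega) _ _),
        Function.update_of_ne (hne _ _ (by omega) _ _), hold c hc.le]
    · simp [hvar 0]
    · simp [hvar 4]
    · simp
  · rintro i τ ⟨hvar, hτG, hold, hnew⟩
    have τ5 := hvar 5 (by decide)
    have τ6 := hvar 6 (by decide)
    have hval : τ.mem (slotAddr n (σ.var 6) i) ≤ cap n := by
      rw [hold _ le_rfl, hs i]
      unfold code cap
      split_ifs <;> omega
    rw [Cmd.den_store (by simpa [τ6] using hval)]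
    simp only [Expr.eval_slotA, Expr.eval_var, Expr.eval_load, Function.update_self, ne_eq,
      Nat.reduceEqDiff, not_false_eq_true, Function.update_of_ne, τ5, τ6]
    refine ⟨fun x hx => ?_, hτG.updateSlot _ _ _, fun c hc j => ?_, fun j hj => ?_⟩
    · rw [Function.update_of_ne hx, hvar x hx]
    · rw [Function.update_of_ne (fun e => by have := (slotAddr_inj e).1; omega), hold c hc]
    · rw [hold _ le_rfl]
      by_cases hji : j = i
      · rw [hji, Function.update_self]
      · rw [Function.update_of_ne (mt slotAddr_inj_iff.1 hji), hnew j ?_]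
        have : (j : ℕ) ≠ i := fun e => hji (Fin.ext e)
        omega

/-- The memory holds a stack of nodes. -/
def HoldsStack (A B : Finset (Fin n)) : List (Finset (Fin n) × Finset (Fin n)) → (ℕ → ℕ) → Prop
  | [], _ => True
  -- The cardinality condition bounds the depth of the stack: a slot is added only when an element
  -- gets decided. So slot numbers fit below `cap n`.
  | x :: L, m => Selection.Valid A x.1 x.2 ∧ #(A \ (x.1 ∪ x.2)) + L.length ≤ n ∧
      HoldsNode A B x.1 x.2 L.length m ∧ HoldsStack A B L m

theorem HoldsStack.congr {L : List (Finset (Fin n) × Finset (Fin n))} (h : HoldsStack A B L m)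
    (hm : ∀ c < L.length, ∀ i : Fin n, m' (slotAddr n c i) = m (slotAddr n c i)) :
    HoldsStack A B L m' := by
  induction L with
  | nil => trivial
  | cons x L ih =>
    simp only [List.length_cons] at hm
    exact ⟨h.1, h.2.1, h.2.2.1.congr (hm _ (by omega)),
      ih h.2.2.2 fun c hc => hm c (by omega)⟩

/-- The potential of a node. -/
noncomputable def nodePotential (G : SimpleGraph (Fin n)) [DecidableRel G.Adj]
    (A B : Finset (Fin n)) (k : ℕ) (x : Finset (Fin n) × Finset (Fin n)) : ℝ :=
  (2 * #(A \ (x.1 ∪ x.2)) + 1) * Selection.leafPotential A B (nbr G A) k x.1 x.2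

theorem nodePotential_nonneg (x : Finset (Fin n) × Finset (Fin n)) :
    0 ≤ nodePotential G A B k x :=
  mul_nonneg (by positivity) (Selection.leafPotential_pos).le

theorem one_le_nodePotential (x : Finset (Fin n) × Finset (Fin n)) :
    1 ≤ nodePotential G A B k x := by
  refine one_le_mul_of_one_le_of_one_le ?_ Selection.one_le_leafPotential
  have : (0 : ℝ) ≤ #(A \ (x.1 ∪ x.2)) := by positivity
  linarith

theorem sum_nodePotential_nonneg (L : List (Finset (Fin n) × Finset (Fin n))) :
    0 ≤ (L.map (nodePotential G A B k)).sum :=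
  List.sum_nonneg fun x hx => by
    obtain ⟨y, -, rfl⟩ := List.mem_map.1 hx
    exact nodePotential_nonneg y

/-- The invariant of the search; `Q` is the answer. -/
def SearchState (G : SimpleGraph (Fin n)) [DecidableRel G.Adj] (T A B : Finset (Fin n)) (k : ℕ)
    (Q : Prop) (r : ℝ) (σ : Store) : Prop :=
  ∃ L : List (Finset (Fin n) × Finset (Fin n)), HoldsGraph G T σ.mem ∧ HoldsStack A B L σ.mem ∧
    σ.var 4 = k ∧ σ.var 5 = L.length ∧ r = (L.map (nodePotential G A B k)).sum ∧
    ((σ.var 0 = 1 ∧ Q ∧ L = []) ∨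
      (σ.var 0 = 0 ∧ (Q ↔ ∃ x ∈ L, Selection.Feasible A B (nbr G A) x.1 x.2 k)))

theorem SearchState.nonneg {Q : Prop} {r : ℝ} (h : SearchState G T A B k Q r σ) : 0 ≤ r := by
  obtain ⟨L, -, -, -, -, rfl, -⟩ := h
  exact sum_nodePotential_nonneg L

theorem SearchState.answer {Q : Prop} {r : ℝ} (h : SearchState G T A B k Q r σ)
    (h5 : σ.var 5 = 0) : (σ.var 0 = 1 ∧ Q) ∨ (σ.var 0 = 0 ∧ ¬ Q) := by
  obtain ⟨L, -, -, -, hL, -, ha⟩ := h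
  rw [h5] at hL
  rw [List.length_eq_zero_iff.1 hL.symm] at ha
  exact ha.imp (fun h => ⟨h.1, h.2.1⟩) fun h => ⟨h.1, by simp [h.2]⟩

theorem card_sdiff_insert_right {a : Fin n} (ha : a ∈ A \ (P ∪ D)) :
    #(A \ (P ∪ insert a D)) + 1 = #(A \ (P ∪ D)) := by
  rw [union_insert, sdiff_insert, card_erase_add_one ha]

theorem card_sdiff_insert_left {a : Fin n} (ha : a ∈ A \ (P ∪ D)) :
    #(A \ (insert a P ∪ D)) + 1 = #(A \ (P ∪ D)) := by
  rw [insert_union, sdiff_insert, card_erase_add_one ha]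

/-- The measure need not drop here, but `u` does; the factor `2u + 1` then loses twice a measure
that is at least one. -/
theorem nodePotential_essential {a : Fin n} (hv : Selection.Valid A P D) (ha : a ∈ A \ (P ∪ D))
    (he : Selection.Essential A B (nbr G A) P D a) :
    nodePotential G A B k (P, insert a D) + 1 ≤ nodePotential G A B k (P, D) := by
  have hu := card_sdiff_insert_right ha
  simp only [mem_sdiff, mem_union, not_or] at ha
  have h1 := Selection.leafPotential_essential (k := k) hv ha.1 ha.2.1 he
  have h2 := Selection.one_le_leafPotential (A := A) (B := B) (N := nbr G A) (k := k) (P := P)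
    (D := insert a D)
  unfold nodePotential
  simp only [← hu]
  push_cast
  nlinarith [Nat.cast_nonneg (α := ℝ) #(A \ (P ∪ insert a D))]

/-- Both children have one undecided element fewer. Since their measures sum to at most that of the
node, `2` copies of the measure are gained, which exceeds one. -/
theorem nodePotential_branch {a : Fin n} (ha : a ∈ A \ (P ∪ D))
    (h : Selection.leafPotential A B (nbr G A) k (insert a P) D +
      Selection.leafPotential A B (nbr G A) k P (insert a D) ≤
      Selection.leafPotential A B (nbr G A) k P D) :
    nodePotential G A B k (insert a P, D) + nodePotential G A B k (P, insert a D) + 1 ≤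
      nodePotential G A B k (P, D) := by
  have hu := card_sdiff_insert_right ha
  have hu' := card_sdiff_insert_left ha
  have h2 := Selection.one_le_leafPotential (A := A) (B := B) (N := nbr G A) (k := k) (P := P)
    (D := D)
  have e : #(A \ (insert a P ∪ D)) = #(A \ (P ∪ insert a D)) := by omega
  unfold nodePotential
  simp only [← hu, e]
  push_cast
  nlinarith [Nat.cast_nonneg (α := ℝ) #(A \ (P ∪ insert a D))]

theorem SearchState.expand {Q : Prop} {L : List (Finset (Fin n) × Finset (Fin n))}
    (hG₄ : HoldsGraph G T τ.mem) (hs₄ : HoldsNode A B P D (τ.var 6) τ.mem)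
    (hv : Selection.Valid A P D) (hAB : Disjoint A B)
    (hcard : #(A \ (P ∪ D)) + L.length ≤ n) (hst₄ : HoldsStack A B L τ.mem)
    (hk : Selection.lower A B (nbr G A) P D ≤ k) (h0₄ : τ.var 0 = 0) (h4₄ : τ.var 4 = k)
    (h5₄ : τ.var 5 = L.length + 1) (h6₄ : τ.var 6 = L.length)
    (hQ : Q ↔ Selection.Feasible A B (nbr G A) P D k ∨
      ∃ x ∈ L, Selection.Feasible A B (nbr G A) x.1 x.2 k)
    (hess : (∃ a ∈ Selection.activeA A B (nbr G A) P D,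
        Selection.Essential A B (nbr G A) P D a ∧ τ.var 12 = a) ∨
      (τ.var 12 = n ∧
        ∀ a ∈ Selection.activeA A B (nbr G A) P D, ¬ Selection.Essential A B (nbr G A) P D a)) :
    ∃ r', SearchState G T A B k Q r' (expandCmd.den n τ) ∧
      r' + 1 ≤ nodePotential G A B k (P, D) + (L.map (nodePotential G A B k)).sum := by
  have hsum := sum_nodePotential_nonneg (G := G) (A := A) (B := B) (k := k) L
  have hone := one_le_nodePotential (G := G) (A := A) (B := B) (k := k) (P, D)
  rcases hess with ⟨a, ha, hea, h12⟩ | ⟨h12, hno⟩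
  · rw [expandCmd, Cmd.den_ite_pos (by simp [h12]), Cmd.den_store (by simp only [Expr.eval_lit, cap]; omega)]
    simp only [Expr.eval_slotA, Expr.eval_var, Expr.eval_lit, h12, h6₄]
    rw [h6₄] at hs₄
    obtain ⟨haA, haP, haD, -⟩ := Selection.mem_activeA.1 ha
    have haU : a ∈ A \ (P ∪ D) := by simp [haA, haP, haD]
    have hu := card_sdiff_insert_right haU
    refine ⟨_, ⟨(P, insert a D) :: L, hG₄.updateSlot _ _ _, ⟨hv.insert_right haA haP, ?_,
      hs₄.insert_right haU, hst₄.congr fun c hc i => Function.update_of_ne (fun e => by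
        have := (slotAddr_inj e).1; omega) _ _⟩, h4₄, h5₄, rfl, Or.inr ⟨h0₄, ?_⟩⟩, ?_⟩
    · simp only; omega
    · rw [hQ, Selection.feasible_essential hv haA haP hea]
      simp
    · simp only [List.map_cons, List.sum_cons]
      have := nodePotential_essential (k := k) hv haU hea
      linarith
  rw [expandCmd, Cmd.den_ite_neg (by simp [h12]), Cmd.den_seq]
  obtain ⟨g, hg, hpick, hcase⟩ := pick_spec hG₄ hs₄ hv hAB
  rw [hpick]
  set σ₅ : Store := ⟨Function.update τ.var 13 g, τ.mem⟩ with hσ₅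
  have h0₅ : σ₅.var 0 = 0 := by simpa [hσ₅] using h0₄
  have h4₅ : σ₅.var 4 = k := by simpa [hσ₅] using h4₄
  have h5₅ : σ₅.var 5 = L.length + 1 := by simpa [hσ₅] using h5₄
  have h6₅ : σ₅.var 6 = L.length := by simpa [hσ₅] using h6₄
  rcases hcase with ⟨a, ha, rfl, hdeg⟩ | ⟨rfl, hempty⟩
  · rw [Cmd.den_ite_pos (by simp [hσ₅])]
    obtain ⟨haA, haP, haD, -⟩ := Selection.mem_activeA.1 ha
    have haU : a ∈ A \ (P ∪ D) := by simp [haA, haP, haD]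
    have hu := card_sdiff_insert_right haU
    have hu' := card_sdiff_insert_left haU
    obtain ⟨hG₆, hs₆, hs₆', hold, h0₆, h4₆, h5₆⟩ := split_spec (σ := σ₅) (T := T) (P := P) (D := D)
      hG₄ (by simpa [hσ₅] using hs₄) haU (by simp [hσ₅]) (by omega) (by omega)
    rw [h6₅] at hs₆ hold
    rw [h5₅] at hs₆' h5₆
    refine ⟨_, ⟨(insert a P, D) :: (P, insert a D) :: L, hG₆, ⟨hv.insert_left haA haD, ?_,
      hs₆', hv.insert_right haA haP, ?_, hs₆, hst₄.congr hold⟩, by rw [h4₆, h4₅], by simpa using h5₆,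
      rfl, Or.inr ⟨by rw [h0₆, h0₅], ?_⟩⟩, ?_⟩
    · simp only [List.length_cons]; omega
    · simp only; omega
    · rw [hQ, Selection.feasible_branch a]
      simp [or_assoc]
    · simp only [List.map_cons, List.sum_cons]
      have := nodePotential_branch haU (Selection.leafPotential_branch hv nbr_subset hk hno ha hdeg)
      linarith
  · rw [Cmd.den_ite_neg (by simp [hσ₅]), Cmd.den_seq, Cmd.den_set (by simp),
      Cmd.den_set (by simp [cap])]
    -- Without active vertices the bound is attained, and it is within the budget; the answer is yes
    -- and the rest of the stack is discarded.
    refine ⟨0, ⟨[], hG₄, trivial, by simp [h4₅], by simp, by simp, Or.inl ⟨by simp, ?_, rfl⟩⟩, by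
      linarith⟩
    rw [hQ]
    exact Or.inl (Selection.feasible_of_activeB_eq_empty hv
      (Selection.activeB_eq_empty nbr_subset hempty) hk)

/-- A node beyond the budget is popped, which removes a potential of at least one; any other node is
handled by `SearchState.expand`. -/
theorem SearchState.step {Q : Prop} {r : ℝ} (hkn : k ≤ n) (hAB : Disjoint A B)
    (h : SearchState G T A B k Q r σ) (h5 : 0 < σ.var 5) :
    ∃ r', SearchState G T A B k Q r' (searchStep.den n σ) ∧ r' + 1 ≤ r := by
  obtain ⟨L, hG, hst, h4, hL, rfl, hans⟩ := h
  obtain _ | ⟨⟨P, D⟩, L⟩ := L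
  · simp at hL; omega
  obtain ⟨hv, hcard, hs, hst⟩ := hst
  simp only at hv hcard hs
  obtain ⟨h0, hQ⟩ : σ.var 0 = 0 ∧ (Q ↔ Selection.Feasible A B (nbr G A) P D k ∨
      ∃ x ∈ L, Selection.Feasible A B (nbr G A) x.1 x.2 k) := by
    rcases hans with ⟨-, -, h⟩ | h
    · cases h
    · simpa using h
  simp only [List.length_cons] at hL
  simp only [List.map_cons, List.sum_cons]
  have hsum := sum_nodePotential_nonneg (G := G) (A := A) (B := B) (k := k) L
  have hone := one_le_nodePotential (G := G) (A := A) (B := B) (k := k) (P, D)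
  rw [searchStep, Cmd.den_seq, Cmd.den_set (by simp [hL]; exact le_cap (by omega)), Cmd.den_seq]
  simp only [Expr.eval_sub, Expr.eval_var, Expr.eval_lit, hL, Nat.add_sub_cancel]
  set σ₁ : Store := ⟨Function.update σ.var 6 L.length, σ.mem⟩ with hσ₁
  have hs₁ : HoldsNode A B P D (σ₁.var 6) σ₁.mem := by simpa [hσ₁] using hs
  obtain ⟨hl, hls⟩ := lowerCmd_spec (σ := σ₁) (T := T) hG hs₁ hv hAB
  have hvar : ∀ x ∉ lowerCmd.writes, (lowerCmd.den n σ₁).var x = σ₁.var x :=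
    fun x hx => Cmd.den_var hx
  generalize lowerCmd.den n σ₁ = σ₂ at hl hls hvar ⊢
  have h0₂ : σ₂.var 0 = 0 := by rw [hvar 0 (by decide)]; simpa [hσ₁] using h0
  have h4₂ : σ₂.var 4 = k := by rw [hvar 4 (by decide)]; simpa [hσ₁] using h4
  have h5₂ : σ₂.var 5 = L.length + 1 := by rw [hvar 5 (by decide)]; simpa [hσ₁] using hL
  have h6₂ : σ₂.var 6 = L.length := by rw [hvar 6 (by decide)]; simp [hσ₁]
  have hG₂ := hG.sameData hls
  have hs₂ := hs.sameData hls
  have hst₂ : HoldsStack A B L σ₂.mem := hst.congr fun c _ i => hls.slot c i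
  by_cases hk : Selection.lower A B (nbr G A) P D ≤ k
  swap
  · rw [Cmd.den_ite_neg (by simpa [hl, h4₂] using hk),
      Cmd.den_set (by simp [h5₂]; exact le_cap (by omega))]
    refine ⟨_, ⟨L, hG₂, hst₂, by simp [h4₂], by simp [h5₂], rfl, Or.inr ⟨by simp [h0₂], ?_⟩⟩, by
      linarith⟩
    rw [hQ, or_iff_right fun h => hk h.lower_le]
  have hlow : σ₂.var 7 ≤ cap n := by
    rw [hl]; exact le_cap (hk.trans hkn)
  rw [Cmd.den_ite_pos (by simpa [hl, h4₂] using hk), Cmd.den_seq, Cmd.den_set (by simpa),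
    Cmd.den_seq, Cmd.den_set (by simpa using le_cap le_rfl), Cmd.den_seq]
  simp only [Expr.eval_var, Expr.eval_size]
  set σ₃ : Store := ⟨Function.update (Function.update σ₂.var 8 (σ₂.var 7)) 12 n, σ₂.mem⟩ with hσ₃
  have hscan := scan_spec (σ := σ₃) (T := T) (P := P) (D := D) hG₂
    (by simpa [hσ₃, h6₂] using hs₂) hv hAB (by simp [hσ₃, hl]) (by simp [hσ₃])
  have hvar₃ : ∀ x ∉ (Cmd.loop 18 scanStep).writes,
      ((Cmd.loop 18 scanStep).den n σ₃).var x = σ₃.var x := fun x hx => Cmd.den_var hx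
  generalize (Cmd.loop 18 scanStep).den n σ₃ = σ₄ at hscan hvar₃ ⊢
  have h0₄ : σ₄.var 0 = 0 := by rw [hvar₃ 0 (by decide)]; simpa [hσ₃] using h0₂
  have h4₄ : σ₄.var 4 = k := by rw [hvar₃ 4 (by decide)]; simpa [hσ₃] using h4₂
  have h5₄ : σ₄.var 5 = L.length + 1 := by rw [hvar₃ 5 (by decide)]; simpa [hσ₃] using h5₂
  have h6₄ : σ₄.var 6 = L.length := by rw [hvar₃ 6 (by decide)]; simpa [hσ₃] using h6₂
  obtain ⟨hsame, hess⟩ := hscan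
  have hG₄ := hG₂.sameData hsame
  have hs₄ : HoldsNode A B P D (σ₄.var 6) σ₄.mem := by
    rw [h6₄]; exact hs₂.sameData hsame
  have hst₄ : HoldsStack A B L σ₄.mem := hst₂.congr fun c _ i => hsame.slot c i
  exact SearchState.expand hG₄ hs₄ hv hAB hcard hst₄ hk h0₄ h4₄ h5₄ h6₄ hQ hess

end

end RAM

/-! ### Preparation of the search -/

namespace RAM

open Finset

open RAM.Expr RAM.Cmd in
/-- Reading of the budget: the variable `1` is the budget, or both are at least `n`. -/
def readCmd : Cmd :=
  seq (set 1 (lit 0)) <|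
  seq (set 3 (lit 1)) <|
  seq (loop 14 <|
    seq (ite (lt (lit 1) (load (add baseE (var 14)))) (set 1 (add (var 1) (var 3))) skip)
      (set 3 (add (var 3) (var 3)))) <|
  ite (load (add baseE size)) (set 1 (add (var 1) size)) skip

namespace Expr

/-- Is the degree of the vertex `x` at least the value of the variable `t`? -/
def big (t x : ℕ) : Expr := le (var t) (cnt 25 (adj (var x) (var 25)))

/-- Is there a split partition with the threshold `22`? -/
def isSplit : Expr :=
  all 26 <| all 27 <| or (eq (var 26) (var 27)) <|
    and (or (not (and (big 22 26) (big 22 27))) (adj (var 26) (var 27)))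
      (or (or (big 22 26) (big 22 27)) (not (adj (var 26) (var 27))))

/-- The size of the clique. -/
def cardK : Expr := cnt 20 (big 2 20)

/-- The number of terminals in the clique. -/
def cardKT : Expr := cnt 20 (and (big 2 20) (term (var 20)))

/-- The number of vertices in the clique that are not terminals. -/
def cardA : Expr := cnt 20 (and (big 2 20) (not (term (var 20))))

/-- The number of terminals outside of the clique. -/
def cardB : Expr := cnt 20 (and (term (var 20)) (not (big 2 20)))

/-- The size of `pairSet`. -/
def cardPair : Expr :=
  cnt 20 (and (not (big 2 20)) (and (adj (var 28) (var 20)) (and (adj (var 29) (var 20))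
    (or (term (var 28)) (or (term (var 29)) (term (var 20)))))))

/-- Is there a solution that leaves at most two vertices of the clique? -/
def easy : Expr :=
  or (le cardK (add (var 1) (lit 1))) <|
  ex 28 <| ex 29 <| and (big 2 28) <| and (big 2 29) <| and (not (eq (var 28) (var 29))) <|
    le (add cardK cardPair) (add (var 1) (lit 2))

/-- The smaller one of two values. -/
def min (e f : Expr) : Expr := sub e (sub e f)

end Expr

open RAM.Expr RAM.Cmd in
/-- The root of the search tree. -/
def rootCmd : Cmd :=
  seq (set 4 (Expr.min (sub (var 1) cardKT) (Expr.min cardA cardB))) <|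
  seq (loop 14 <|
    ite (big 2 14)
      (ite (term (var 14)) (store (slotA (lit 0) (var 14)) (lit 4))
        (store (slotA (lit 0) (var 14)) (lit 0)))
      (ite (term (var 14)) (store (slotA (lit 0) (var 14)) (lit 3))
        (store (slotA (lit 0) (var 14)) (lit 4)))) <|
  set 5 (lit 1)

open RAM.Expr RAM.Cmd in
/-- The preparation of the search. -/
def prepareCmd : Cmd :=
  seq readCmd <|
  seq (set 2 (first 24 22 isSplit)) <|
  ite (load (lit 1)) skip <|
  ite easy (set 0 (lit 1)) <|
  ite (le cardKT (var 1)) rootCmd skip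

/-! ### Correctness of the preparation -/

section

variable {n k t : ℕ} {A B K T : Finset (Fin n)} {G : SimpleGraph (Fin n)} [DecidableRel G.Adj]
  {σ : Store} {m v : ℕ → ℕ}

/-- The memory holds the digits of `k`. -/
def HoldsNumber (n k : ℕ) (m : ℕ → ℕ) : Prop :=
  ∀ i ≤ n, (1 < m (base n + i) ↔ k.testBit i = true) ∧ (0 < m (base n + i) ↔ 2 ^ i ≤ k)

theorem mod_two_pow_succ (k i : ℕ) :
    k % 2 ^ (i + 1) = k % 2 ^ i + if k.testBit i then 2 ^ i else 0 := by
  rw [Nat.mod_pow_succ, ← Nat.toNat_testBit]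
  cases k.testBit i <;> simp

/-- Only `n` digits are read, with all values saturating at `cap n`. An overflow implies that the
true budget is at least `n`, and then its exact value is irrelevant. -/
theorem readCmd_spec (h : HoldsNumber n k σ.mem) :
    (readCmd.den n σ).mem = σ.mem ∧
      ((readCmd.den n σ).var 1 = k ∨ (n ≤ (readCmd.den n σ).var 1 ∧ n ≤ k)) := by
  set c : Cmd := .seq (.ite (.lt (.lit 1) (.load (.add .baseE (.var 14))))
    (.set 1 (.add (.var 1) (.var 3))) .skip) (.set 3 (.add (.var 3) (.var 3))) with hc
  have key := Cmd.den_loop (n := n) (x := 14) (c := c)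
    (σ := (Cmd.set 3 (.lit 1)).den n ((Cmd.set 1 (.lit 0)).den n σ))
    (fun i τ => τ.mem = σ.mem ∧ τ.var 1 = min (k % 2 ^ i) (cap n) ∧ τ.var 3 = min (2 ^ i) (cap n))
    ⟨rfl, by simp [Cmd.den, Nat.mod_one], by simp [Cmd.den]⟩ ?_
  · rw [readCmd, Cmd.den_seq, Cmd.den_seq, Cmd.den_seq]
    generalize (Cmd.loop 14 c).den n _ = τ at key ⊢
    obtain ⟨h1, h2, -⟩ := key
    have hn := (h n le_rfl).2
    -- A further digit is present exactly if `2 ^ n ≤ k`; adding `n` then makes the stored value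
    -- large enough.
    by_cases hk : 2 ^ n ≤ k
    · rw [Cmd.den_ite_pos (by
        simp only [Expr.holds_load, Expr.eval_add, Expr.eval_baseE, Expr.eval_size, h1]
        exact hn.2 hk)]
      refine ⟨h1, Or.inr ⟨?_, Nat.lt_two_pow_self.le.trans hk⟩⟩
      simp [Cmd.den, cap]
      omega
    · rw [Cmd.den_ite_neg (by
        simp only [Expr.holds_load, Expr.eval_add, Expr.eval_baseE, Expr.eval_size, h1]
        exact mt hn.1 hk)]
      refine ⟨h1, ?_⟩
      simp only [Cmd.den, h2]
      rw [Nat.mod_eq_of_lt (not_le.1 hk)]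
      unfold cap
      omega
  · rintro i τ ⟨h1, h2, h3⟩
    have hi := (h i i.2.le).1
    have e : (Expr.lt (.lit 1) (.load (.add .baseE (.var 14)))).Holds n
        (Function.update τ.var 14 i) τ.mem ↔ k.testBit i = true := by
      rw [← hi, Expr.holds_lt]
      simp [h1]
    have hpow : (2 : ℕ) ^ ((i : ℕ) + 1) = 2 ^ (i : ℕ) + 2 ^ (i : ℕ) := by ring
    rw [hc, Cmd.den_seq]
    by_cases hb : k.testBit i = true
    · rw [Cmd.den_ite_pos (e.2 hb)]
      refine ⟨h1, ?_, ?_⟩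
      · simp only [Cmd.den, mod_two_pow_succ, hb, if_true]
        simp [h2, h3]
        omega
      · simp [Cmd.den, h3, hpow]
        omega
    · rw [Cmd.den_ite_neg (mt e.1 hb)]
      refine ⟨h1, ?_, ?_⟩
      · simp only [Cmd.den, mod_two_pow_succ, hb]
        simp [h2]
      · simp [Cmd.den, h3, hpow]
        omega

theorem Expr.holds_big (hG : HoldsGraph G T m) {x : ℕ} {i : Fin n} (hx : x ≠ 25)
    (hi : v x = i) : (big t x).Holds n v m ↔
      i ∈ ({w | v t ≤ #{u | G.Adj w u}} : Finset (Fin n)) := by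
  rw [big, Expr.holds_le, Expr.eval_var, mem_filter_univ]
  rw [Expr.eval_cnt_eq (s := ({u | G.Adj i u} : Finset (Fin n)))]
  intro j
  rw [Expr.holds_adj hG (i := i) (j := j) (by simp [Function.update_of_ne hx, hi]) (by simp)]
  simp

theorem Expr.holds_isSplit (hG : HoldsGraph G T m) : isSplit.Holds n v m ↔
    SplitGraph.IsPartition G {w | v 22 ≤ #{u | G.Adj w u}} := by
  set K : Finset (Fin n) := {w | v 22 ≤ #{u | G.Adj w u}} with hK
  have h : isSplit.Holds n v m ↔ ∀ i j : Fin n, i = j ∨ ((¬ (i ∈ K ∧ j ∈ K) ∨ G.Adj i j) ∧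
      ((i ∈ K ∨ j ∈ K) ∨ ¬ G.Adj i j)) := by
    rw [isSplit, Expr.holds_all]
    refine forall_congr' fun i => ?_
    rw [Expr.holds_all]
    refine forall_congr' fun j => ?_
    simp only [Expr.holds_or, Expr.holds_and, Expr.holds_not, Expr.holds_eq]
    rw [Expr.holds_adj hG (i := i) (j := j) (by simp) (by simp),
      Expr.holds_big hG (i := i) (by decide) (by simp),
      Expr.holds_big hG (i := j) (by decide) (by simp)]
    simp only [Expr.eval_var, Function.update_self, ne_eq, Nat.reduceEqDiff, not_false_eq_true,
      Function.update_of_ne, ← hK, Fin.val_inj]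
  rw [h]
  constructor
  · intro h
    refine ⟨fun u hu w hw hne => ?_, fun u hu w hw => ?_⟩
    · have := h u w
      tauto
    · by_cases e : u = w
      · rw [e]; exact G.irrefl
      · have := h u w
        tauto
  · intro h i j
    by_cases e : i = j
    · exact Or.inl e
    · refine Or.inr ⟨?_, ?_⟩
      · have := h.clique i
        tauto
      · have := h.indep i
        tauto

/-- The program knows the clique `K`. -/
structure Clique (G : SimpleGraph (Fin n)) [DecidableRel G.Adj] (T K : Finset (Fin n))
    (v m : ℕ → ℕ) : Prop where
  graph : HoldsGraph G T m
  eq : K = ({w | v 2 ≤ #{u | G.Adj w u}} : Finset (Fin n))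

theorem Clique.update (h : Clique G T K v m) {x : ℕ} (hx : 2 ≠ x) (i : ℕ) :
    Clique G T K (Function.update v x i) m :=
  ⟨h.graph, by rw [Function.update_of_ne hx, h.eq]⟩

theorem Clique.holds (h : Clique G T K v m) {x : ℕ} {i : Fin n} (hx : x ≠ 25) (hi : v x = i) :
    (Expr.big 2 x).Holds n v m ↔ i ∈ K := by
  rw [Expr.holds_big h.graph hx hi, ← h.eq]

theorem Clique.eval_cardK (h : Clique G T K v m) : Expr.cardK.eval n v m = #K :=
  Expr.eval_cnt_eq fun i => (h.update (by decide) i).holds (by decide) (by simp)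

theorem Clique.eval_cardKT (h : Clique G T K v m) : Expr.cardKT.eval n v m = #(K ∩ T) :=
  Expr.eval_cnt_eq fun i => by
    rw [Expr.holds_and, (h.update (by decide) i).holds (i := i) (by decide) (by simp),
      Expr.holds_term h.graph (i := i) (by simp), mem_inter]

theorem Clique.eval_cardA (h : Clique G T K v m) : Expr.cardA.eval n v m = #(K \ T) :=
  Expr.eval_cnt_eq fun i => by
    rw [Expr.holds_and, (h.update (by decide) i).holds (i := i) (by decide) (by simp),
      Expr.holds_not, Expr.holds_term h.graph (i := i) (by simp), mem_sdiff]

theorem Clique.eval_cardB (h : Clique G T K v m) : Expr.cardB.eval n v m = #(T \ K) :=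
  Expr.eval_cnt_eq fun i => by
    rw [Expr.holds_and, Expr.holds_not,
      (h.update (by decide) i).holds (i := i) (by decide) (by simp),
      Expr.holds_term h.graph (i := i) (by simp), mem_sdiff]

theorem Clique.eval_cardPair (h : Clique G T K v m) {x y : Fin n} (hx : v 28 = x)
    (hy : v 29 = y) : Expr.cardPair.eval n v m = #(SplitGraph.pairSet G K T x y) :=
  Expr.eval_cnt_eq fun i => by
    simp only [Expr.holds_and, Expr.holds_or, Expr.holds_not]
    rw [(h.update (by decide) i).holds (i := i) (by decide) (by simp),
      Expr.holds_adj h.graph (i := x) (j := i) (by simpa using hx) (by simp),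
      Expr.holds_adj h.graph (i := y) (j := i) (by simpa using hy) (by simp),
      Expr.holds_term h.graph (i := x) (by simpa using hx),
      Expr.holds_term h.graph (i := y) (by simpa using hy),
      Expr.holds_term h.graph (i := i) (by simp), SplitGraph.pairSet, mem_filter_univ]

theorem Clique.holds_easy (h : Clique G T K v m) : Expr.easy.Holds n v m ↔
    #K ≤ v 1 + 1 ∨ ∃ x ∈ K, ∃ y ∈ K, x ≠ y ∧ #K + #(SplitGraph.pairSet G K T x y) ≤ v 1 + 2 := by
  rw [Expr.easy, Expr.holds_or, Expr.holds_le, h.eval_cardK, Expr.holds_ex]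
  refine or_congr Iff.rfl (exists_congr fun x => ?_)
  rw [Expr.holds_ex, ← exists_and_left]
  refine exists_congr fun y => ?_
  have h' := (h.update (x := 28) (by decide) x).update (x := 29) (by decide) y
  rw [Expr.holds_and, Expr.holds_and, Expr.holds_and, Expr.holds_not, Expr.holds_eq, Expr.holds_le,
    h'.holds (i := x) (by decide) (by simp), h'.holds (i := y) (by decide) (by simp),
    Expr.eval_add, h'.eval_cardK, h'.eval_cardPair (x := x) (y := y) (by simp) (by simp)]
  simp [Fin.ext_iff]

@[simp] theorem Expr.eval_min {e f : Expr} :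
    (Expr.min e f).eval n v m = Min.min (e.eval n v m) (f.eval n v m) := by
  simp only [Expr.min, Expr.eval_sub]
  omega

theorem rootCmd_spec (h : Clique G T K σ.var σ.mem) :
    (rootCmd.den n σ).var 0 = σ.var 0 ∧
      (rootCmd.den n σ).var 4 = min (σ.var 1 - #(K ∩ T)) (min #(K \ T) #(T \ K)) ∧
      (rootCmd.den n σ).var 5 = 1 ∧ HoldsGraph G T (rootCmd.den n σ).mem ∧
      HoldsNode (K \ T) (T \ K) ∅ ∅ 0 (rootCmd.den n σ).mem := by
  have hA : #(K \ T) ≤ n := by simpa using card_le_univ (K \ T)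
  rw [rootCmd, Cmd.den_seq, Cmd.den_set (by
    simp only [Expr.eval_min, h.eval_cardA]
    exact le_cap (by omega)), Cmd.den_seq, Cmd.den_set (by simp [cap])]
  simp only [Expr.eval_min, Expr.eval_sub, h.eval_cardA, h.eval_cardB, h.eval_cardKT, Expr.eval_var,
    Expr.eval_lit]
  generalize min (σ.var 1 - #(K ∩ T)) (min #(K \ T) #(T \ K)) = z
  have key := Cmd.den_loop (n := n) (x := 14)
    (c := .ite (.big 2 14)
      (.ite (.term (.var 14)) (.store (.slotA (.lit 0) (.var 14)) (.lit 4))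
        (.store (.slotA (.lit 0) (.var 14)) (.lit 0)))
      (.ite (.term (.var 14)) (.store (.slotA (.lit 0) (.var 14)) (.lit 3))
        (.store (.slotA (.lit 0) (.var 14)) (.lit 4))))
    (σ := ⟨Function.update σ.var 4 z, σ.mem⟩)
    (fun i τ => (τ.var 0 = σ.var 0 ∧ τ.var 4 = z) ∧ Clique G T K τ.var τ.mem ∧
      ∀ j : Fin n, (j : ℕ) < i → τ.mem (slotAddr n 0 j) = code (K \ T) (T \ K) ∅ ∅ j)
    ⟨⟨by simp, by simp⟩, h.update (by decide) _, by simp⟩ ?_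
  · generalize Cmd.den n _ _ = τ at key ⊢
    obtain ⟨⟨h1, h2⟩, h3, h4⟩ := key
    exact ⟨by simp [h1], by simp [h2], by simp, h3.graph, fun j => h4 j j.2⟩
  · rintro i τ ⟨⟨h1, h2⟩, h3, h4⟩
    have h3' := h3.update (x := 14) (by decide) i
    have hK := h3'.holds (x := 14) (i := i) (by decide) (by simp)
    have hT := Expr.holds_term (e := .var 14) (v := Function.update τ.var 14 i) h3'.graph (i := i)
      (by simp)
    have hstore : ∀ x ≤ 4, x = code (K \ T) (T \ K) ∅ ∅ i →
        (fun i τ => (τ.var 0 = σ.var 0 ∧ τ.var 4 = z) ∧ Clique G T K τ.var τ.mem ∧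
        ∀ j : Fin n, (j : ℕ) < i → τ.mem (slotAddr n 0 j) = code (K \ T) (T \ K) ∅ ∅ j) (i + 1)
          ((Cmd.store (.slotA (.lit 0) (.var 14)) (.lit x)).den n
            ⟨Function.update τ.var 14 i, τ.mem⟩) := by
      intro x hx hxc
      rw [Cmd.den_store (by simp only [Expr.eval_lit, cap]; omega)]
      simp only [Expr.eval_slotA, Expr.eval_var, Expr.eval_lit, Function.update_self]
      refine ⟨⟨by simp [h1], by simp [h2]⟩, ⟨h3'.graph.updateSlot _ _ _, h3'.eq⟩, fun j hj => ?_⟩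
      by_cases hji : j = i
      · rw [hji, Function.update_self, hxc]
      · rw [Function.update_of_ne (mt slotAddr_inj_iff.1 hji), h4 j ?_]
        have : (j : ℕ) ≠ i := fun e => hji (Fin.ext e)
        omega
    by_cases hiK : i ∈ K
    · rw [Cmd.den_ite_pos (hK.2 hiK)]
      by_cases hiT : i ∈ T
      · rw [Cmd.den_ite_pos (hT.2 hiT)]
        exact hstore 4 (by decide) (by simp [code, hiK, hiT])
      · rw [Cmd.den_ite_neg (mt hT.1 hiT)]
        exact hstore 0 (by decide) (by simp [code, hiK, hiT])
    · rw [Cmd.den_ite_neg (mt hK.1 hiK)]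
      by_cases hiT : i ∈ T
      · rw [Cmd.den_ite_pos (hT.2 hiT)]
        exact hstore 3 (by decide) (by simp [code, hiK, hiT])
      · rw [Cmd.den_ite_neg (mt hT.1 hiT)]
        exact hstore 4 (by decide) (by simp [code, hiK, hiT])

/-- Finding the clique. -/
theorem threshold_spec (hG : HoldsGraph G T σ.mem) (hs : G.IsSplitGraph) :
    ∃ t K, (Cmd.set 2 (.first 24 22 .isSplit)).den n σ = ⟨Function.update σ.var 2 t, σ.mem⟩ ∧
      SplitGraph.IsPartition G K ∧ Clique G T K (Function.update σ.var 2 t) σ.mem := by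
  have h := Expr.eval_first (n := n) (x := 24) (y := 22) (e := .isSplit) (v := σ.var) (m := σ.mem)
    (fun j : Fin n => SplitGraph.IsPartition G {w | (j : ℕ) ≤ #{u | G.Adj w u}}) (by decide)
    (fun i j => by rw [Expr.holds_isSplit hG]; simp)
  rcases h with ⟨w, hw, hp⟩ | ⟨hw, hno⟩
  · rw [Cmd.den_set (by rw [hw]; exact le_cap w.2.le), hw]
    exact ⟨w, _, rfl, hp, hG, by simp⟩
  · rw [Cmd.den_set (by rw [hw]; exact le_cap le_rfl), hw]
    obtain ⟨t, ht, hp⟩ := SplitGraph.exists_threshold hs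
    rw [Fintype.card_fin] at ht
    -- If no threshold below `n` works, `first` returns `n`, which is then the only remaining
    -- candidate.
    rcases ht.lt_or_eq with ht | rfl
    · exact absurd hp (hno ⟨t, ht⟩)
    · exact ⟨t, _, rfl, hp, hG, by simp⟩

theorem SearchState.of_answer {Q : Prop} (hG : HoldsGraph G T σ.mem) (h5 : σ.var 5 = 0)
    (h : (σ.var 0 = 1 ∧ Q) ∨ (σ.var 0 = 0 ∧ ¬ Q)) :
    SearchState G T A B (σ.var 4) Q 0 σ :=
  ⟨[], hG, trivial, rfl, h5, by simp, h.imp (fun h => ⟨h.1, h.2, rfl⟩)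
    fun h => ⟨h.1, by simp [h.2]⟩⟩

/-- Every outcome is a state of the search: a decided instance has an empty stack and potential
zero, any other one has the root `(∅, ∅)` with the reduced budget. -/
theorem prepareCmd_spec {k : ℤ} (hG : HoldsGraph G T σ.mem) (hs : G.IsSplitGraph)
    (hk : HoldsNumber n k.natAbs σ.mem) (hneg : 0 < σ.mem 1 ↔ k < 0) (h0 : σ.var 0 = 0)
    (h4 : σ.var 4 = 0) (h5 : σ.var 5 = 0) :
    ∃ A B, Disjoint A B ∧ ∃ b ≤ n, ∃ r ≤ (2 * n + 1) * (2 * (1.3497 : ℝ) ^ n),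
      SearchState G T A B b (HasSubsetFVSOfSizeAtMost G T k) r (prepareCmd.den n σ) := by
  rw [prepareCmd, Cmd.den_seq]
  obtain ⟨hmem, hread⟩ := readCmd_spec hk
  have hvar : ∀ x ∉ readCmd.writes, (readCmd.den n σ).var x = σ.var x := fun x hx => Cmd.den_var hx
  generalize readCmd.den n σ = σ₁ at hmem hread hvar ⊢
  have h0₁ : σ₁.var 0 = 0 := by rw [hvar 0 (by decide), h0]
  have h4₁ : σ₁.var 4 = 0 := by rw [hvar 4 (by decide), h4]
  have h5₁ : σ₁.var 5 = 0 := by rw [hvar 5 (by decide), h5]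
  rw [← hmem] at hG hneg
  obtain ⟨t, K, hset, hK, hC⟩ := threshold_spec hG hs
  rw [Cmd.den_seq, hset]
  set σ₂ : Store := ⟨Function.update σ₁.var 2 t, σ₁.mem⟩ with hσ₂
  have h0₂ : σ₂.var 0 = 0 := by simpa [hσ₂] using h0₁
  have h4₂ : σ₂.var 4 = 0 := by simpa [hσ₂] using h4₁
  have h5₂ : σ₂.var 5 = 0 := by simpa [hσ₂] using h5₁
  have h1₂ : σ₂.var 1 = σ₁.var 1 := by simp [hσ₂]
  change 0 < σ₂.mem 1 ↔ _ at hneg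
  change HoldsGraph G T σ₂.mem at hG
  change Clique G T K σ₂.var σ₂.mem at hC
  rw [← h1₂] at hread
  have hbound : (0 : ℝ) ≤ (2 * n + 1) * (2 * (1.3497 : ℝ) ^ n) := by positivity
  have hdisj : Disjoint (K \ T) (T \ K) := disjoint_sdiff_sdiff
  clear_value σ₂
  have hcard : ∀ S : Finset (Fin n), #S ≤ n := fun S => by simpa using card_le_univ S
  by_cases hk0 : k < 0
  · rw [Cmd.den_ite_pos (by simpa [Expr.holds_load] using hneg.2 hk0)]
    have := SearchState.of_answer (A := K \ T) (B := T \ K) (Q := HasSubsetFVSOfSizeAtMost G T k) hG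
      h5₂ (Or.inr ⟨h0₂, fun ⟨S, hS, _⟩ => by omega⟩)
    rw [h4₂] at this
    exact ⟨_, _, hdisj, 0, Nat.zero_le _, 0, hbound, this⟩
  rw [Cmd.den_ite_neg (by simpa [Expr.holds_load] using mt hneg.1 hk0)]
  -- The stored budget may differ from `k` only if both are at least `n`, and no vertex set is
  -- larger than that.
  have hQ : HasSubsetFVSOfSizeAtMost G T k ↔
      ∃ S : Finset (Fin n), #S ≤ σ₂.var 1 ∧
        G.IsSubsetFeedbackVertexSet (T : Set (Fin n)) (S : Set (Fin n)) := by
    refine exists_congr fun S => and_congr_left fun _ => ?_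
    have := hcard S
    omega
  rw [SplitGraph.exists_iff hK, ← or_assoc] at hQ
  by_cases he : Expr.easy.Holds n σ₂.var σ₂.mem
  · rw [Cmd.den_ite_pos he, Cmd.den_set (by simp [cap])]
    have := SearchState.of_answer (A := K \ T) (B := T \ K) (Q := HasSubsetFVSOfSizeAtMost G T k)
      (σ := ⟨Function.update σ₂.var 0 1, σ₂.mem⟩) hG (by simpa using h5₂)
      (Or.inl ⟨by simp, hQ.2 (Or.inl (hC.holds_easy.1 he))⟩)
    exact ⟨_, _, hdisj, 0, Nat.zero_le _, 0, hbound, by simpa [h4₂] using this⟩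
  rw [Cmd.den_ite_neg he]
  rw [or_iff_right (mt hC.holds_easy.2 he)] at hQ
  by_cases hkt : #(K ∩ T) ≤ σ₂.var 1
  swap
  · rw [Cmd.den_ite_neg (by simpa [hC.eval_cardKT] using hkt)]
    have := SearchState.of_answer (A := K \ T) (B := T \ K) (Q := HasSubsetFVSOfSizeAtMost G T k) hG
      h5₂ (Or.inr ⟨h0₂, fun h => hkt (hQ.1 h).1⟩)
    rw [h4₂] at this
    exact ⟨_, _, hdisj, 0, Nat.zero_le _, 0, hbound, this⟩
  rw [Cmd.den_ite_pos (by simpa [hC.eval_cardKT] using hkt)]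
  rw [and_iff_right hkt] at hQ
  obtain ⟨r0, r4, r5, rG, rN⟩ := rootCmd_spec hC
  set b := min (σ₂.var 1 - #(K ∩ T)) (min #(K \ T) #(T \ K)) with hb
  refine ⟨_, _, hdisj, b, by have := hcard (K \ T); omega, _, ?_, [(∅, ∅)], rG,
    ⟨⟨empty_subset _, empty_subset _, disjoint_empty_left _⟩, by simpa using hcard (K \ T), rN,
      trivial⟩, r4, r5, rfl, Or.inr ⟨by rw [r0, h0₂], ?_⟩⟩
  · have h1 := Selection.leafPotential_empty_le (A := K \ T) (B := T \ K) (N := nbr G (K \ T))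
      (k := b) (by omega) (by omega)
    have h2 : #(K \ T) + #(T \ K) ≤ n := by
      rw [← card_union_of_disjoint hdisj]; exact hcard _
    have h3 : (1.3497 : ℝ) ^ (#(K \ T) + #(T \ K)) ≤ 1.3497 ^ n :=
      pow_le_pow_right₀ (by norm_num) h2
    have h4 : ((#(K \ T) : ℕ) : ℝ) ≤ n := by exact_mod_cast hcard _
    simp only [List.map_cons, List.map_nil, List.sum_cons, List.sum_nil, add_zero, nodePotential,
      union_empty, sdiff_empty]
    have h5 := (Selection.leafPotential_pos (A := K \ T) (B := T \ K) (N := nbr G (K \ T))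
      (k := b) (P := ∅) (D := ∅)).le
    have h6 : (0 : ℝ) ≤ #(K \ T) := by positivity
    exact mul_le_mul (by linarith) (by linarith) h5 (by positivity)
  · rw [hQ, show SplitGraph.nbrs G K T = nbr G (K \ T) from rfl,
      ← Selection.feasible_min_iff nbr_subset]
    simp [hb]

end

end RAM

/-! ### The input word -/

theorem List.getD_flatMap_of_length {α : Type*} (l : List α) (g : α → List ℕ) {n : ℕ}
    (hg : ∀ a, (g a).length = n) {i j : ℕ} (hj : j < n) (hi : i < l.length) :
    (l.flatMap g).getD (i * n + j) 0 = (g l[i]).getD j 0 := by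
  induction l generalizing i with
  | nil => simp at hi
  | cons a l ih =>
    rw [List.flatMap_cons]
    cases i with
    | zero => rw [List.getD_append _ _ _ _ (by rw [hg]; omega)]; simp
    | succ i =>
      have e : (i + 1) * n + j = n + (i * n + j) := by ring
      rw [List.getD_append_right _ _ _ _ (by rw [hg, e]; omega), hg, e, Nat.add_sub_cancel_left,
        ih (by simpa using hi)]
      simp

namespace RAM

open Finset

section

variable {n : ℕ} (G : SimpleGraph (Fin n)) [DecidableRel G.Adj] (T : Finset (Fin n)) (k : ℤ)

theorem sfvsInput_eq : sfvsInput G T k = [n, if k < 0 then 1 else 0] ++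
    ((List.finRange n).flatMap (fun i => (List.finRange n).map fun j => if G.Adj i j then 1 else 0)
    ++ ((List.finRange n).map (fun i => if i ∈ T then 1 else 0)
    ++ k.natAbs.bits.map (fun b : Bool => if b then 2 else 1))) := by
  unfold sfvsInput
  simp only [List.append_assoc]
  congr!

theorem getD_sfvsInput_zero : (sfvsInput G T k).getD 0 0 = n := by
  rw [sfvsInput_eq]; rfl

theorem getD_sfvsInput_one : (sfvsInput G T k).getD 1 0 = if k < 0 then 1 else 0 := by
  rw [sfvsInput_eq]; rfl

theorem getD_sfvsInput_add_two (i : ℕ) : (sfvsInput G T k).getD (2 + i) 0 =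
    ((List.finRange n).flatMap (fun i => (List.finRange n).map fun j => if G.Adj i j then 1 else 0)
    ++ ((List.finRange n).map (fun i => if i ∈ T then 1 else 0)
    ++ k.natAbs.bits.map (fun b : Bool => if b then 2 else 1))).getD i 0 := by
  rw [sfvsInput_eq, List.getD_append_right _ _ _ _ (by simp)]
  simp

theorem length_rows : ((List.finRange n).flatMap
    (fun i => (List.finRange n).map fun j => if G.Adj i j then 1 else 0)).length = n * n := by
  simp [List.length_flatMap]

theorem holdsGraph_sfvsInput : HoldsGraph G T fun i => (sfvsInput G T k).getD i 0 := by
  refine ⟨fun i j => ?_, fun i => ?_⟩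
  · have h : (i : ℕ) * n + j < n * n := by
      have := adj_addr_lt i j
      have h1 : (i : ℕ) * n + n ≤ n * n := by
        have := Nat.mul_le_mul_right n i.2
        rwa [Nat.succ_mul] at this
      have := j.2
      omega
    rw [getD_sfvsInput_add_two, List.getD_append _ _ _ _ (by rw [length_rows]; exact h),
      List.getD_flatMap_of_length _ _ (by simp) j.2 (by simp)]
    simp
  · rw [getD_sfvsInput_add_two, List.getD_append_right _ _ _ _ (by rw [length_rows]; omega),
      length_rows, Nat.add_sub_cancel_left, List.getD_append _ _ _ _ (by simp)]
    simp

theorem getD_sfvsInput_base (i : ℕ) : (sfvsInput G T k).getD (base n + i) 0 =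
    (k.natAbs.bits.map (fun b : Bool => if b then 2 else 1)).getD i 0 := by
  have e : base n + i = 2 + (n * n + (n + i)) := by unfold base; ring
  rw [e, getD_sfvsInput_add_two, List.getD_append_right _ _ _ _ (by rw [length_rows]; omega),
    length_rows, Nat.add_sub_cancel_left, List.getD_append_right _ _ _ _ (by simp)]
  simp

/-- `Nat.bits` has no leading zeros, so digit `i` is present exactly if `2 ^ i` is at most the
number. -/
theorem holdsNumber_sfvsInput :
    HoldsNumber n k.natAbs fun i => (sfvsInput G T k).getD i 0 := by
  intro i _
  simp only
  rw [getD_sfvsInput_base, ← Nat.lt_size, ← Nat.size_eq_bits_len, Nat.testBit_eq_inth]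
  by_cases h : i < k.natAbs.bits.length
  · rw [List.getD_eq_getElem _ _ (by simpa using h), List.getI_eq_getElem _ h, List.getElem_map]
    cases k.natAbs.bits[i] <;> simp [h]
  · rw [List.getD_eq_default _ _ (by simpa using h), List.getI_eq_default _ (not_lt.1 h)]
    simp [h]

theorem getD_sfvsInput_le (a : ℕ) : (sfvsInput G T k).getD a 0 ≤ cap n := by
  have h : ∀ x ∈ sfvsInput G T k, x ≤ cap n := by
    intro x hx
    rw [sfvsInput_eq] at hx
    simp only [List.cons_append, List.nil_append, List.mem_cons, List.mem_append, List.mem_flatMap,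
      List.mem_map] at hx
    unfold cap
    rcases hx with rfl | rfl | ⟨_, _, _, _, rfl⟩ | ⟨_, _, rfl⟩ | ⟨_, _, rfl⟩
    · omega
    all_goals split <;> omega
  rcases lt_or_ge a (sfvsInput G T k).length with ha | ha
  · rw [List.getD_eq_getElem _ _ ha]
    exact h _ (List.getElem_mem ha)
  · rw [List.getD_eq_default _ _ ha]
    exact Nat.zero_le _

end

/-! ### The algorithm -/

/-- The whole program. -/
def splitProg : Prog :=
  .seq (.const (tmp 0) 0) <|
  -- The first input cell is `n`; compiled code finds it in register `0`, which is overwritten only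
  -- by the final answer.
  .seq (.load 0 (tmp 0)) <|
  .seq (prepareCmd.compile 0) <|
  .seq (.whilePos (usr 5) (searchStep.compile 0)) <|
  .seq (.const (tmp 0) 0) (.arith .add 0 (usr 0) (tmp 0))

/-- A bound for the number of steps of the search. -/
noncomputable def searchBound (n : ℕ) : ℕ := ⌈(2 * n + 1) * (2 * (1.3497 : ℝ) ^ n)⌉₊

theorem splitProg_decides : ∃ f g : ℕ → ℕ, PolyBounded f ∧ PolyBounded g ∧
    ∀ (n : ℕ) (G : SimpleGraph (Fin n)) (T : Finset (Fin n)) (k : ℤ), G.IsSplitGraph →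
      splitProg.DecidesWithin (sfvsInput G T k) (HasSubsetFVSOfSizeAtMost G T k)
        (f n + (searchBound n + 1) * g n) := by
  classical
  obtain ⟨f, hf, hfs⟩ := prepareCmd.compile_spec
  obtain ⟨g, hg, hgs⟩ := searchStep.compile_spec
  refine ⟨fun n => 5 + n + f n, fun n => 1 + cap n + g n,
    ((PolyBounded.const 5).add .id).add hf, ((PolyBounded.const 1).add cap_polyBounded).add hg,
    fun n G T k hG => ?_⟩
  set m : ℕ → ℕ := fun i => (sfvsInput G T k).getD i 0 with hm
  have m0 : m 0 = n := getD_sfvsInput_zero G T k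
  let σ : Store := ⟨fun _ => 0, m⟩
  have hb : Bdd n σ := ⟨fun _ => Nat.zero_le _, getD_sfvsInput_le G T k⟩
  obtain ⟨A, B, hAB, b, hbn, r, hr, hst⟩ := prepareCmd_spec (σ := σ) (k := k)
    (holdsGraph_sfvsInput G T k) hG (holdsNumber_sfvsInput G T k)
    (by simp only [σ, hm, getD_sfvsInput_one]; split <;> simp [*]) rfl rfl rfl
  have key : splitProg.Runs (initState (sfvsInput G T k))
      (5 + n + f n + (searchBound n + 1) * (1 + cap n + g n))
      fun s => (HasSubsetFVSOfSizeAtMost G T k → s.reg 0 = 1) ∧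
        (¬ HasSubsetFVSOfSizeAtMost G T k → s.reg 0 = 0) := by
    have hmem : (initState (sfvsInput G T k)).mem = m := rfl
    have hreg : ∀ x, (initState (sfvsInput G T k)).reg x = 0 := fun x => rfl
    refine Prog.Runs.seq (b₁ := 1)
      (b₂ := 4 + n + f n + (searchBound n + 1) * (1 + cap n + g n)) (.const le_rfl (Eq.refl _))
      ?_ (by omega)
    rintro _ rfl
    refine Prog.Runs.seq (b₁ := 1 + n)
      (b₂ := 3 + f n + (searchBound n + 1) * (1 + cap n + g n))
      (.load (by simp [hmem, m0]) (Eq.refl _)) ?_ (by omega)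
    rintro _ rfl
    refine Prog.Runs.seq (b₁ := f n) (b₂ := 3 + (searchBound n + 1) * (1 + cap n + g n))
      (hfs n 0 σ _ hb ⟨?_, ?_, ?_⟩) ?_ (by omega)
    · simp [hmem, m0]
    · intro x; simp [hreg, σ]
    · simp [hmem, σ]
    rintro s₁ ⟨hr₁, -⟩
    refine Prog.Runs.seq (b₁ := (searchBound n + 1) * (1 + cap n + g n)) (b₂ := 3)
      (Prog.Runs.whileCmd
        (SearchState G T A B b (HasSubsetFVSOfSizeAtMost G T k))
        (fun σ s hb hr => (hgs n 0 σ s hb hr).mono le_rfl fun _ h => h.1)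
        (fun r σ h _ h5 => SearchState.step hbn hAB h h5)
        (fun r σ h => h.nonneg) (searchBound n) r _ s₁ hst (prepareCmd.den_bdd hb) hr₁
        (hr.trans (Nat.le_ceil _))) ?_ (by omega)
    rintro s₂ ⟨r', τ, hτ, hr₂, h5⟩
    have h0 := hr₂.var 0
    have hans := hτ.answer h5
    have hle : τ.var 0 ≤ 1 := by omega
    refine Prog.Runs.seq (b₁ := 1) (b₂ := 2) (.const le_rfl (Eq.refl _)) ?_ le_rfl
    rintro _ rfl
    refine .arith (by simp [h0]; omega) ?_
    simp only [State.setReg_reg, ArithOp.eval]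
    simp [h0]
    tauto
  obtain ⟨c, s, h1, h2, h3⟩ := key
  exact ⟨c, s, h1, h2, h3⟩

/-- The gap between `1.3497` and `1.350` absorbs all polynomial factors. -/
theorem searchBound_isBigO {f g : ℕ → ℕ} (hf : PolyBounded f) (hg : PolyBounded g) :
    (fun n : ℕ => ((f n + (searchBound n + 1) * g n : ℕ) : ℝ)) =O[Filter.atTop]
      (fun n : ℕ => (1.350 : ℝ) ^ n) := by
  have hq : PolyBounded fun n => f n + (4 * n + 4) * g n :=
    hf.add ((((PolyBounded.const 4).mul .id).add (.const 4)).mul hg)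
  obtain ⟨K, d, hq⟩ := hq
  have h := isLittleO_pow_const_mul_const_pow_const_pow_of_norm_lt (R := ℝ) d (r₁ := 1.3497)
    (r₂ := 1.350) (by norm_num)
  refine Asymptotics.IsBigO.trans (.of_bound (K * 2 ^ d) ?_) h.isBigO
  filter_upwards [Filter.eventually_ge_atTop 1] with n hn
  have hx : (1 : ℝ) ≤ 1.3497 ^ n := one_le_pow₀ (by norm_num)
  have hR : (searchBound n : ℝ) ≤ (2 * n + 1) * (2 * (1.3497 : ℝ) ^ n) + 1 :=
    (Nat.ceil_lt_add_one (by positivity)).le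
  have h1 : ((f n + (4 * n + 4) * g n : ℕ) : ℝ) ≤ K * (n + 1) ^ d := by exact_mod_cast hq n
  have h2 : ((n : ℝ) + 1) ^ d ≤ 2 ^ d * n ^ d := by
    rw [← mul_pow]
    have : (1 : ℝ) ≤ n := by exact_mod_cast hn
    gcongr
    linarith
  rw [Real.norm_of_nonneg (by positivity), Real.norm_of_nonneg (by positivity)]
  push_cast at h1 ⊢
  -- The additive `2` from the ceiling and the final test is at most `2 * 1.3497 ^ n`.
  have h3 : (searchBound n : ℝ) + 1 ≤ (4 * n + 4) * 1.3497 ^ n := by linarith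
  have h4 : (0 : ℝ) ≤ f n := by positivity
  calc (f n : ℝ) + (searchBound n + 1) * g n
      ≤ f n * 1.3497 ^ n + ((4 * n + 4) * 1.3497 ^ n) * g n := by
        gcongr
        exact le_mul_of_one_le_right h4 hx
    _ = (f n + (4 * n + 4) * g n) * 1.3497 ^ n := by ring
    _ ≤ (K * (n + 1) ^ d) * 1.3497 ^ n := by gcongr
    _ ≤ (K * (2 ^ d * n ^ d)) * 1.3497 ^ n := by gcongr
    _ = _ := by ring

end RAM

theorem mainTheorem5 :
    ∃ (p : RAM.Prog) (τ : ℕ → ℕ),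
      (fun n : ℕ => (τ n : ℝ)) =O[Filter.atTop] (fun n : ℕ => (1.350 : ℝ) ^ n) ∧
      ∀ (n : ℕ) (G : SimpleGraph (Fin n)) (T : Finset (Fin n)) (k : ℤ), G.IsSplitGraph →
        p.DecidesWithin (sfvsInput G T k) (HasSubsetFVSOfSizeAtMost G T k) (τ n) := by
  obtain ⟨f, g, hf, hg, h⟩ := RAM.splitProg_decides
  exact ⟨RAM.splitProg, _, RAM.searchBound_isBigO hf hg, h⟩
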